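/- For $d\ge 2$ let $\mathcal T_d$ be the $d$-regular rooted tree, with vertex set the finite words over $\Sigma=\{1,\dots,d\}$ and boundary $\partial\mathcal T_d=\Sigma^{\mathbb N}$, and let $\mu$ be the uniform Bernoulli measure on $\partial\mathcal T_d$. For a tree automorphism $g$ that fixes the first level write $g=(g_1,\dots,g_d)$ if $g(iw)=i\,g_i(w)$ for every $i\in\Sigma$ and every word $w$; let $a$ be the automorphism that permutes the $d$ top branches cyclically. Consider the following groups $G=\langle S\rangle$ with finite symmetric generating set $S$. - $\mathfrak G\le\operatorname{Aut}(\mathcal T_2)$, $S=\{a,b,c,d\}$, where $b=(a,c)$, $c=(a,d)$, $d=(1,b)$; - $\tilde{\mathfrak G}\le\operatorname{Aut}(\mathcal T_2)$, $S=\{a,\tilde b,\tilde c,\tilde d\}$, where $\tilde b=(a,\tilde c)$, $\tilde c=(1,\tilde d)$, $\tilde d=(1,\tilde b)$; - $\Gamma$, $\overline\Gamma$, $\overline{\overline\Gamma}\le\operatorname{Aut}(\mathcal T_3)$, with $S=\{a^{\pm1},t^{\pm1}\}$, where $t=(a,1,t)$ for $\Gamma$, $t=(a,a,t)$ for $\overline\Gamma$,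 and $t=(a,a^{-1},t)$ for $\overline{\overline\Gamma}$. Let $P\le G$ be the stabilizer of the infinite ray $ddd\cdots\in\partial\mathcal T_d$ (the last letter repeated). Let $M$ be the Markov operator of the Schreier graph of $(G,P,S)$, that is, the operator on $\ell^2(G/P)$ given by $(Mf)(v)=\frac1{|S|}\sum_{s\in S}f(sv)$, and let $H_\pi=\frac1{|S|}\sum_{s\in S}\pi(s)$ on $L^2(\partial\mathcal T_d,\mu)$, where $(\pi(g)f)(\xi)=f(g^{-1}\xi)$. For $\lambda\in\mathbb R$ let $J(\lambda)\subset\mathbb C$ be the Julia set of $z\mapsto z^2-\lambda$, and let $R(\lambda)$ be the set of all finite nested radicals $\pm\sqrt\lambda$, $\pm\sqrt{\lambda\pm\sqrt\lambda}$, $\pm\sqrt{\lambda\pm\sqrt{\lambda\pm\sqrt\lambda}}$, …, that is, $R(\lambda)=\bigcup_{n\ge1}\{z: f^n(z)=0\}$ for $f(z)=z^2-\lambda$. For each of the five groups the operators $M$ and $H_\pi$ have the same spectrum, which is: 1. for $\mathfrak G$: $[-\frac12,0]\cup[\frac12,1]$; 2. for $\tilde{\mathfrak G}$: $[0,1]$;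 3. for $\Gamma$: $\{1,\frac14\}\cup\frac14\bigl(1\pm\overline{R(6)}\bigr)$. This subset of $\mathbb R$ is the disjoint union of $\frac14(1\pm J(6))$, which is a Cantor set of Lebesgue measure zero, and of $\{\frac14\}\cup\frac14(1\pm R(6))$, all of whose points are isolated points of the spectrum; 4. for $\overline\Gamma$ and for $\overline{\overline\Gamma}$: $\{1,-\frac12,\frac14\}\cup\frac14\Bigl(1\pm\sqrt{\frac92\pm2J(\frac{45}{16})}\Bigr)$, which is a Cantor set of real numbers of Lebesgue measure zero. -/

import Mathlib

open scoped ENNReal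

noncomputable section

namespace FractalSpectra

open MeasureTheory

/-! Rooted trees, their automorphisms and boundaries. -/

/-- The automorphism group of the `d`-regular rooted tree with vertex set the finite words over
`Fin d`: the permutations of the words that preserve the level (the length) and the prefix order.
The letters `1, …, d` of the alphabet are written `0, …, d - 1`. -/
def TreeAut (d : ℕ) : Subgroup (Equiv.Perm (List (Fin d))) where
  carrier := {g | (∀ w, (g w).length = w.length) ∧ ∀ u v, g u <+: g v ↔ u <+: v}
  one_mem' := by simp
  mul_mem' := by
    rintro g h ⟨hg, hg'⟩ ⟨hh, hh'⟩
    exact ⟨fun w => by simp [hg, hh], fun u v => by simp [hg', hh']⟩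
  inv_mem' := by
    rintro g ⟨hg, hg'⟩
    refine ⟨fun w => ?_, fun u v => ?_⟩
    · rw [← hg (g⁻¹ w)]; simp
    · rw [← hg' (g⁻¹ u)]; simp

/-- The first `n` letters of an infinite word. -/
def initialWord {d : ℕ} (ξ : ℕ → Fin d) (n : ℕ) : List (Fin d) := List.ofFn fun i : Fin n => ξ i

theorem length_initialWord {d : ℕ} (ξ : ℕ → Fin d) (n : ℕ) : (initialWord ξ n).length = n := by
  simp [initialWord]

theorem getElem_initialWord {d : ℕ} (ξ : ℕ → Fin d) (n i : ℕ) (h : i < (initialWord ξ n).length) :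
    (initialWord ξ n)[i] = ξ i := by
  simp only [initialWord, List.getElem_ofFn]

theorem length_apply {d : ℕ} (g : TreeAut d) (w : List (Fin d)) :
    ((g : Equiv.Perm (List (Fin d))) w).length = w.length := g.2.1 w

/-- The action of a tree automorphism on the boundary `Σ^ℕ`: the `n`-th letter of the image of `ξ`
is the last letter of the image of the vertex of level `n + 1` on the ray `ξ`. -/
def boundaryAct {d : ℕ} (g : TreeAut d) (ξ : ℕ → Fin d) (n : ℕ) : Fin d :=
  ((g : Equiv.Perm (List (Fin d))) (initialWord ξ (n + 1)))[n]'(by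
    rw [length_apply, length_initialWord]; exact n.lt_succ_self)

theorem initialWord_prefix {d : ℕ} (ξ : ℕ → Fin d) {m n : ℕ} (h : m ≤ n) :
    initialWord ξ m <+: initialWord ξ n := by
  rw [List.prefix_iff_eq_take]
  apply List.ext_getElem
  · simp [initialWord, h]
  · intro i h1 h2
    simp [initialWord]

theorem initialWord_boundaryAct {d : ℕ} (g : TreeAut d) (ξ : ℕ → Fin d) (n : ℕ) :
    initialWord (boundaryAct g ξ) n = (g : Equiv.Perm (List (Fin d))) (initialWord ξ n) := by
  apply List.ext_getElem
  · rw [length_apply, length_initialWord, length_initialWord]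
  · intro i h1 h2
    rw [length_initialWord] at h1
    have hp := (g.2.2 _ _).2 (initialWord_prefix ξ (Nat.succ_le_of_lt h1))
    have hi : i < ((g : Equiv.Perm (List (Fin d))) (initialWord ξ (i + 1))).length := by
      rw [length_apply, length_initialWord]; exact i.lt_succ_self
    rw [← hp.getElem hi]
    simp [initialWord, boundaryAct]

theorem initialWord_injective {d : ℕ} {ξ η : ℕ → Fin d}
    (h : ∀ n, initialWord ξ n = initialWord η n) : ξ = η := by
  funext n
  have := congrFun (List.ofFn_injective (h (n + 1))) (Fin.last n)
  simpa using this

instance boundaryMulAction (d : ℕ) : MulAction (TreeAut d) (ℕ → Fin d) where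
  smul g ξ := boundaryAct g ξ
  one_smul ξ := initialWord_injective fun n => by
    change initialWord (boundaryAct _ _) n = _
    rw [initialWord_boundaryAct]; rfl
  mul_smul g h ξ := initialWord_injective fun n => by
    change initialWord (boundaryAct _ _) n = initialWord (boundaryAct _ (boundaryAct _ _)) n
    simp only [initialWord_boundaryAct]; rfl

/-! The uniform measure on the boundary, and the representation on `L²`. -/

/-- The uniform Bernoulli measure on the boundary `Σ^ℕ`. -/
def uniformMeasure (d : ℕ) [NeZero d] : Measure (ℕ → Fin d) :=
  Measure.infinitePi fun _ : ℕ => (PMF.uniformOfFintype (Fin d)).toMeasure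

instance (d : ℕ) [NeZero d] : IsProbabilityMeasure (uniformMeasure d) := by
  unfold uniformMeasure; infer_instance

/-- The cylinder `σΣ^ℕ` of a finite word `σ`. -/
def cylinder {d : ℕ} (w : List (Fin d)) : Set (ℕ → Fin d) := {ξ | initialWord ξ w.length = w}

theorem uniformMeasure_cylinder {d : ℕ} [NeZero d] (w : List (Fin d)) :
    uniformMeasure d (cylinder w) = ((d : ℝ≥0∞)⁻¹) ^ w.length := by
  have h : cylinder w = Set.pi ((Finset.range w.length : Finset ℕ) : Set ℕ)
      (fun i => if h : i < w.length then {w[i]} else Set.univ) := by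
    ext ξ
    simp only [cylinder, Set.mem_ofPred_eq, Set.mem_pi, Finset.coe_range, Set.mem_Iio]
    constructor
    · intro hw i hi
      rw [dif_pos hi, Set.mem_singleton_iff]
      have h2 : i < (initialWord ξ w.length).length := by rw [length_initialWord]; exact hi
      have : (initialWord ξ w.length)[i] = w[i] := by congr 1
      rw [← this]; simp [initialWord]
    · intro hw
      apply List.ext_getElem
      · rw [length_initialWord]
      · intro i h1 h2
        have := hw i h2
        rw [dif_pos h2, Set.mem_singleton_iff] at this
        rw [← this]; simp [initialWord]
  rw [h, uniformMeasure, Measure.infinitePi_pi _ (fun _ _ => MeasurableSet.of_discrete)]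
  rw [Finset.prod_congr rfl (g := fun _ => (d : ℝ≥0∞)⁻¹), Finset.prod_const, Finset.card_range]
  intro i hi
  rw [dif_pos (Finset.mem_range.1 hi), PMF.toMeasure_uniformOfFintype_apply _ (by measurability)]
  simp

theorem measurable_initialWord {d : ℕ} (n : ℕ) (w : List (Fin d)) :
    MeasurableSet {ξ : ℕ → Fin d | initialWord ξ n = w} := by
  have h : Measurable fun (ξ : ℕ → Fin d) (i : Fin n) => ξ i :=
    measurable_pi_lambda _ fun i => measurable_pi_apply _
  exact h (t := {v | List.ofFn v = w}) MeasurableSet.of_discrete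

theorem generateFrom_cylinder (d : ℕ) :
    (MeasurableSpace.pi : MeasurableSpace (ℕ → Fin d)) =
      MeasurableSpace.generateFrom (insert ∅ (Set.range (cylinder (d := d)))) := by
  apply le_antisymm
  · refine iSup_le fun i => ?_
    rintro _ ⟨t, -, rfl⟩
    have : (fun ξ : ℕ → Fin d => ξ i) ⁻¹' t =
        ⋃ w ∈ {w : List (Fin d) | ∃ h : w.length = i + 1, w[i] ∈ t}, cylinder w := by
      ext ξ
      simp only [Set.mem_preimage, Set.mem_iUnion, cylinder, Set.mem_ofPred_eq]
      constructor
      · intro h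
        exact ⟨initialWord ξ (i + 1), ⟨length_initialWord _ _, by rw [getElem_initialWord]; exact h⟩,
          by rw [length_initialWord]⟩
      · rintro ⟨w, ⟨hl, ht⟩, hw⟩
        have h2 : i < (initialWord ξ w.length).length := by rw [length_initialWord]; omega
        have h3 : (initialWord ξ w.length)[i] = w[i] := by congr 1
        rw [← h3] at ht
        rw [getElem_initialWord] at ht
        exact ht
    rw [this]
    exact MeasurableSet.biUnion (Set.to_countable _) fun w _ =>
      MeasurableSpace.measurableSet_generateFrom (Or.inr ⟨w, rfl⟩)
  · refine MeasurableSpace.generateFrom_le ?_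
    rintro _ (rfl | ⟨w, rfl⟩)
    · exact MeasurableSet.empty
    · exact measurable_initialWord _ _

theorem isPiSystem_cylinder (d : ℕ) :
    IsPiSystem (insert ∅ (Set.range (cylinder (d := d)))) := by
  have key : ∀ v w : List (Fin d), v.length ≤ w.length → (cylinder v ∩ cylinder w).Nonempty →
      cylinder v ∩ cylinder w = cylinder w := by
    rintro v w hl ⟨ξ, h1, h2⟩
    refine Set.inter_eq_right.2 fun η hη => ?_
    have e1 := List.prefix_iff_eq_take.1 (initialWord_prefix ξ hl)
    have e2 := List.prefix_iff_eq_take.1 (initialWord_prefix η hl)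
    simp only [cylinder, Set.mem_ofPred_eq] at h1 h2 hη ⊢
    rw [length_initialWord] at e1 e2
    rw [e2, hη, ← h2, ← e1, h1]
  rintro _ (rfl | ⟨v, rfl⟩) _ (rfl | ⟨w, rfl⟩) hne
  · simp at hne
  · simp at hne
  · simp at hne
  · rcases le_total v.length w.length with h | h
    · rw [key v w h hne]; exact Or.inr ⟨w, rfl⟩
    · rw [Set.inter_comm] at hne ⊢
      rw [key w v h hne]; exact Or.inr ⟨v, rfl⟩

theorem preimage_cylinder {d : ℕ} (g : TreeAut d) (w : List (Fin d)) :
    (fun ξ : ℕ → Fin d => g • ξ) ⁻¹' cylinder w =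
      cylinder (((g : Equiv.Perm (List (Fin d))).symm w)) := by
  have hl : ((g : Equiv.Perm (List (Fin d))).symm w).length = w.length := by
    rw [← length_apply g]; simp
  ext ξ
  change initialWord (boundaryAct g ξ) w.length = w ↔ initialWord ξ _ = _
  rw [initialWord_boundaryAct, hl, Equiv.eq_symm_apply]

theorem measurePreserving_smul {d : ℕ} [NeZero d] (g : TreeAut d) :
    MeasurePreserving (fun ξ : ℕ → Fin d => g • ξ) (uniformMeasure d) (uniformMeasure d) := by
  have hm : Measurable (fun ξ : ℕ → Fin d => g • ξ) := by
    rw [generateFrom_cylinder]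
    refine @measurable_generateFrom _ _ (MeasurableSpace.generateFrom _) _ _ ?_
    rintro _ (rfl | ⟨w, rfl⟩)
    · exact @MeasurableSet.empty _ (MeasurableSpace.generateFrom _)
    · rw [preimage_cylinder]
      exact MeasurableSpace.measurableSet_generateFrom (Or.inr ⟨_, rfl⟩)
  have : IsProbabilityMeasure ((uniformMeasure d).map fun ξ => g • ξ) :=
    Measure.isProbabilityMeasure_map hm.aemeasurable
  refine ⟨hm, ext_of_generate_finite _ (generateFrom_cylinder d) (isPiSystem_cylinder d) ?_
    (by simp)⟩
  rintro _ (rfl | ⟨w, rfl⟩)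
  · simp
  · rw [Measure.map_apply hm (show MeasurableSet (cylinder w) from measurable_initialWord _ _),
      preimage_cylinder,
      uniformMeasure_cylinder, uniformMeasure_cylinder]
    congr 1
    rw [← length_apply g]; simp

/-- The unitary operator `(π(g)f)(ξ) = f(g⁻¹ξ)` on `L²(∂T, μ)`. The measure is invariant under
`g`, so that the Radon–Nikodym factor in the general formula is `1`. -/
def boundaryRep {d : ℕ} [NeZero d] (g : TreeAut d) :
    Lp ℂ 2 (uniformMeasure d) →L[ℂ] Lp ℂ 2 (uniformMeasure d) :=
  (Lp.compMeasurePreservingₗᵢ ℂ (fun ξ => g⁻¹ • ξ) (measurePreserving_smul g⁻¹)).toContinuousLinearMap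

/-- The Hecke type operator `H_π = |S|⁻¹ ∑_{s ∈ S} π(s)` on `L²(∂T, μ)`. -/
def heckeOperator {d : ℕ} [NeZero d] (S : Finset (TreeAut d)) :
    Lp ℂ 2 (uniformMeasure d) →L[ℂ] Lp ℂ 2 (uniformMeasure d) :=
  ((S.card : ℂ)⁻¹) • ∑ s ∈ S, boundaryRep s

/-! Graphs, Schreier graphs and Markov operators. -/

/-- A graph with vertex set `V` and edge set `E`: every edge has a start, and there is an
involution of the edges. -/
structure EdgeGraph (V E : Type) where
  start : E → V
  inv : E → E
  inv_inv : ∀ e, inv (inv e) = e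

namespace EdgeGraph

variable {V E : Type}

/-- The end of an edge. -/
def finish (X : EdgeGraph V E) (e : E) : V := X.start (X.inv e)

/-- The number of edges that start at `v`. -/
def degree (X : EdgeGraph V E) (v : V) : ℕ := Nat.card {e : E // X.start e = v}

/-- The formula `(Mf)(v) = (deg v)⁻¹ ∑_{α(e) = v} f(ω(e))`, for functions on the vertices of a
locally finite graph. -/
def markovFun (X : EdgeGraph V E) (f : V → ℂ) (v : V) : ℂ :=
  ((X.degree v : ℂ)⁻¹) * ∑ᶠ e : {e : E // X.start e = v}, f (X.finish e)

end EdgeGraph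

/-- The Hilbert space `ℓ²(V)`. -/
abbrev EllTwo (V : Type) : Type := lp (fun _ : V => ℂ) 2

/-- The Schreier graph of `G` with respect to the subgroup `H` and the finite symmetric set `S`:
the vertices are the cosets `gH`, the edges are the pairs `(s, gH)`, the edge `(s, gH)` starts at
`gH`, and its inverse is `(s⁻¹, sgH)`. -/
def schreierGraph {G : Type} [Group G] (S : Finset G) (hS : ∀ s ∈ S, s⁻¹ ∈ S) (H : Subgroup G) :
    EdgeGraph (G ⧸ H) (S × (G ⧸ H)) where
  start e := e.2
  inv e := (⟨(e.1 : G)⁻¹, hS _ e.1.2⟩, (e.1 : G) • e.2)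
  inv_inv e := by simp

section Markov

variable {G : Type} [Group G] (S : Finset G) (hS : ∀ s ∈ S, s⁻¹ ∈ S) (H : Subgroup G)

/-- The edges of the Schreier graph that start at a vertex are labelled by `S`. -/
def schreierStar (v : G ⧸ H) : S ≃ {e : S × (G ⧸ H) // (schreierGraph S hS H).start e = v} where
  toFun s := ⟨(s, v), rfl⟩
  invFun e := e.1.1
  left_inv _ := rfl
  right_inv := by rintro ⟨⟨s, w⟩, h⟩; cases h; rfl

theorem markovFun_schreierGraph (f : G ⧸ H → ℂ) (v : G ⧸ H) :
    (schreierGraph S hS H).markovFun f v = ((S.card : ℂ)⁻¹) * ∑ s ∈ S, f (s • v) := by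
  have h1 : (schreierGraph S hS H).degree v = S.card := by
    rw [EdgeGraph.degree, ← Nat.card_congr (schreierStar S hS H v)]; simp
  have h2 : ∑ᶠ e : {e // (schreierGraph S hS H).start e = v},
      f ((schreierGraph S hS H).finish e) = ∑ s ∈ S, f (s • v) := by
    rw [← finsum_comp_equiv (schreierStar S hS H v), finsum_eq_sum_of_fintype,
      ← Finset.sum_coe_sort S fun s => f (s • v)]
    rfl
  rw [EdgeGraph.markovFun, h1, h2]

/-- Translation of the elements of `ℓ²(G/H)` by an element of `G`. -/
def translate (s : G) (f : EllTwo (G ⧸ H)) : EllTwo (G ⧸ H) :=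
  ⟨fun v => f (s • v), (memℓp_gen_iff (by simp)).2
    ((MulAction.toPerm s : Equiv.Perm (G ⧸ H)).summable_iff.2
      ((memℓp_gen_iff (by simp)).1 (lp.memℓp f)))⟩

theorem norm_translate (s : G) (f : EllTwo (G ⧸ H)) : ‖translate H s f‖ = ‖f‖ := by
  rw [lp.norm_eq_tsum_rpow (by simp), lp.norm_eq_tsum_rpow (by simp)]
  congr 1
  exact (MulAction.toPerm s : Equiv.Perm (G ⧸ H)).tsum_eq fun v => ‖f v‖ ^ (2 : ℝ≥0∞).toReal

theorem markovFun_eq_translate (f : EllTwo (G ⧸ H)) :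
    (schreierGraph S hS H).markovFun f =
      (((S.card : ℂ)⁻¹) • ∑ s ∈ S, translate H s f : EllTwo (G ⧸ H)) := by
  funext v
  rw [markovFun_schreierGraph, lp.coeFn_smul, Pi.smul_apply, lp.coeFn_sum, Finset.sum_apply]
  rfl

theorem memℓp_markovFun (f : EllTwo (G ⧸ H)) :
    Memℓp ((schreierGraph S hS H).markovFun f) 2 := by
  rw [markovFun_eq_translate]; exact lp.memℓp _

/-- The Markov operator of the Schreier graph, a bounded operator on `ℓ²(G/H)`. -/
def schreierMarkov : EllTwo (G ⧸ H) →L[ℂ] EllTwo (G ⧸ H) :=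
  LinearMap.mkContinuous
    { toFun := fun f => ⟨(schreierGraph S hS H).markovFun f, memℓp_markovFun S hS H f⟩
      map_add' := fun f g => by
        ext v
        change (schreierGraph S hS H).markovFun (fun w => f w + g w) v =
          (schreierGraph S hS H).markovFun f v + (schreierGraph S hS H).markovFun g v
        simp [markovFun_schreierGraph, Finset.sum_add_distrib, mul_add]
      map_smul' := fun c f => by
        ext v
        change (schreierGraph S hS H).markovFun (fun w => c * f w) v =
          c * (schreierGraph S hS H).markovFun f v
        simp [markovFun_schreierGraph, ← Finset.mul_sum, mul_left_comm] }
    1 (fun f => by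
      have : (⟨(schreierGraph S hS H).markovFun f, memℓp_markovFun S hS H f⟩ : EllTwo (G ⧸ H)) =
          ((S.card : ℂ)⁻¹) • ∑ s ∈ S, translate H s f :=
        Subtype.ext (markovFun_eq_translate S hS H f)
      change ‖(⟨(schreierGraph S hS H).markovFun f, memℓp_markovFun S hS H f⟩ :
        EllTwo (G ⧸ H))‖ ≤ _
      rw [this, norm_smul, one_mul]
      have h : ‖∑ s ∈ S, translate H s f‖ ≤ S.card * ‖f‖ := by
        refine (norm_sum_le _ _).trans (le_of_eq ?_)
        simp [norm_translate]
      refine (mul_le_mul_of_nonneg_left h (norm_nonneg _)).trans ?_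
      rw [← mul_assoc]
      refine mul_le_of_le_one_left (norm_nonneg _) ?_
      rw [norm_inv, Complex.norm_natCast]
      exact inv_mul_le_one)

end Markov

/-! Groups generated by finite sets of tree automorphisms. -/

/-- The finite set `S` as a set of elements of the group `⟨S⟩`. -/
def generatorsIn {d : ℕ} (S : Finset (TreeAut d)) :
    Finset (Subgroup.closure (S : Set (TreeAut d))) :=
  S.attach.map ⟨fun s => ⟨s.1, Subgroup.subset_closure (Finset.mem_coe.2 s.2)⟩,
    fun _ _ h => Subtype.ext (Subtype.mk.inj h)⟩

theorem generatorsIn_symm {d : ℕ} {S : Finset (TreeAut d)} (hS : ∀ s ∈ S, s⁻¹ ∈ S) :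
    ∀ s ∈ generatorsIn S, s⁻¹ ∈ generatorsIn S := by
  intro s hs
  simp only [generatorsIn, Finset.mem_map, Finset.mem_attach, true_and] at hs ⊢
  obtain ⟨⟨t, ht⟩, rfl⟩ := hs
  exact ⟨⟨t⁻¹, hS t ht⟩, rfl⟩

/-- The parabolic subgroup `P` of the group `⟨S⟩`: the stabilizer of the ray `ddd…`, where
`d = k + 1` is the last letter. -/
def parabolic {k : ℕ} (S : Finset (TreeAut (k + 1))) :
    Subgroup (Subgroup.closure (S : Set (TreeAut (k + 1)))) :=
  MulAction.stabilizer _ (fun _ => Fin.last k : ℕ → Fin (k + 1))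

/-- The Markov operator `M` of the Schreier graph of `(⟨S⟩, P, S)`. -/
def parabolicMarkov {k : ℕ} (S : Finset (TreeAut (k + 1))) (hS : ∀ s ∈ S, s⁻¹ ∈ S) :
    EllTwo (Subgroup.closure (S : Set (TreeAut (k + 1))) ⧸ parabolic S) →L[ℂ]
      EllTwo (Subgroup.closure (S : Set (TreeAut (k + 1))) ⧸ parabolic S) :=
  schreierMarkov (generatorsIn S) (generatorsIn_symm hS) (parabolic S)

/-! Recursively defined tree automorphisms. -/

/-- A system of recursive equations for tree automorphisms `q`, indexed by `Q`: on the first level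
`q` acts by `out q`, and on the subtree below the letter `x` it continues as `sec q x`. -/
structure Recursion (d : ℕ) (Q : Type) where
  out : Q → Equiv.Perm (Fin d)
  sec : Q → Fin d → Q

namespace Recursion

variable {d : ℕ} {Q : Type}

/-- The action on words: `q(xw) = (out q)(x) (sec q x)(w)`. -/
def run (A : Recursion d Q) : Q → List (Fin d) → List (Fin d)
  | _, [] => []
  | q, x :: w => A.out q x :: A.run (A.sec q x) w

/-- The recursion of the inverse automorphisms. -/
def inverse (A : Recursion d Q) : Recursion d Q where
  out q := (A.out q)⁻¹
  sec q x := A.sec q ((A.out q)⁻¹ x)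

theorem inverse_run (A : Recursion d Q) (q : Q) (w : List (Fin d)) :
    A.inverse.run q (A.run q w) = w := by
  induction w generalizing q with
  | nil => rfl
  | cons x w ih => simp [run, inverse]; exact ih _

theorem run_inverse (A : Recursion d Q) (q : Q) (w : List (Fin d)) :
    A.run q (A.inverse.run q w) = w := by
  induction w generalizing q with
  | nil => rfl
  | cons x w ih => simp [run, inverse]; exact ih _

theorem length_run (A : Recursion d Q) (q : Q) (w : List (Fin d)) :
    (A.run q w).length = w.length := by
  induction w generalizing q with
  | nil => rfl
  | cons x w ih => simp [run, ih]

theorem run_prefix (A : Recursion d Q) (q : Q) (u v : List (Fin d)) :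
    A.run q u <+: A.run q v ↔ u <+: v := by
  induction u generalizing q v with
  | nil => simp [run]
  | cons x u ih =>
    cases v with
    | nil => simp [run]
    | cons y v =>
      simp only [run, List.cons_prefix_cons, EmbeddingLike.apply_eq_iff_eq]
      constructor
      · rintro ⟨rfl, h⟩; exact ⟨rfl, (ih _ _).1 h⟩
      · rintro ⟨rfl, h⟩; exact ⟨rfl, (ih _ _).2 h⟩

/-- The tree automorphism `q` that solves the recursion. -/
def aut (A : Recursion d Q) (q : Q) : TreeAut d :=
  ⟨⟨A.run q, A.inverse.run q, A.inverse_run q, A.run_inverse q⟩, A.length_run q, A.run_prefix q⟩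

theorem aut_inv (A : Recursion d Q) (h : ∀ q x, A.out q (A.out q x) = x)
    (h' : ∀ q x, A.sec q (A.out q x) = A.sec q x) (q : Q) : (A.aut q)⁻¹ = A.aut q := by
  have hr : ∀ w q, A.run q (A.run q w) = w := by
    intro w
    induction w with
    | nil => intro q; rfl
    | cons x w ih => intro q; simp [run, h, h', ih]
  rw [inv_eq_iff_mul_eq_one]
  apply Subtype.ext
  apply Equiv.ext
  intro w
  exact hr w q

end Recursion

/-! The five examples. -/

/-- Names of the automorphisms that occur in the recursions of the first two groups. -/
inductive BinaryState
  | one | a | b | c | d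

/-- The top permutation: `a` exchanges the two branches, the others fix them. -/
def binaryOut : BinaryState → Equiv.Perm (Fin 2)
  | .a => Equiv.swap 0 1
  | _ => 1

/-- `b = (a, c)`, `c = (a, d)`, `d = (1, b)`. -/
def grigorchuk : Recursion 2 BinaryState where
  out := binaryOut
  sec
    | .b => ![.a, .c]
    | .c => ![.a, .d]
    | .d => ![.one, .b]
    | _ => ![.one, .one]

/-- `b = (a, c)`, `c = (1, d)`, `d = (1, b)`. -/
def grigorchukTilde : Recursion 2 BinaryState where
  out := binaryOut
  sec
    | .b => ![.a, .c]
    | .c => ![.one, .d]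
    | .d => ![.one, .b]
    | _ => ![.one, .one]

/-- Names of the automorphisms that occur in the recursion of a `GGS` group on the ternary tree:
the power `rot k = aᵏ` of the cyclic rotation of the top branches, and `t`. -/
inductive TernaryState
  | rot (k : Fin 3) | t

/-- `t = (a ^ ε₁, a ^ ε₂, t)`, where `a` permutes the three top branches cyclically. -/
def ggs (ε₁ ε₂ : Fin 3) : Recursion 3 TernaryState where
  out
    | .rot k => Equiv.addRight k
    | .t => 1
  sec
    | .rot _ => ![.rot 0, .rot 0, .rot 0]
    | .t => ![.rot ε₁, .rot ε₂, .t]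

open Classical in
/-- The set `{a, b, c, d}` of generators. -/
def binaryGenerators (A : Recursion 2 BinaryState) : Finset (TreeAut 2) :=
  {A.aut .a, A.aut .b, A.aut .c, A.aut .d}

open Classical in
/-- The set `{a, a⁻¹, t, t⁻¹}` of generators. -/
def ternaryGenerators (A : Recursion 3 TernaryState) : Finset (TreeAut 3) :=
  {A.aut (.rot 1), (A.aut (.rot 1))⁻¹, A.aut .t, (A.aut .t)⁻¹}

/-- The generators of the group `𝔊`. -/
def gensG : Finset (TreeAut 2) := binaryGenerators grigorchuk

/-- The generators of the group `𝔊~`. -/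
def gensGTilde : Finset (TreeAut 2) := binaryGenerators grigorchukTilde

/-- The generators of the group `Γ` of Fabrykowski and Gupta, with `t = (a, 1, t)`. -/
def gensGamma : Finset (TreeAut 3) := ternaryGenerators (ggs 1 0)

/-- The generators of the group with `t = (a, a, t)`. -/
def gensGammaBar : Finset (TreeAut 3) := ternaryGenerators (ggs 1 1)

/-- The generators of the group of Gupta and Sidki, with `t = (a, a⁻¹, t)`, where `a⁻¹ = a²`. -/
def gensGammaBarBar : Finset (TreeAut 3) := ternaryGenerators (ggs 1 2)

theorem gensG_symm : ∀ s ∈ gensG, s⁻¹ ∈ gensG := by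
  have h := grigorchuk.aut_inv
    (by intro q x; cases q <;> fin_cases x <;> rfl) (by intro q x; cases q <;> fin_cases x <;> rfl)
  intro s hs
  simp only [gensG, binaryGenerators, Finset.mem_insert, Finset.mem_singleton] at hs ⊢
  rcases hs with rfl | rfl | rfl | rfl <;> simp [h]

theorem gensGTilde_symm : ∀ s ∈ gensGTilde, s⁻¹ ∈ gensGTilde := by
  have h := grigorchukTilde.aut_inv
    (by intro q x; cases q <;> fin_cases x <;> rfl) (by intro q x; cases q <;> fin_cases x <;> rfl)
  intro s hs
  simp only [gensGTilde, binaryGenerators, Finset.mem_insert, Finset.mem_singleton] at hs ⊢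
  rcases hs with rfl | rfl | rfl | rfl <;> simp [h]

theorem ternaryGenerators_symm (A : Recursion 3 TernaryState) :
    ∀ s ∈ ternaryGenerators A, s⁻¹ ∈ ternaryGenerators A := by
  intro s hs
  simp only [ternaryGenerators, Finset.mem_insert, Finset.mem_singleton] at hs ⊢
  rcases hs with rfl | rfl | rfl | rfl <;> simp

/-! Julia sets and Cantor sets. -/

/-- The filled Julia set of a map of the complex plane: the points with bounded forward orbit. -/
def filledJuliaSet (f : ℂ → ℂ) : Set ℂ := {z | Bornology.IsBounded (Set.range fun n : ℕ => f^[n] z)}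

/-- `J(lam)`, the Julia set of the polynomial `z ↦ z² - lam`, the boundary of the filled Julia
set. -/
def juliaSet (lam : ℝ) : Set ℂ := frontier (filledJuliaSet fun z => z ^ 2 - (lam : ℂ))

/-- The set of the finite nested radicals `±√lam`, `±√(lam ± √lam)`, `±√(lam ± √(lam ± √lam))`, …
for all choices of the signs and of the complex square roots. -/
inductive IsNestedRadical (lam : ℝ) : ℂ → Prop
  | sqrt {z : ℂ} : z ^ 2 = lam → IsNestedRadical lam z
  | step {y z : ℂ} : IsNestedRadical lam y → z ^ 2 = lam + y → IsNestedRadical lam z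

/-- A Cantor set of real numbers: a nonempty compact set without isolated points and with no
connected subset of more than one point. -/
def IsCantorSet (K : Set ℝ) : Prop :=
  K.Nonempty ∧ IsCompact K ∧ Preperfect K ∧ IsTotallyDisconnected K

/-- The set `¼(1 ± A)`. -/
def quarterOnePM (A : Set ℂ) : Set ℂ := {w | ∃ z ∈ A, w = (1 + z) / 4 ∨ w = (1 - z) / 4}

/-- The set `±√(9/2 ± 2A)`. -/
def sqrtNineHalvesPM (A : Set ℂ) : Set ℂ :=
  {y | ∃ z ∈ A, y ^ 2 = 9 / 2 + 2 * z ∨ y ^ 2 = 9 / 2 - 2 * z}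

/-- The spectrum computed for `Γ`. -/
def spectrumGamma : Set ℂ := {1, 1 / 4} ∪ quarterOnePM (closure {z | IsNestedRadical 6 z})

/-- The spectrum computed for the last two groups. -/
def spectrumGammaBar : Set ℂ :=
  {1, -1 / 2, 1 / 4} ∪ quarterOnePM (sqrtNineHalvesPM (juliaSet (45 / 16)))

end FractalSpectra

end

namespace FractalSpectra

open MeasureTheory

/-! Spectra of symmetric operators, from approximate eigenvectors and lower bounds. -/

/-! Both operators have spectrum `closure (levelSpectrum S)`, where `levelSpectrum S` collects the
eigenvalues of the average over `S` on the finite levels of the tree. In `L²` of the boundary, the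
functions of the first `n` letters form an invariant subspace on which the Hecke operator is the
level operator, and the union of these subspaces is dense (`spectrum_heckeOperator`). In `ℓ²(G/P)`,
a finitely supported function can be pushed forward to a level deep enough to separate its support,
so it inherits the lower bounds valid on that level. Conversely, an eigenfunction of a level lifts
to the orbit of `ddd…`; cut off to the rays that are `ddd…` from index `N` on, a set whose boundary
has bounded size, it becomes an approximate eigenvector (`spectrum_parabolicMarkov`).

The level operators have the form `α P + β Q - γ`, with `P` the average over the first letter and
`Q` a self-similar projection. The compression satisfies `d P Q P = p P + Q + i`, the right side
acting one level lower. Applying `P` and `Q` to an eigenvalue equation of `α P + Q` shows that, for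
`y` other than `0` and `1`, `y` is an eigenvalue on level `n + 1` exactly if `d (y - 1)(y - α)/α -
i` is an eigenvalue of `p P + Q` on level `n` (`mem_pairSpectrum_succ`,
`mem_pairSpectrum_of_quadratic`). So the level spectra are backward orbits of a quadratic
polynomial: in affine coordinates `2c² - 1` for the binary groups, whose backward orbit of `0`
consists of dyadic cosines; `x² - 6` for `Γ`; `q² - 45/16` for the last two groups. Where the
initial `α` differs from `p`, one extra square root appears.

For `z² - λ` with fixed point `β > 0` and `λ - β > 1/4`, the Julia set is real and the map expands
on it. Hence backward orbits accumulate at each of its points, and an expansion by more than `2`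
with respect to the density `juliaDensity` makes it a null set. -/

open scoped InnerProductSpace in
theorem dense_range_sub_smul {E : Type*} [NormedAddCommGroup E] [InnerProductSpace ℂ E]
    [CompleteSpace E] (T : E →L[ℂ] E) (hT : IsSelfAdjoint T) {z : ℂ} (hz : (starRingEnd ℂ) z = z)
    (hinj : ∀ f, T f - z • f = 0 → f = 0) : DenseRange (T - z • (1 : E →L[ℂ] E)) := by
  -- The orthogonal complement of the range is the kernel of the adjoint, which is `T - z` itself
  -- because `z` is real.
  have h : ((T - z • (1 : E →L[ℂ] E)).range).topologicalClosure = ⊤ := by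
    rw [Submodule.topologicalClosure_eq_top_iff, ContinuousLinearMap.orthogonal_range,
      ← ContinuousLinearMap.star_eq_adjoint, star_sub, star_smul, star_one, hT.star_eq,
      Submodule.eq_bot_iff]
    intro f hf
    apply hinj
    simpa [hz] using hf
  have h2 := Submodule.dense_iff_topologicalClosure_eq_top.2 h
  exact h2

/-- A self-adjoint operator for which the points of `Λ` are approximate eigenvalues, and which
satisfies on a dense set the lower bounds that a diagonal operator with eigenvalues in `Λ`
satisfies, has spectrum the closure of `Λ`. -/
theorem spectrum_eq_closure {E : Type*} [NormedAddCommGroup E] [InnerProductSpace ℂ E]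
    [CompleteSpace E] (T : E →L[ℂ] E) (hT : IsSelfAdjoint T) (Λ : Set ℂ)
    (happrox : ∀ z ∈ Λ, ∀ ε > 0, ∃ f, f ≠ 0 ∧ ‖T f - z • f‖ ≤ ε * ‖f‖)
    (D : Set E) (hD : Dense D)
    (hbound : ∀ f ∈ D, ∀ (z : ℂ) (δ : ℝ), 0 < δ → (∀ w ∈ Λ, δ ≤ ‖w - z‖) →
      δ * ‖f‖ ≤ ‖T f - z • f‖) :
    spectrum ℂ T = closure Λ := by
  apply Set.Subset.antisymm
  · intro z hz
    by_contra hcl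
    have hre : (starRingEnd ℂ) z = z := by
      rw [hT.mem_spectrum_eq_re hz, Complex.conj_ofReal]
    obtain ⟨δ, hδ, hball⟩ := Metric.isOpen_iff.1 (isClosed_closure (s := Λ)).isOpen_compl z hcl
    have hdist : ∀ w ∈ Λ, δ ≤ ‖w - z‖ := by
      intro w hw
      by_contra hlt
      exact hball (by rw [Metric.mem_ball, dist_eq_norm]; exact not_le.1 hlt) (subset_closure hw)
    have hall : ∀ f, δ * ‖f‖ ≤ ‖T f - z • f‖ := by
      intro f
      refine hD.induction (P := fun f => δ * ‖f‖ ≤ ‖T f - z • f‖)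
        (fun f hf => hbound f hf z δ hδ hdist) ?_ f
      exact isClosed_le (by fun_prop) (by fun_prop)
    -- `T - z` is bounded below and, `z` being real, has dense range; so it is invertible.
    refine hz ?_
    rw [spectrum.mem_resolventSet_iff, ← IsUnit.neg_iff, neg_sub, Algebra.algebraMap_eq_smul_one,
      ContinuousLinearMap.isUnit_iff_bijective,
      ContinuousLinearMap.bijective_iff_dense_range_and_antilipschitz]
    constructor
    · have := dense_range_sub_smul T hT hre (fun f hf => by
        have := hall f
        rw [hf, norm_zero] at this
        exact norm_le_zero_iff.1 (by nlinarith [norm_nonneg f]))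
      rw [← Submodule.dense_iff_topologicalClosure_eq_top]
      exact this
    · refine ⟨⟨δ⁻¹, by positivity⟩, ContinuousLinearMap.antilipschitz_of_bound _ fun f => ?_⟩
      have := hall f
      change ‖f‖ ≤ δ⁻¹ * ‖T f - z • f‖
      rw [inv_mul_eq_div, le_div_iff₀ hδ]
      linarith
  · refine closure_minimal (fun z hz => ?_) (spectrum.isClosed T)
    intro hu
    obtain ⟨u, hu⟩ := hu
    -- If `T - z` had an inverse of norm `K`, this choice of `ε` would give `‖f‖ ≤ K ε ‖f‖ ≤ ‖f‖ /
    -- 2`.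
    obtain ⟨f, hf, hle⟩ := happrox z hz (1 / (2 * (‖(↑u⁻¹ : E →L[ℂ] E)‖ + 1))) (by positivity)
    have h1 : (↑u⁻¹ : E →L[ℂ] E) ((↑u : E →L[ℂ] E) f) = f := by
      rw [← ContinuousLinearMap.comp_apply, ← ContinuousLinearMap.mul_def, Units.inv_mul]; rfl
    have h2 : ‖(↑u : E →L[ℂ] E) f‖ = ‖T f - z • f‖ := by
      rw [hu, norm_sub_rev]; rfl
    have h3 := (↑u⁻¹ : E →L[ℂ] E).le_opNorm ((↑u : E →L[ℂ] E) f)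
    rw [h1, h2] at h3
    have hfpos : 0 < ‖f‖ := norm_pos_iff.2 hf
    set K := ‖(↑u⁻¹ : E →L[ℂ] E)‖
    have hK : 0 ≤ K := norm_nonneg _
    have h4 : ‖f‖ ≤ K * (1 / (2 * (K + 1)) * ‖f‖) := h3.trans (by gcongr)
    have h5 : K * (1 / (2 * (K + 1)) * ‖f‖) ≤ ‖f‖ / 2 := by
      rw [← mul_assoc, mul_one_div, div_mul_eq_mul_div, div_le_iff₀ (by positivity)]
      nlinarith
    linarith

/-- The lower bound for a symmetric operator on a finite dimensional space. -/
theorem le_norm_sub_smul_of_eigenvalues {E : Type*} [NormedAddCommGroup E] [InnerProductSpace ℂ E]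
    [FiniteDimensional ℂ E] (T : E →ₗ[ℂ] E) (hT : T.IsSymmetric) {z : ℂ} {δ : ℝ} (hδ : 0 ≤ δ)
    (h : ∀ w, Module.End.HasEigenvalue T w → δ ≤ ‖w - z‖) (f : E) :
    δ ^ 2 * ‖f‖ ^ 2 ≤ ‖T f - z • f‖ ^ 2 := by
  set b := hT.eigenvectorBasis rfl
  rw [← b.repr.norm_map f, ← b.repr.norm_map (T f - z • f), EuclideanSpace.norm_sq_eq,
    EuclideanSpace.norm_sq_eq, Finset.mul_sum]
  refine Finset.sum_le_sum fun i _ => ?_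
  have h1 : b.repr (T f - z • f) i = ((hT.eigenvalues rfl i : ℂ) - z) * b.repr f i := by
    rw [map_sub, map_smul]
    simp only [PiLp.sub_apply, PiLp.smul_apply, smul_eq_mul]
    rw [hT.eigenvectorBasis_apply_self_apply rfl f i]
    simp [b, sub_mul]
  rw [h1, norm_mul, mul_pow]
  gcongr
  exact h _ (hT.hasEigenvalue_eigenvalues rfl i)

/-! The spectra of the operators on the finite levels of the tree. -/

variable {d : ℕ}

/-- The vertices of level `n`. -/
abbrev Level (d n : ℕ) : Type := {w : List (Fin d) // w.length = n}

instance (d n : ℕ) : Fintype (Level d n) := inferInstanceAs (Fintype (List.Vector (Fin d) n))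

/-- The average of a function on the vertices of the tree over the translates by elements of `S`. -/
noncomputable def levelOperator (S : Finset (TreeAut d)) (F : List (Fin d) → ℂ) (w : List (Fin d)) : ℂ :=
  (S.card : ℂ)⁻¹ * ∑ s ∈ S, F ((s : Equiv.Perm (List (Fin d))) w)

/-- The eigenvalues of the operator `levelOperator S`. -/
def levelSpectrum (S : Finset (TreeAut d)) : Set ℂ :=
  {z | ∃ F : List (Fin d) → ℂ, F ≠ 0 ∧ ∀ w, levelOperator S F w = z * F w}

/-- The permutation of the vertices of level `n` that is given by a tree automorphism. -/
def levelPerm (g : TreeAut d) (n : ℕ) : Equiv.Perm (Level d n) where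
  toFun w := ⟨(g : Equiv.Perm (List (Fin d))) w.1, by rw [length_apply]; exact w.2⟩
  invFun w := ⟨((g⁻¹ : TreeAut d) : Equiv.Perm (List (Fin d))) w.1, by
    rw [length_apply]; exact w.2⟩
  left_inv w := Subtype.ext (by simp)
  right_inv w := Subtype.ext (by simp)

-- Tree automorphisms preserve levels, so the average over the symmetric set `S` is a symmetric
-- matrix on each level. Its eigenvectors, extended by zero to the other levels, are eigenfunctions
-- on the whole tree, so its eigenvalues lie in `levelSpectrum S`.
open scoped InnerProductSpace in
theorem le_sum_norm_levelOperator {S : Finset (TreeAut d)} (hS : ∀ s ∈ S, s⁻¹ ∈ S) (n : ℕ)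
    (F : List (Fin d) → ℂ) {z : ℂ} {δ : ℝ} (hδ : 0 < δ) (h : ∀ w ∈ levelSpectrum S, δ ≤ ‖w - z‖) :
    δ ^ 2 * ∑ w : Level d n, ‖F w.1‖ ^ 2 ≤
      ∑ w : Level d n, ‖levelOperator S F w.1 - z * F w.1‖ ^ 2 := by
  let T : EuclideanSpace ℂ (Level d n) →ₗ[ℂ] EuclideanSpace ℂ (Level d n) :=
    { toFun := fun f => WithLp.toLp 2 fun w => (S.card : ℂ)⁻¹ * ∑ s ∈ S, f (levelPerm s n w)
      map_add' := fun f g => by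
        ext w; simp [Finset.sum_add_distrib, mul_add]
      map_smul' := fun c f => by
        ext w; simp [← Finset.mul_sum, mul_left_comm] }
  have hT : T.IsSymmetric := by
    intro f g
    simp only [PiLp.inner_apply, RCLike.inner_apply, T, LinearMap.coe_mk, AddHom.coe_mk, map_mul,
      map_inv₀, map_natCast, map_sum, Finset.mul_sum, Finset.sum_mul]
    rw [Finset.sum_comm, Finset.sum_comm (s := Finset.univ)]
    refine Finset.sum_bij' (fun s _ => s⁻¹) (fun s _ => s⁻¹) hS hS (by simp) (by simp) ?_
    intro s _
    refine Fintype.sum_equiv (levelPerm s n) _ _ fun w => ?_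
    have : levelPerm s⁻¹ n (levelPerm s n w) = w := (levelPerm s n).symm_apply_apply w
    rw [this]
    ring
  have key := le_norm_sub_smul_of_eigenvalues T hT (z := z) hδ.le ?_ (WithLp.toLp 2 fun w => F w.1)
  · rw [EuclideanSpace.norm_sq_eq, EuclideanSpace.norm_sq_eq] at key
    exact key
  · intro μ hμ
    obtain ⟨f, hf, hne⟩ := hμ.exists_hasEigenvector
    rw [Module.End.mem_eigenspace_iff] at hf
    apply h
    refine ⟨fun w => if h : w.length = n then f ⟨w, h⟩ else 0, fun h0 => hne ?_, fun w => ?_⟩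
    · ext w
      have := congrFun h0 w.1
      simp only [w.2, dif_pos] at this
      exact this
    · by_cases hw : w.length = n
      · have := congrArg (fun f : EuclideanSpace ℂ (Level d n) => f ⟨w, hw⟩) hf
        simp only [levelOperator, length_apply, hw, dif_pos]
        exact this
      · simp [levelOperator, length_apply, hw]

/-- Reconciles the action by `s` in `levelOperator` with the action by `s⁻¹` in the representation
on `L²`. -/
theorem levelOperator_inv {S : Finset (TreeAut d)} (hS : ∀ s ∈ S, s⁻¹ ∈ S)
    (F : List (Fin d) → ℂ) (w : List (Fin d)) :
    levelOperator S F w =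
      (S.card : ℂ)⁻¹ * ∑ s ∈ S, F (((s⁻¹ : TreeAut d) : Equiv.Perm (List (Fin d))) w) := by
  rw [levelOperator]
  congr 1
  exact Finset.sum_bij' (fun s _ => s⁻¹) (fun s _ => s⁻¹) hS hS (by simp) (by simp) (by simp)

open scoped InnerProductSpace in
/-- An average of unitary operators that is symmetric under inversion is self-adjoint. -/
theorem isSelfAdjoint_average {G E : Type*} [Group G] [NormedAddCommGroup E]
    [InnerProductSpace ℂ E] [CompleteSpace E] {S : Finset G} (hS : ∀ s ∈ S, s⁻¹ ∈ S)
    (U : G → E →L[ℂ] E) (hU : ∀ s ∈ S, ∀ f, ‖U s f‖ = ‖f‖) (hinv : ∀ s ∈ S, ∀ f, U s (U s⁻¹ f) = f)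
    (T : E →L[ℂ] E) (hT : ∀ f, T f = (S.card : ℂ)⁻¹ • ∑ s ∈ S, U s f) : IsSelfAdjoint T := by
  rw [ContinuousLinearMap.isSelfAdjoint_iff_isSymmetric]
  intro f g
  simp only [ContinuousLinearMap.coe_coe, hT, inner_smul_left, inner_smul_right, sum_inner,
    inner_sum, map_inv₀, map_natCast]
  congr 1
  refine Finset.sum_bij' (fun s _ => s⁻¹) (fun s _ => s⁻¹) hS hS (by simp) (by simp) ?_
  intro s hs
  -- By polarization `U s` preserves inner products, so its adjoint is `U s⁻¹`.
  have h := (LinearMap.norm_map_iff_inner_map_map (U s)).1 (hU s hs) f (U s⁻¹ g)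
  rw [← h, hinv s hs]

/-! The spectrum of the Hecke type operator. -/

section Hecke

variable {d : ℕ}

theorem measurable_comp_initialWord (n : ℕ) (F : List (Fin d) → ℂ) :
    Measurable fun ξ : ℕ → Fin d => F (initialWord ξ n) :=
  (Measurable.of_discrete (f := fun v : Fin n → Fin d => F (List.ofFn v))).comp
    (measurable_pi_lambda _ fun _ => measurable_pi_apply _)

variable [NeZero d]

theorem memLp_comp_initialWord (n : ℕ) (F : List (Fin d) → ℂ) :
    MemLp (fun ξ : ℕ → Fin d => F (initialWord ξ n)) 2 (uniformMeasure d) := by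
  obtain ⟨C, hC⟩ := (Set.finite_range fun v : Fin n → Fin d => ‖F (List.ofFn v)‖).bddAbove
  exact MemLp.of_bound (measurable_comp_initialWord n F).aestronglyMeasurable C
    (Filter.Eventually.of_forall fun ξ => hC ⟨fun i => ξ i, rfl⟩)

/-- The function on the boundary that depends only on the first `n` letters as prescribed. -/
noncomputable def cylinderFun (n : ℕ) : (List (Fin d) → ℂ) →ₗ[ℂ] Lp ℂ 2 (uniformMeasure d) where
  toFun F := (memLp_comp_initialWord n F).toLp
  map_add' _ _ := rfl
  map_smul' _ _ := rfl

theorem coeFn_cylinderFun (n : ℕ) (F : List (Fin d) → ℂ) :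
    cylinderFun n F =ᵐ[uniformMeasure d] fun ξ => F (initialWord ξ n) :=
  (memLp_comp_initialWord n F).coeFn_toLp

theorem toLp_eq_cylinderFun {n : ℕ} {F : List (Fin d) → ℂ} {f : (ℕ → Fin d) → ℂ}
    (hf : MemLp f 2 (uniformMeasure d)) (h : ∀ ξ, f ξ = F (initialWord ξ n)) :
    hf.toLp = cylinderFun n F :=
  MemLp.toLp_congr hf (memLp_comp_initialWord n F) (Filter.Eventually.of_forall h)

theorem boundaryRep_cylinderFun (g : TreeAut d) (n : ℕ) (F : List (Fin d) → ℂ) :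
    boundaryRep g (cylinderFun n F) =
      cylinderFun n fun w => F (((g⁻¹ : TreeAut d) : Equiv.Perm (List (Fin d))) w) := by
  refine (Lp.toLp_compMeasurePreserving (memLp_comp_initialWord n F)
    (measurePreserving_smul g⁻¹)).trans ?_
  refine toLp_eq_cylinderFun _ fun ξ => ?_
  exact congrArg F (initialWord_boundaryAct g⁻¹ ξ n)

theorem heckeOperator_cylinderFun {S : Finset (TreeAut d)} (hS : ∀ s ∈ S, s⁻¹ ∈ S) (n : ℕ)
    (F : List (Fin d) → ℂ) :
    heckeOperator S (cylinderFun n F) = cylinderFun n (levelOperator S F) := by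
  have h : levelOperator S F = (S.card : ℂ)⁻¹ • ∑ s ∈ S,
      fun w => F (((s⁻¹ : TreeAut d) : Equiv.Perm (List (Fin d))) w) := by
    funext w
    rw [levelOperator_inv hS]
    simp
  rw [h, map_smul, map_sum, heckeOperator, smul_apply,
    sum_apply]
  simp only [boundaryRep_cylinderFun]

/-- All cylinders of level `n` have measure `d⁻ⁿ`. So the embedding of level `n` into `L²` is a
multiple of an isometry and transfers lower bounds. -/
theorem norm_sq_cylinderFun (n : ℕ) (F : List (Fin d) → ℂ) :
    ‖cylinderFun n F‖ ^ 2 = ((d : ℝ)⁻¹) ^ n * ∑ w : Level d n, ‖F w.1‖ ^ 2 := by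
  have h1 : (‖cylinderFun n F‖ ^ 2 : ℝ) =
      ∫ ξ, ‖F (initialWord ξ n)‖ ^ 2 ∂(uniformMeasure d) := by
    have h := L2.inner_def (𝕜 := ℂ) (cylinderFun n F) (cylinderFun n F)
    rw [inner_self_eq_norm_sq_to_K, integral_congr_ae (g := fun ξ =>
      ((‖F (initialWord ξ n)‖ ^ 2 : ℝ) : ℂ)) ?_, integral_complex_ofReal] at h
    · apply Complex.ofReal_injective
      rw [← h]
      push_cast
      rfl
    · filter_upwards [coeFn_cylinderFun n F] with ξ hξ
      rw [hξ, inner_self_eq_norm_sq_to_K]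
      push_cast
      rfl
  have h2 : ∀ ξ : ℕ → Fin d, ‖F (initialWord ξ n)‖ ^ 2 =
      ∑ w : Level d n, {ξ | initialWord ξ n = w.1}.indicator
        (fun _ => ‖F w.1‖ ^ 2) ξ := by
    intro ξ
    rw [Finset.sum_eq_single (⟨initialWord ξ n, length_initialWord ξ n⟩ : Level d n)]
    · simp
    · intro w _ hw
      rw [Set.indicator_of_notMem]
      rintro (h : initialWord ξ n = w.1)
      exact hw (Subtype.ext h.symm)
    · simp
  simp only [h1, h2]
  rw [integral_finsetSum _ fun w _ =>
    (integrable_const _).indicator (measurable_initialWord n w.1), Finset.mul_sum]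
  refine Finset.sum_congr rfl fun w _ => ?_
  rw [integral_indicator_const _ (measurable_initialWord n w.1), smul_eq_mul]
  congr 1
  have h3 : {ξ : ℕ → Fin d | initialWord ξ n = w.1} = cylinder w.1 := by
    unfold cylinder
    rw [w.2]
  rw [h3, measureReal_def, uniformMeasure_cylinder, w.2]
  simp

/-- The functions on the boundary that depend only on finitely many letters. -/
def cylinderFunctions (d : ℕ) [NeZero d] : Submodule ℂ (Lp ℂ 2 (uniformMeasure d)) where
  carrier := {f | ∃ n F, f = cylinderFun n F}
  zero_mem' := ⟨0, 0, (map_zero _).symm⟩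
  add_mem' := by
    have take_eq : ∀ {m n : ℕ} (ξ : ℕ → Fin d), m ≤ n →
        (initialWord ξ n).take m = initialWord ξ m := by
      intro m n ξ h
      have := List.prefix_iff_eq_take.1 (initialWord_prefix ξ h)
      rw [length_initialWord] at this
      exact this.symm
    -- A function of `m` letters is also a function of `n ≥ m` letters, so two summands can be put
    -- on a common level.
    have up : ∀ {m n : ℕ} (F : List (Fin d) → ℂ), m ≤ n →
        cylinderFun m F = cylinderFun n fun w => F (w.take m) := by
      intro m n F h
      exact toLp_eq_cylinderFun (memLp_comp_initialWord m F) fun ξ => by rw [take_eq ξ h]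
    rintro _ _ ⟨m, F, rfl⟩ ⟨n, G, rfl⟩
    refine ⟨max m n, (fun w => F (w.take m)) + fun w => G (w.take n), ?_⟩
    rw [up F (le_max_left m n), up G (le_max_right m n), ← map_add]
  smul_mem' := by
    rintro c _ ⟨n, F, rfl⟩
    exact ⟨n, c • F, (map_smul _ _ _).symm⟩

theorem mem_cylinderFunctions {f : Lp ℂ 2 (uniformMeasure d)} :
    f ∈ cylinderFunctions d ↔ ∃ n F, f = cylinderFun n F := Iff.rfl

/-- A function orthogonal to all cylinder functions has integral zero over every cylinder, and the
cylinders are a π-system that generates the σ-algebra. -/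
theorem dense_cylinderFunctions :
    Dense (cylinderFunctions d : Set (Lp ℂ 2 (uniformMeasure d))) := by
  rw [Submodule.dense_iff_topologicalClosure_eq_top, Submodule.topologicalClosure_eq_top_iff,
    Submodule.eq_bot_iff]
  intro f hf
  have hint : Integrable f (uniformMeasure d) := (Lp.memLp f).integrable (by norm_num)
  have hcyl : ∀ w : List (Fin d), ∫ ξ in cylinder w, f ξ ∂(uniformMeasure d) = 0 := by
    intro w
    have hm : MeasurableSet (cylinder w) := measurable_initialWord _ _
    rw [← L2.inner_indicatorConstLp_one hm (measure_ne_top _ _) f]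
    refine hf _ (mem_cylinderFunctions.2 ⟨w.length, fun v => if v = w then 1 else 0, ?_⟩)
    refine toLp_eq_cylinderFun (memLp_indicator_const 2 hm 1 (Or.inr (measure_ne_top _ _)))
      fun ξ => ?_
    by_cases h : ξ ∈ cylinder w
    · rw [Set.indicator_of_mem h]
      exact (if_pos h).symm
    · rw [Set.indicator_of_notMem h]
      exact (if_neg h).symm
  refine (Lp.eq_zero_iff_ae_eq_zero).2 (hint.ae_eq_zero_of_forall_setIntegral_eq_zero ?_)
  intro s hs _
  induction s, hs using MeasurableSpace.induction_on_inter (generateFrom_cylinder d)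
    (isPiSystem_cylinder d) with
  | empty => simp
  | basic t ht =>
    rcases ht with rfl | ⟨w, rfl⟩
    · simp
    · exact hcyl w
  | compl t ht ih =>
    -- Passing to complements needs the total integral to vanish; the whole space is the cylinder of
    -- the empty word.
    have h0 : cylinder ([] : List (Fin d)) = Set.univ := by
      ext; simp [cylinder, initialWord]
    have h1 := hcyl []
    rw [h0] at h1
    rw [setIntegral_compl ht hint, ih (measure_lt_top _ _), ← setIntegral_univ, h1, sub_zero]
  | iUnion t hdisj hm ih =>
    rw [integral_iUnion hm hdisj hint.integrableOn]
    simp [fun i => ih i (measure_lt_top _ _)]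

theorem norm_boundaryRep (g : TreeAut d) (f : Lp ℂ 2 (uniformMeasure d)) :
    ‖boundaryRep g f‖ = ‖f‖ :=
  Lp.norm_compMeasurePreserving f (measurePreserving_smul g⁻¹)

/-- By continuity it suffices to look at cylinder functions, where the representation acts by
permuting words. -/
theorem boundaryRep_inv_apply (g : TreeAut d) (f : Lp ℂ 2 (uniformMeasure d)) :
    boundaryRep g (boundaryRep g⁻¹ f) = f := by
  refine dense_cylinderFunctions.induction (P := fun f => boundaryRep g (boundaryRep g⁻¹ f) = f)
    ?_ (isClosed_eq (by fun_prop) continuous_id) f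
  intro f hf
  obtain ⟨n, F, rfl⟩ := mem_cylinderFunctions.1 hf
  simp [boundaryRep_cylinderFun]

theorem spectrum_heckeOperator {S : Finset (TreeAut d)} (hS : ∀ s ∈ S, s⁻¹ ∈ S) :
    spectrum ℂ (heckeOperator S) = closure (levelSpectrum S) := by
  have hd : 0 < (d : ℝ) := by exact_mod_cast Nat.pos_of_ne_zero (NeZero.ne d)
  refine spectrum_eq_closure _ ?_ _ ?_ _ dense_cylinderFunctions ?_
  · refine isSelfAdjoint_average hS boundaryRep (fun s _ => norm_boundaryRep s)
      (fun s _ => boundaryRep_inv_apply s) _ fun f => ?_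
    simp [heckeOperator]
  · rintro z ⟨F, hF, hz⟩ ε hε
    obtain ⟨w, hw⟩ := Function.ne_iff.1 hF
    refine ⟨cylinderFun w.length F, ?_, ?_⟩
    · have h0 : 0 < ‖cylinderFun w.length F‖ ^ 2 := by
        rw [norm_sq_cylinderFun]
        have hpos : 0 < ‖F w‖ ^ 2 := by
          have : 0 < ‖F w‖ := norm_pos_iff.2 hw
          positivity
        refine mul_pos (by positivity) (hpos.trans_le ?_)
        exact Finset.single_le_sum (f := fun v : Level d w.length => ‖F v.1‖ ^ 2)
          (fun _ _ => by positivity) (Finset.mem_univ ⟨w, rfl⟩)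
      rintro h
      simp [h] at h0
    · rw [heckeOperator_cylinderFun hS, ← map_smul, ← map_sub]
      have : levelOperator S F - z • F = 0 := by
        funext w
        simp [hz]
      rw [this, map_zero, norm_zero]
      positivity
  · intro f hf z δ hδ h
    obtain ⟨n, F, rfl⟩ := mem_cylinderFunctions.1 hf
    rw [heckeOperator_cylinderFun hS, ← map_smul, ← map_sub]
    refine le_of_sq_le_sq ?_ (norm_nonneg _)
    rw [mul_pow, norm_sq_cylinderFun, norm_sq_cylinderFun, mul_left_comm]
    gcongr
    exact le_sum_norm_levelOperator hS n F hδ h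

end Hecke

/-! Finitely supported elements of `ℓ²`. -/

theorem sum_norm_sq_le {V : Type} (f : EllTwo V) (A : Finset V) :
    ∑ v ∈ A, ‖f v‖ ^ 2 ≤ ‖f‖ ^ 2 := by
  have := lp.sum_rpow_le_norm_rpow (by simp) f A
  simpa using this

theorem norm_sq_eq_sum {V : Type} (f : EllTwo V) (A : Finset V) (hA : ∀ v ∉ A, f v = 0) :
    ‖f‖ ^ 2 = ∑ v ∈ A, ‖f v‖ ^ 2 := by
  have := lp.norm_rpow_eq_tsum (by simp) f
  rw [tsum_eq_sum (s := A) (by intro v hv; simp [hA v hv])] at this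
  simpa using this

theorem memℓp_of_finite {V : Type} {f : V → ℂ} (hf : Set.Finite {v | f v ≠ 0}) :
    Memℓp f 2 :=
  (memℓp_zero hf).of_exponent_ge zero_le

theorem dense_finite_support (V : Type) : Dense {f : EllTwo V | Set.Finite {v | f v ≠ 0}} := by
  classical
  intro f
  refine mem_closure_of_tendsto (lp.hasSum_single (by simp) f) (Filter.Eventually.of_forall ?_)
  intro A
  refine A.finite_toSet.subset fun v hv => ?_
  by_contra hvA
  refine hv ?_
  rw [lp.coeFn_sum, Finset.sum_apply]
  refine Finset.sum_eq_zero fun i hi => ?_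
  rw [lp.single_apply_ne]
  rintro rfl
  exact hvA hi

/-! The orbit of the ray `ddd…`, and the spectrum of the Markov operator of its Schreier graph. -/

section Orbit

variable {k : ℕ}

/-- The coset space of the parabolic subgroup. -/
abbrev Cosets (S : Finset (TreeAut (k + 1))) : Type :=
  Subgroup.closure (S : Set (TreeAut (k + 1))) ⧸ parabolic S

/-- The coset space of the parabolic subgroup as an orbit on the boundary. -/
def ray (S : Finset (TreeAut (k + 1))) :
    Cosets S → ℕ → Fin (k + 1) :=
  MulAction.ofQuotientStabilizer _ (fun _ => Fin.last k : ℕ → Fin (k + 1))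

variable {S : Finset (TreeAut (k + 1))}

theorem ray_injective : Function.Injective (ray S) :=
  MulAction.injective_ofQuotientStabilizer _ _

theorem ray_smul (g : Subgroup.closure (S : Set (TreeAut (k + 1))))
    (v : Cosets S) :
    ray S (g • v) = (g : TreeAut (k + 1)) • ray S v :=
  MulAction.ofQuotientStabilizer_smul _ _ g v

theorem initialWord_smul {d : ℕ} (g : TreeAut d) (ξ : ℕ → Fin d) (n : ℕ) :
    initialWord (g • ξ) n = (g : Equiv.Perm (List (Fin d))) (initialWord ξ n) :=
  initialWord_boundaryAct g ξ n

theorem sum_generatorsIn {M : Type*} [AddCommMonoid M] (h : TreeAut (k + 1) → M) :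
    ∑ s ∈ generatorsIn S, h s = ∑ s ∈ S, h s := by
  rw [generatorsIn, Finset.sum_map]
  exact Finset.sum_attach S h

theorem card_generatorsIn : (generatorsIn S).card = S.card := by
  rw [generatorsIn, Finset.card_map, Finset.card_attach]

/-! ### The Markov operator as a self-adjoint average of translations, and its comparison with the
levels -/

theorem parabolicMarkov_apply (hS : ∀ s ∈ S, s⁻¹ ∈ S)
    (f : EllTwo (Cosets S))
    (v : Cosets S) :
    parabolicMarkov S hS f v = (S.card : ℂ)⁻¹ * ∑ s ∈ generatorsIn S, f (s • v) := by
  rw [← card_generatorsIn]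
  exact markovFun_schreierGraph _ (generatorsIn_symm hS) _ f v

theorem isSelfAdjoint_parabolicMarkov (hS : ∀ s ∈ S, s⁻¹ ∈ S) :
    IsSelfAdjoint (parabolicMarkov S hS) := by
  have hU : ∀ s, ∃ U : EllTwo (Cosets S) →L[ℂ]
      EllTwo (Cosets S),
      ∀ f, U f = translate (parabolic S) s f := by
    intro s
    refine ⟨LinearMap.mkContinuous ⟨⟨translate (parabolic S) s, fun f g => rfl⟩, fun c f => rfl⟩ 1
      fun f => ?_, fun f => rfl⟩
    rw [one_mul]
    exact (norm_translate _ s f).le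
  choose U hU using hU
  refine isSelfAdjoint_average (generatorsIn_symm hS) U (fun s _ f => ?_) (fun s _ f => ?_) _
    fun f => ?_
  · rw [hU, norm_translate]
  · rw [hU, hU]
    apply Subtype.ext
    funext v
    exact congrArg f (inv_smul_smul s v)
  · apply Subtype.ext
    simp only [hU]
    exact markovFun_eq_translate (generatorsIn S) (generatorsIn_symm hS) (parabolic S) f

/-- Each of the finitely many pairs of distinct rays separates at some level; the maximum of these
levels serves for all pairs. -/
theorem exists_injOn_initialWord {V : Type} {d : ℕ} {φ : V → ℕ → Fin d}
    (hφ : Function.Injective φ) (A : Finset V) :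
    ∃ n, Set.InjOn (fun v => initialWord (φ v) n) A := by
  have hex : ∀ p : V × V, ∃ n, p.1 ≠ p.2 → initialWord (φ p.1) n ≠ initialWord (φ p.2) n := by
    intro p
    by_contra! hp
    exact (hp 0).1 (hφ (initialWord_injective fun n => (hp n).2))
  choose N hN using hex
  refine ⟨(A ×ˢ A).sup N, ?_⟩
  intro u hu v hv huv
  by_contra hne
  refine hN (u, v) hne ?_
  have hle := Finset.le_sup (f := N) (Finset.mk_mem_product hu hv)
  have e1 := List.prefix_iff_eq_take.1 (initialWord_prefix (φ u) hle)
  have e2 := List.prefix_iff_eq_take.1 (initialWord_prefix (φ v) hle)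
  rw [length_initialWord] at e1 e2
  simp only at huv
  rw [e1, e2, huv]

theorem sum_norm_sq_mapDomain {V : Type} {d n : ℕ} {c : V → List (Fin d)}
    (hc : ∀ v, (c v).length = n) (g : V →₀ ℂ) (hinj : Set.InjOn c g.support) :
    ∑ w : Level d n, ‖g.mapDomain c w.1‖ ^ 2 = ∑ v ∈ g.support, ‖g v‖ ^ 2 := by
  classical
  symm
  refine Finset.sum_of_injOn (fun v => (⟨c v, hc v⟩ : Level d n))
    (fun u hu v hv huv => hinj hu hv (Subtype.mk.inj huv)) (by simp) ?_ ?_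
  · intro w _ hw
    have : g.mapDomain c w.1 = 0 := by
      rw [← Finsupp.notMem_support_iff, Finsupp.mapDomain_support_of_injOn _ hinj]
      intro hmem
      obtain ⟨v, hv, hvw⟩ := Finset.mem_image.1 hmem
      exact hw ⟨v, hv, Subtype.ext hvw⟩
    simp [this]
  · intro v hv
    rw [Finsupp.mapDomain_apply' (g.support : Set _) g subset_rfl hinj hv]

/-- For a finitely supported function on an invariant set of rays, the lower bound of a
sufficiently deep level holds. -/
theorem le_sum_norm_of_finsupp {V ι : Type} {d : ℕ} {S : Finset (TreeAut d)}
    (hS : ∀ s ∈ S, s⁻¹ ∈ S) {φ : V → ℕ → Fin d} (hφ : Function.Injective φ) (A : Finset ι)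
    (p : ι → Equiv.Perm V) (q : ι → TreeAut d) (hpq : ∀ i v, φ (p i v) = q i • φ v)
    (hq : ∀ h : TreeAut d → ℂ, ∑ i ∈ A, h (q i) = ∑ s ∈ S, h s) {z : ℂ} {δ : ℝ} (hδ : 0 < δ)
    (hΛ : ∀ w ∈ levelSpectrum S, δ ≤ ‖w - z‖) (f g : V →₀ ℂ)
    (hg : ∀ v, g v = (S.card : ℂ)⁻¹ * ∑ i ∈ A, f (p i v) - z * f v) :
    δ ^ 2 * ∑ v ∈ f.support, ‖f v‖ ^ 2 ≤ ∑ v ∈ g.support, ‖g v‖ ^ 2 := by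
  classical
  -- The level must separate the support of the image as well, so that both norms survive the
  -- push-forward.
  obtain ⟨n, hn⟩ := exists_injOn_initialWord hφ (f.support ∪ g.support)
  set c : V → List (Fin d) := fun v => initialWord (φ v) n with hc
  have hlevel : ∀ w, levelOperator S (f.mapDomain c) w - z * f.mapDomain c w =
      g.mapDomain c w := by
    intro w
    have hg' : g = (S.card : ℂ)⁻¹ • (∑ i ∈ A, f.mapDomain (p i).symm) + (-z) • f := by
      ext v
      simp [hg, Finsupp.mapDomain_equiv_apply, sub_eq_add_neg]
    rw [hg', Finsupp.mapDomain_add, Finsupp.mapDomain_smul, Finsupp.mapDomain_finsetSum,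
      Finsupp.mapDomain_smul, levelOperator,
      ← hq fun s => f.mapDomain c ((s : Equiv.Perm (List (Fin d))) w)]
    simp only [Finsupp.add_apply, Finsupp.smul_apply, Finsupp.finsetSum_apply, smul_eq_mul,
      neg_mul, ← sub_eq_add_neg]
    congr 2
    refine Finset.sum_congr rfl fun i _ => ?_
    -- Taking the first `n` letters is equivariant; hence the push-forward intertwines the average
    -- on `V` with the level operator.
    have hcomm : c ∘ (p i).symm = ((q i : Equiv.Perm (List (Fin d))).symm) ∘ c := by
      funext v
      rw [Function.comp_apply, Function.comp_apply, Equiv.eq_symm_apply]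
      have := initialWord_boundaryAct (q i) (φ ((p i).symm v)) n
      rw [← this]
      change initialWord (q i • φ ((p i).symm v)) n = initialWord (φ v) n
      rw [← hpq, Equiv.apply_symm_apply]
    rw [← Finsupp.mapDomain_comp, hcomm, Finsupp.mapDomain_comp, Finsupp.mapDomain_equiv_apply]
    rfl
  have key := le_sum_norm_levelOperator hS n (f.mapDomain c) hδ hΛ
  simp only [hlevel] at key
  rwa [sum_norm_sq_mapDomain (fun v => length_initialWord _ _) f
      (hn.mono (Finset.coe_subset.2 Finset.subset_union_left)),
    sum_norm_sq_mapDomain (fun v => length_initialWord _ _) g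
      (hn.mono (Finset.coe_subset.2 Finset.subset_union_right))] at key

theorem le_norm_parabolicMarkov_sub (hS : ∀ s ∈ S, s⁻¹ ∈ S)
    {f : EllTwo (Cosets S)}
    (hf : Set.Finite {v | f v ≠ 0}) {z : ℂ} {δ : ℝ} (hδ : 0 < δ)
    (h : ∀ w ∈ levelSpectrum S, δ ≤ ‖w - z‖) :
    δ * ‖f‖ ≤ ‖parabolicMarkov S hS f - z • f‖ := by
  have hfin : Set.Finite {v | (parabolicMarkov S hS f - z • f) v ≠ 0} := by
    have h2 : (⋃ s ∈ generatorsIn S, (fun v => s • v) ⁻¹' {v | f v ≠ 0}).Finite :=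
      (generatorsIn S).finite_toSet.biUnion fun s _ =>
        hf.preimage (MulAction.injective s).injOn
    refine (hf.union h2).subset fun v hv => ?_
    by_contra hnot
    simp only [Set.mem_union, Set.mem_ofPred_eq, Set.mem_iUnion, Set.mem_preimage, not_or,
      not_exists, not_not] at hnot
    refine hv ?_
    rw [lp.coeFn_sub, Pi.sub_apply, parabolicMarkov_apply, lp.coeFn_smul, Pi.smul_apply, hnot.1,
      smul_zero, Finset.sum_eq_zero hnot.2, mul_zero, sub_zero]
  have key := le_sum_norm_of_finsupp hS ray_injective (generatorsIn S)
    (fun s => MulAction.toPerm s) (fun s => (s : TreeAut (k + 1))) ray_smul sum_generatorsIn hδ h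
    (Finsupp.ofSupportFinite f hf) (Finsupp.ofSupportFinite _ hfin) fun v => by
      change (parabolicMarkov S hS f - z • f) v = _
      rw [lp.coeFn_sub, Pi.sub_apply, parabolicMarkov_apply]
      rfl
  refine le_of_sq_le_sq ?_ (norm_nonneg _)
  rw [mul_pow, norm_sq_eq_sum f (Finsupp.ofSupportFinite f hf).support
      fun v hv => Finsupp.notMem_support_iff.1 hv,
    norm_sq_eq_sum _ (Finsupp.ofSupportFinite _ hfin).support
      fun v hv => Finsupp.notMem_support_iff.1 hv]
  exact key

/-- Every generator changes only letters near the first letter that is not the last one of the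
alphabet. -/
def ActsNearby (S : Finset (TreeAut (k + 1))) : Prop :=
  ∀ s ∈ S, ∀ (ξ : ℕ → Fin (k + 1)) (j : ℕ), ξ j ≠ Fin.last k → ∀ i, j + 2 ≤ i → (s • ξ) i = ξ i

/-- For every level there is a vertex of that level such that the letter below it can be changed
at will without affecting the other letters. -/
def FlipsLetters (S : Finset (TreeAut (k + 1))) : Prop :=
  ∀ N : ℕ, ∃ v : ℕ → Fin (k + 1), ∀ x y : Fin (k + 1),
    ∃ g ∈ Subgroup.closure (S : Set (TreeAut (k + 1))), ∀ ξ : ℕ → Fin (k + 1),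
      (∀ i < N, ξ i = v i) → ξ N = x → g • ξ = Function.update ξ N y

/-- Induction on the number of letters to be changed: bring the first `N` letters to the special
word `v`, correct the letter at index `N` there, then correct the first `N` letters. In particular
the orbit of `ddd…` contains every sequence that is eventually `d`. -/
theorem FlipsLetters.exists_smul_eq (hS : FlipsLetters S) (N : ℕ) :
    ∀ ξ η : ℕ → Fin (k + 1), (∀ i, N ≤ i → ξ i = η i) →
      ∃ g ∈ Subgroup.closure (S : Set (TreeAut (k + 1))), g • ξ = η := by
  induction N with
  | zero => exact fun ξ η h => ⟨1, one_mem _, by rw [one_smul]; exact funext fun i => h i (by simp)⟩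
  | succ N ih =>
    intro ξ η h
    obtain ⟨v, hv⟩ := hS N
    set ξ' : ℕ → Fin (k + 1) := fun i => if i < N then v i else ξ i with hξ'
    obtain ⟨g1, hg1, h1⟩ := ih ξ ξ' fun i hi => by simp [hξ', not_lt.2 hi]
    obtain ⟨g2, hg2, h2⟩ := hv (ξ' N) (η N)
    obtain ⟨g3, hg3, h3⟩ := ih (Function.update ξ' N (η N)) η fun i hi => by
      rcases hi.eq_or_lt with rfl | hi
      · simp
      · rw [Function.update_of_ne hi.ne', ← h i hi]
        simp [hξ', not_lt.2 hi.le]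
    refine ⟨g3 * (g2 * g1), mul_mem hg3 (mul_mem hg2 hg1), ?_⟩
    rw [mul_smul, mul_smul, h1, h2 ξ' (fun i hi => by simp [hξ', hi]) rfl, h3]

theorem FlipsLetters.exists_ray_eq (hS : FlipsLetters S) {N : ℕ} {ξ : ℕ → Fin (k + 1)}
    (h : ∀ i, N ≤ i → ξ i = Fin.last k) : ∃ v, ray S v = ξ := by
  obtain ⟨g, hg, hgξ⟩ := hS.exists_smul_eq N (fun _ => Fin.last k) ξ fun i hi => (h i hi).symm
  exact ⟨QuotientGroup.mk (⟨g, hg⟩ : Subgroup.closure (S : Set (TreeAut (k + 1)))), hgξ⟩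

/-- The vertices of the Schreier graph that correspond to sequences that end in `ddd…` from the
index `N` on. -/
def block (S : Finset (TreeAut (k + 1))) (N : ℕ) :
    Set (Cosets S) :=
  {v | ∀ i, N ≤ i → ray S v i = Fin.last k}

theorem finite_block (N : ℕ) : (block S N).Finite := by
  have hfin : (Set.range fun (w : Fin N → Fin (k + 1)) (i : ℕ) =>
      if h : i < N then w ⟨i, h⟩ else Fin.last k).Finite := Set.finite_range _
  refine (hfin.preimage ray_injective.injOn).subset fun v hv => ⟨fun i => ray S v i, ?_⟩
  funext i
  by_cases h : i < N
  · simp [h]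
  · simp [h, hv i (not_lt.1 h)]

/-- The number of vertices at which a block is adjacent to its complement is bounded. -/
theorem exists_boundary_block (hS : ∀ s ∈ S, s⁻¹ ∈ S) (hnear : ActsNearby S)
    (hflip : FlipsLetters S) (N : ℕ) :
    ∃ A : Finset (Cosets S),
      A.card ≤ (k + 1) + S.card * (k + 1) ∧
      ∀ v ∉ A, ∀ s ∈ generatorsIn S, s • v ∈ block S N ↔ v ∈ block S N := by
  classical
  -- Only these rays, with at most one letter other than `d`, at index `N - 1`, can leave the block:
  -- such a letter at an index `j ≤ N - 2` protects all letters from `j + 2 ≤ N` on.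
  have hex : ∀ x : Fin (k + 1), ∃ v, ray S v = Function.update (fun _ => Fin.last k) (N - 1) x := by
    intro x
    refine hflip.exists_ray_eq (N := N + 1) fun i hi => ?_
    rw [Function.update_of_ne (by omega)]
  choose u hu using hex
  set X := Finset.univ.image u
  have hXcard : X.card ≤ k + 1 := Finset.card_image_le.trans (by simp)
  have hX : ∀ v ∈ block S N, ∀ s ∈ generatorsIn S, s • v ∉ block S N → v ∈ X := by
    intro v hv s hs hsv
    by_contra hvX
    apply hsv
    have hsS : (s : TreeAut (k + 1)) ∈ S := by
      simp only [generatorsIn, Finset.mem_map, Finset.mem_attach, true_and] at hs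
      obtain ⟨t, rfl⟩ := hs
      exact t.2
    obtain ⟨j, hj, hjlast⟩ : ∃ j, j ≠ N - 1 ∧ ray S v j ≠ Fin.last k := by
      by_contra! hall
      refine hvX (Finset.mem_image.2 ⟨ray S v (N - 1), Finset.mem_univ _, ray_injective ?_⟩)
      rw [hu]
      funext i
      by_cases hi : i = N - 1
      · rw [hi, Function.update_self]
      · rw [Function.update_of_ne hi, hall i hi]
    have hjN : j < N := by
      by_contra hle
      exact hjlast (hv j (not_lt.1 hle))
    intro i hi
    rw [ray_smul, hnear _ hsS _ j hjlast i (by omega)]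
    exact hv i hi
  -- If `s` moves `v` into the block from outside, then `s⁻¹` moves `s • v` out of it, so `s • v` is
  -- in `X`.
  refine ⟨X ∪ (generatorsIn S).biUnion fun s => X.image fun v => s⁻¹ • v, ?_, ?_⟩
  · refine (Finset.card_union_le _ _).trans (add_le_add hXcard ?_)
    rw [← card_generatorsIn]
    exact Finset.card_biUnion_le_card_mul _ _ _ fun s _ => Finset.card_image_le.trans hXcard
  · intro v hv s hs
    rw [Finset.mem_union, not_or] at hv
    constructor
    · intro hsv
      by_contra hvb
      refine hv.2 (Finset.mem_biUnion.2 ⟨s, hs, Finset.mem_image.2 ⟨s • v, ?_, by simp⟩⟩)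
      exact hX _ hsv s⁻¹ (generatorsIn_symm hS s hs) (by simpa using hvb)
    · intro hvb
      by_contra hsv
      exact hv.1 (hX v hvb s hs hsv)

open Classical in
/-- The function on a block that depends only on the first `n` letters as prescribed. -/
noncomputable def truncation (S : Finset (TreeAut (k + 1))) (F : List (Fin (k + 1)) → ℂ) (n N : ℕ) :
    EllTwo (Cosets S) :=
  ⟨fun v => if v ∈ block S N then F (initialWord (ray S v) n) else 0,
    memℓp_of_finite ((finite_block N).subset fun v hv => by by_contra h; exact hv (if_neg h))⟩

theorem truncation_of_mem {F : List (Fin (k + 1)) → ℂ} {n N : ℕ} {v : Cosets S}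
    (h : v ∈ block S N) : truncation S F n N v = F (initialWord (ray S v) n) := if_pos h

theorem truncation_of_notMem {F : List (Fin (k + 1)) → ℂ} {n N : ℕ} {v : Cosets S}
    (h : v ∉ block S N) : truncation S F n N v = 0 := if_neg h

/-- The value `F w` is taken at the `K` rays that continue `w` by `d`'s with a single letter `0`, at
one of `K` positions. They are distinct because `0` is not the last letter when `k ≥ 1`. -/
theorem le_norm_sq_truncation (hk : 1 ≤ k) (hflip : FlipsLetters S)
    (F : List (Fin (k + 1)) → ℂ) (w : List (Fin (k + 1))) (K : ℕ) :
    K * ‖F w‖ ^ 2 ≤ ‖truncation S F w.length (w.length + K + 1)‖ ^ 2 := by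
  classical
  set n := w.length
  have hex : ∀ j : Fin K, ∃ v, ray S v = fun i => if h : i < n then w[i] else
      if i = n + j then 0 else Fin.last k := by
    intro j
    refine hflip.exists_ray_eq (N := n + K + 1) fun i hi => ?_
    rw [dif_neg (by omega), if_neg (by omega)]
  choose u hu using hex
  have huinj : Function.Injective u := by
    intro i j hij
    have h := congrFun (congrArg (ray S) hij) (n + i)
    rw [hu, hu] at h
    simp only [Nat.not_lt.2 (Nat.le_add_right n i), dif_neg, not_false_eq_true, if_true] at h
    by_contra hne
    rw [if_neg (by omega)] at h
    exact absurd (congrArg Fin.val h) (by simp; omega)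
  refine le_trans (le_of_eq ?_) (sum_norm_sq_le _ (Finset.univ.image u))
  rw [Finset.sum_image huinj.injOn, Finset.sum_congr rfl (g := fun _ => ‖F w‖ ^ 2)]
  · simp
  · intro j _
    rw [truncation_of_mem]
    · congr 3
      apply List.ext_getElem
      · rw [length_initialWord]
      · intro i h1 h2
        rw [getElem_initialWord, hu]
        exact dif_pos h2
    · intro i hi
      rw [hu]
      simp only
      rw [dif_neg (by omega), if_neg (by omega)]

/-- Without the cutoff the lifted function satisfies the eigenvalue equation exactly, so the error
comes only from edges that cross the boundary of the block. -/
theorem parabolicMarkov_sub_truncation (hS : ∀ s ∈ S, s⁻¹ ∈ S) {z : ℂ}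
    {F : List (Fin (k + 1)) → ℂ} (hz : ∀ w, levelOperator S F w = z * F w) (n N : ℕ)
    (v : Cosets S) :
    (v ∈ block S N → (parabolicMarkov S hS (truncation S F n N) - z • truncation S F n N) v =
      (S.card : ℂ)⁻¹ * ∑ s ∈ generatorsIn S,
        (truncation S F n N (s • v) - F (initialWord (ray S (s • v)) n))) ∧
    (v ∉ block S N → (parabolicMarkov S hS (truncation S F n N) - z • truncation S F n N) v =
      (S.card : ℂ)⁻¹ * ∑ s ∈ generatorsIn S, truncation S F n N (s • v)) := by
  rw [lp.coeFn_sub, Pi.sub_apply, parabolicMarkov_apply, lp.coeFn_smul, Pi.smul_apply, smul_eq_mul]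
  constructor
  · intro hv
    rw [Finset.sum_sub_distrib, mul_sub, truncation_of_mem hv, ← hz, levelOperator,
      ← sum_generatorsIn (S := S)]
    simp only [ray_smul, initialWord_smul]
  · intro hv
    rw [truncation_of_notMem hv, mul_zero, sub_zero]

/-- The error lives on the boundary vertices and is at most `C` at each of them. The bound does not
depend on `N`. -/
theorem norm_sq_parabolicMarkov_sub_truncation_le (hS : ∀ s ∈ S, s⁻¹ ∈ S) (hnear : ActsNearby S)
    (hflip : FlipsLetters S) {z : ℂ} {F : List (Fin (k + 1)) → ℂ}
    (hz : ∀ w, levelOperator S F w = z * F w) {n : ℕ} {C : ℝ}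
    (hC : ∀ ξ : ℕ → Fin (k + 1), ‖F (initialWord ξ n)‖ ≤ C) (N : ℕ) :
    ‖parabolicMarkov S hS (truncation S F n N) - z • truncation S F n N‖ ^ 2 ≤
      ((k + 1) + S.card * (k + 1) : ℕ) * C ^ 2 := by
  have hC0 : 0 ≤ C := (norm_nonneg _).trans (hC fun _ => 0)
  obtain ⟨A, hAcard, hA⟩ := exists_boundary_block hS hnear hflip N
  have hzero : ∀ v ∉ A,
      (parabolicMarkov S hS (truncation S F n N) - z • truncation S F n N) v = 0 := by
    intro v hv
    obtain ⟨h1, h2⟩ := parabolicMarkov_sub_truncation hS hz n N v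
    by_cases hvb : v ∈ block S N
    · rw [h1 hvb, Finset.sum_eq_zero, mul_zero]
      intro s hs
      rw [truncation_of_mem ((hA v hv s hs).2 hvb), sub_self]
    · rw [h2 hvb, Finset.sum_eq_zero, mul_zero]
      intro s hs
      rw [truncation_of_notMem (mt (hA v hv s hs).1 hvb)]
  have havg : ∀ h : Subgroup.closure (S : Set (TreeAut (k + 1))) → ℂ, (∀ s, ‖h s‖ ≤ C) →
      ‖(S.card : ℂ)⁻¹ * ∑ s ∈ generatorsIn S, h s‖ ≤ C := by
    intro h hh
    rw [norm_mul, norm_inv, Complex.norm_natCast]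
    have := norm_sum_le_of_le (generatorsIn S) fun s _ => hh s
    rw [Finset.sum_const, card_generatorsIn, nsmul_eq_mul] at this
    refine (mul_le_mul_of_nonneg_left this (by positivity)).trans ?_
    rw [← mul_assoc]
    exact mul_le_of_le_one_left hC0 inv_mul_le_one
  have hle : ∀ v,
      ‖(parabolicMarkov S hS (truncation S F n N) - z • truncation S F n N) v‖ ≤ C := by
    intro v
    obtain ⟨h1, h2⟩ := parabolicMarkov_sub_truncation hS hz n N v
    by_cases hvb : v ∈ block S N
    · rw [h1 hvb]
      refine havg _ fun s => ?_
      by_cases hs : s • v ∈ block S N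
      · rw [truncation_of_mem hs, sub_self, norm_zero]; exact hC0
      · rw [truncation_of_notMem hs, zero_sub, norm_neg]; exact hC _
    · rw [h2 hvb]
      refine havg _ fun s => ?_
      by_cases hs : s • v ∈ block S N
      · rw [truncation_of_mem hs]; exact hC _
      · rw [truncation_of_notMem hs, norm_zero]; exact hC0
  rw [norm_sq_eq_sum _ A hzero]
  refine (Finset.sum_le_card_nsmul A _ (C ^ 2) fun v _ => ?_).trans ?_
  · exact pow_le_pow_left₀ (norm_nonneg _) (hle v) 2
  · rw [nsmul_eq_mul]
    exact mul_le_mul_of_nonneg_right (by exact_mod_cast hAcard) (by positivity)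

theorem exists_approx_eigenvector (hk : 1 ≤ k) (hS : ∀ s ∈ S, s⁻¹ ∈ S) (hnear : ActsNearby S)
    (hflip : FlipsLetters S) {z : ℂ} (hz : z ∈ levelSpectrum S) {ε : ℝ} (hε : 0 < ε) :
    ∃ f, f ≠ 0 ∧ ‖parabolicMarkov S hS f - z • f‖ ≤ ε * ‖f‖ := by
  obtain ⟨F, hF, hz⟩ := hz
  obtain ⟨w, hw⟩ := Function.ne_iff.1 hF
  replace hw : 0 < ‖F w‖ := norm_pos_iff.2 hw
  obtain ⟨C, hC⟩ := (Set.finite_range fun v : Level (k + 1) w.length => ‖F v.1‖).bddAbove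
  replace hC : ∀ ξ : ℕ → Fin (k + 1), ‖F (initialWord ξ w.length)‖ ≤ C := fun ξ =>
    hC ⟨⟨initialWord ξ w.length, length_initialWord _ _⟩, rfl⟩
  -- The squared error is bounded independently of `K`, while the squared norm of the cutoff is at
  -- least `K ‖F w‖²`.
  obtain ⟨K, hK⟩ := exists_nat_gt
    (((k + 1) + S.card * (k + 1) : ℕ) * C ^ 2 / (ε ^ 2 * ‖F w‖ ^ 2))
  rw [div_lt_iff₀ (by positivity)] at hK
  have hlow := le_norm_sq_truncation hk hflip F w K
  have hup := norm_sq_parabolicMarkov_sub_truncation_le hS hnear hflip hz hC (w.length + K + 1)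
  set f := truncation S F w.length (w.length + K + 1)
  have hsq : ‖parabolicMarkov S hS f - z • f‖ ^ 2 < ε ^ 2 * ‖f‖ ^ 2 := by
    nlinarith [sq_nonneg ε]
  refine ⟨f, ?_, ?_⟩
  · rintro h0
    rw [h0] at hsq
    simp at hsq
  · rw [← mul_pow] at hsq
    exact (lt_of_pow_lt_pow_left₀ 2 (by positivity) hsq).le

theorem spectrum_parabolicMarkov (hk : 1 ≤ k) (hS : ∀ s ∈ S, s⁻¹ ∈ S) (hnear : ActsNearby S)
    (hflip : FlipsLetters S) : spectrum ℂ (parabolicMarkov S hS) = closure (levelSpectrum S) :=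
  spectrum_eq_closure _ (isSelfAdjoint_parabolicMarkov hS) _
    (fun _ hz _ hε => exists_approx_eigenvector hk hS hnear hflip hz hε) _ (dense_finite_support _)
    fun _ hf _ _ hδ h => le_norm_parabolicMarkov_sub hS hf hδ h

end Orbit

/-! A self-similar pair of projections on the functions on the tree. -/

section Projections

variable {d : ℕ}

/-- The average over the first letter. -/
noncomputable def avgFirst (F : List (Fin d) → ℂ) : List (Fin d) → ℂ
  | [] => F []
  | _ :: w => (d : ℂ)⁻¹ * ∑ y, F (y :: w)

/-- The projection that is on the subtree below a letter `x` the average over the next letter if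
`act x`, the identity if not, and below the distinguished letter `l` again the projection itself. -/
noncomputable def selfSimilarProj (l : Fin d) (act : Fin d → Bool) : List (Fin d) → (List (Fin d) → ℂ) → ℂ
  | [], F => F []
  | x :: w, F =>
    if x = l then selfSimilarProj l act w fun v => F (x :: v)
    else if act x then avgFirst (fun v => F (x :: v)) w else F (x :: w)

/-- The eigenvalues of `α P + Q` on level `n`, where `P = avgFirst` and `Q = selfSimilarProj`. -/
def pairSpectrum (l : Fin d) (act : Fin d → Bool) (α : ℂ) (n : ℕ) : Set ℂ :=
  {y | ∃ F : List (Fin d) → ℂ, (∃ w, w.length = n ∧ F w ≠ 0) ∧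
    ∀ w, α * avgFirst F w + selfSimilarProj l act w F = y * F w}

theorem avgFirst_cons (hd : d ≠ 0) (F : List (Fin d) → ℂ) (x : Fin d) (w : List (Fin d)) :
    ∑ y, F (y :: w) = d * avgFirst F (x :: w) := by
  rw [avgFirst, mul_inv_cancel_left₀ (by exact_mod_cast hd)]

theorem avgFirst_linear (a b : ℂ) (F G : List (Fin d) → ℂ) (w : List (Fin d)) :
    avgFirst (fun v => a * F v + b * G v) w = a * avgFirst F w + b * avgFirst G w := by
  cases w with
  | nil => rfl
  | cons x w =>
    simp only [avgFirst, Finset.sum_add_distrib, ← Finset.mul_sum]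
    ring

theorem avgFirst_avgFirst (F : List (Fin d) → ℂ) (w : List (Fin d)) :
    avgFirst (avgFirst F) w = avgFirst F w := by
  cases w with
  | nil => rfl
  | cons x w =>
    have hd : d ≠ 0 := fun h => by subst h; exact x.elim0
    rw [avgFirst]
    simp only [avgFirst, Finset.sum_const, Finset.card_univ, Fintype.card_fin, nsmul_eq_mul]
    rw [inv_mul_cancel_left₀ (by exact_mod_cast hd)]

variable {l : Fin d} {act : Fin d → Bool}

theorem selfSimilarProj_linear (a b : ℂ) (F G : List (Fin d) → ℂ) (w : List (Fin d)) :
    selfSimilarProj l act w (fun v => a * F v + b * G v) =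
      a * selfSimilarProj l act w F + b * selfSimilarProj l act w G := by
  induction w generalizing F G with
  | nil => rfl
  | cons x w ih =>
    simp only [selfSimilarProj]
    split_ifs
    · exact ih _ _
    · exact avgFirst_linear _ _ _ _ _
    · rfl

theorem selfSimilarProj_selfSimilarProj (F : List (Fin d) → ℂ) (w : List (Fin d)) :
    selfSimilarProj l act w (fun v => selfSimilarProj l act v F) = selfSimilarProj l act w F := by
  induction w generalizing F with
  | nil => rfl
  | cons x w ih =>
    simp only [selfSimilarProj]
    split_ifs
    · exact ih _
    · exact avgFirst_avgFirst _ _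
    · rfl

/-- `Q` preserves levels. This permits applying `Q` to identities that are known on a single level
only. -/
theorem selfSimilarProj_congr {F G : List (Fin d) → ℂ} {n : ℕ}
    (h : ∀ w : List (Fin d), w.length = n → F w = G w) {w : List (Fin d)} (hw : w.length = n) :
    selfSimilarProj l act w F = selfSimilarProj l act w G := by
  induction w generalizing F G n with
  | nil => exact h [] hw
  | cons x w ih =>
    subst hw
    have h' : ∀ v : List (Fin d), v.length = w.length → F (x :: v) = G (x :: v) := fun v hv =>
      h _ (by simp [hv])
    simp only [selfSimilarProj]
    split_ifs
    · exact ih h' rfl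
    · cases w with
      | nil => exact h' [] rfl
      | cons z w =>
        simp only [avgFirst]
        congr 1
        exact Finset.sum_congr rfl fun y _ => h' _ (by simp)
    · exact h' w rfl

/-- The compression of `Q` to the range of `P`. -/
theorem avgFirst_selfSimilarProj_lift (p i : ℕ)
    (hp : (Finset.univ.filter fun x => x ≠ l ∧ act x = true).card = p)
    (hi : (Finset.univ.filter fun x => x ≠ l ∧ ¬ act x = true).card = i)
    (g : List (Fin d) → ℂ) (x : Fin d) (w : List (Fin d)) :
    d * avgFirst (fun v => selfSimilarProj l act v fun u => g u.tail) (x :: w) =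
      p * avgFirst g w + selfSimilarProj l act w g + i * g w := by
  have hd : d ≠ 0 := fun h => by subst h; exact x.elim0
  rw [← avgFirst_cons hd]
  simp only [selfSimilarProj, List.tail_cons]
  rw [Finset.sum_ite, Finset.sum_ite, Finset.sum_const, Finset.sum_const, Finset.sum_const,
    Finset.filter_filter, Finset.filter_filter, hp, hi]
  have : (Finset.univ.filter fun x => x = l).card = 1 := by
    rw [Finset.filter_eq']; simp
  rw [this]
  simp only [nsmul_eq_mul, Nat.cast_one, one_mul]
  ring

theorem mem_pairSpectrum_zero {α y : ℂ} (h : y ∈ pairSpectrum l act α 0) : y = α + 1 := by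
  obtain ⟨F, ⟨w, hw, hF⟩, hy⟩ := h
  rw [List.length_eq_zero_iff] at hw
  subst hw
  have := hy []
  simp only [avgFirst, selfSimilarProj] at this
  have h2 : (α + 1 - y) * F [] = 0 := by linear_combination this
  rcases mul_eq_zero.1 h2 with h3 | h3
  · linear_combination -h3
  · exact absurd h3 hF

/-- From `P Q F = (y - α) P F` and `α Q P F = (y - 1) Q F` follows `P Q P F = ((y - 1)(y - α)/α) P
F`. By the compression formula `P F`, as a function of the remaining `n` letters, is an
eigenfunction of `p P + Q`, unless it vanishes; then `F` is an eigenvector of the projection `Q` and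
`y` is `0` or `1`. -/
theorem mem_pairSpectrum_succ {p i : ℕ}
    (hp : (Finset.univ.filter fun x => x ≠ l ∧ act x = true).card = p)
    (hi : (Finset.univ.filter fun x => x ≠ l ∧ ¬ act x = true).card = i) {α y : ℂ} (hα : α ≠ 0)
    {n : ℕ} (h : y ∈ pairSpectrum l act α (n + 1)) :
    y = 0 ∨ y = 1 ∨ d * ((y - 1) * (y - α) / α) - i ∈ pairSpectrum l act p n := by
  obtain ⟨F, ⟨w, hw, hF⟩, hy⟩ := h
  have hd : d ≠ 0 := fun h => by
    subst h
    cases w with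
    | nil => simp at hw
    | cons x w => exact x.elim0
  -- the equations `P Q F = (y - α) P F` and `α Q P F = (y - 1) Q F`
  have hPQ : ∀ v, avgFirst (fun u => selfSimilarProj l act u F) v = (y - α) * avgFirst F v := by
    intro v
    have h1 := avgFirst_linear α 1 (avgFirst F) (fun u => selfSimilarProj l act u F) v
    have h2 := avgFirst_linear y 0 F F v
    have h3 : (fun v => α * avgFirst F v + 1 * selfSimilarProj l act v F) =
        fun v => y * F v + 0 * F v := by
      funext v
      linear_combination hy v
    rw [h3, h2, avgFirst_avgFirst] at h1
    linear_combination -h1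
  have hQP : ∀ v, α * selfSimilarProj l act v (avgFirst F) =
      (y - 1) * selfSimilarProj l act v F := by
    intro v
    have h1 := selfSimilarProj_linear (l := l) (act := act) α 1 (avgFirst F)
      (fun u => selfSimilarProj l act u F) v
    have h2 := selfSimilarProj_linear (l := l) (act := act) y 0 F F v
    have h3 : (fun v => α * avgFirst F v + 1 * selfSimilarProj l act v F) =
        fun v => y * F v + 0 * F v := by
      funext v
      linear_combination hy v
    rw [h3, h2, selfSimilarProj_selfSimilarProj] at h1
    linear_combination -h1
  by_cases hzero : ∀ v : List (Fin d), v.length = n + 1 → avgFirst F v = 0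
  · have h1 : ∀ v : List (Fin d), v.length = n + 1 → selfSimilarProj l act v F = y * F v := by
      intro v hv
      have := hy v
      rw [hzero v hv] at this
      linear_combination this
    have h2 := selfSimilarProj_congr (l := l) (act := act)
      (F := fun v => selfSimilarProj l act v F) (G := fun v => y * F v + 0 * F v) (fun v hv => by rw [h1 v hv]; ring) hw
    rw [selfSimilarProj_selfSimilarProj, selfSimilarProj_linear, h1 w hw] at h2
    have h3 : y * (y - 1) * F w = 0 := by linear_combination -h2
    rcases mul_eq_zero.1 h3 with h4 | h4
    · rcases mul_eq_zero.1 h4 with h5 | h5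
      · exact Or.inl h5
      · exact Or.inr (Or.inl (by linear_combination h5))
    · exact absurd h4 hF
  · right; right
    push Not at hzero
    obtain ⟨v, hv, hne⟩ := hzero
    cases v with
    | nil => simp at hv
    | cons x v =>
      refine ⟨fun u => avgFirst F (x :: u), ⟨v, by simpa using hv, hne⟩, fun u => ?_⟩
      have h1 := avgFirst_selfSimilarProj_lift p i hp hi (fun u => avgFirst F (x :: u)) x u
      -- Off the empty word `P F` ignores the first letter, so it agrees with its own lift from the
      -- level below.
      have h2 : ∀ v : List (Fin d), v.length = u.length + 1 →
          avgFirst F (x :: v.tail) = avgFirst F v := by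
        intro v hv
        cases v with
        | nil => simp at hv
        | cons z v => rfl
      have h3 : avgFirst (fun v => selfSimilarProj l act v fun u => avgFirst F (x :: u.tail))
          (x :: u) = (y - 1) * (y - α) / α * avgFirst F (x :: u) := by
        have h4 : avgFirst (fun v => selfSimilarProj l act v fun u => avgFirst F (x :: u.tail))
          (x :: u) = avgFirst (fun v => ((y - 1) / α) * selfSimilarProj l act v F +
            0 * selfSimilarProj l act v F) (x :: u) := by
          simp only [avgFirst]
          congr 1
          refine Finset.sum_congr rfl fun z _ => ?_
          have h5 := selfSimilarProj_congr (l := l) (act := act) (w := z :: u) h2 rfl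
          simp only [avgFirst] at h5
          rw [h5, zero_mul, add_zero, div_mul_eq_mul_div, eq_div_iff hα, mul_comm _ α]
          exact hQP _
        rw [h4, avgFirst_linear, hPQ]
        field_simp
        ring
      rw [h3] at h1
      linear_combination -h1

/-- If `V` is the lift of `g`, then `P V = V` and `P Q V = k V` with `α k = (y - 1)(y - α)`, and a
computation shows that `(y - 1) V + Q V` is an eigenfunction. If it vanished, `1 - y` would be an
eigenvalue of the projection `Q`, which the conditions on `y` exclude. -/
theorem mem_pairSpectrum_of_quadratic {p i : ℕ}
    (hp : (Finset.univ.filter fun x => x ≠ l ∧ act x = true).card = p)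
    (hi : (Finset.univ.filter fun x => x ≠ l ∧ ¬ act x = true).card = i) {α y : ℂ} (hα : α ≠ 0)
    {n : ℕ} (h0 : y ≠ 0) (h1 : y ≠ 1)
    (h : d * ((y - 1) * (y - α) / α) - i ∈ pairSpectrum l act p n) :
    y ∈ pairSpectrum l act α (n + 1) := by
  obtain ⟨g, ⟨w, hw, hg⟩, hy⟩ := h
  have hd : (d : ℂ) ≠ 0 := by
    have : d ≠ 0 := fun h => by subst h; exact l.elim0
    exact_mod_cast this
  set k : ℂ := (y - 1) * (y - α) / α with hk
  have hkα : α * k = (y - 1) * (y - α) := by rw [hk]; field_simp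
  -- At the empty word both projections are the identity, so `P Q V = k V` forces the value `0`
  -- there unless `k = 1`.
  set V : List (Fin d) → ℂ := fun v => if v = [] then 0 else g v.tail with hV
  have hPV : ∀ v, avgFirst V v = V v := by
    intro v
    cases v with
    | nil => rfl
    | cons x v =>
      simp only [avgFirst, hV, List.tail_cons, reduceCtorEq, if_false, Finset.sum_const,
        Finset.card_univ, Fintype.card_fin, nsmul_eq_mul]
      rw [inv_mul_cancel_left₀ hd]
  have hPQV : ∀ v, avgFirst (fun v => selfSimilarProj l act v V) v = k * V v := by
    intro v
    cases v with
    | nil => simp [avgFirst, selfSimilarProj, hV]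
    | cons x v =>
      have h1 := avgFirst_selfSimilarProj_lift p i hp hi g x v
      have h2 : avgFirst (fun v => selfSimilarProj l act v V) (x :: v) =
          avgFirst (fun v => selfSimilarProj l act v fun u => g u.tail) (x :: v) := rfl
      rw [h2]
      apply mul_left_cancel₀ hd
      rw [h1]
      simp only [hV, List.tail_cons, reduceCtorEq, if_false]
      linear_combination hy v
  refine ⟨fun v => (y - 1) * V v + 1 * selfSimilarProj l act v V, ?_, fun v => ?_⟩
  · by_contra! hall
    have h2 : ∀ v : List (Fin d), v.length = n + 1 → selfSimilarProj l act v V =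
        (1 - y) * V v + 0 * V v := fun v hv => by linear_combination hall v hv
    have h3 := selfSimilarProj_congr (l := l) (act := act) h2 (w := l :: w) (by simp [hw])
    rw [selfSimilarProj_selfSimilarProj, selfSimilarProj_linear,
      h2 (l :: w) (by simp [hw])] at h3
    have h4 : V (l :: w) = g w := by simp [hV]
    rw [h4] at h3
    have h5 : y * (1 - y) * g w = 0 := by linear_combination h3
    rcases mul_eq_zero.1 h5 with h6 | h6
    · rcases mul_eq_zero.1 h6 with h7 | h7
      · exact h0 h7
      · exact h1 (by linear_combination -h7)
    · exact hg h6
  · rw [avgFirst_linear, selfSimilarProj_linear, selfSimilarProj_selfSimilarProj, hPV, hPQV]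
    linear_combination V v * hkα

/-- On the first level `Q` is the identity, and `1` is an eigenvalue of `α P + Q`. -/
theorem one_mem_pairSpectrum (hd : 2 ≤ d) (α : ℂ) : 1 ∈ pairSpectrum l act α 1 := by
  set x : Fin d := ⟨0, by omega⟩
  set y : Fin d := ⟨1, by omega⟩
  have hxy : x ≠ y := by simp [x, y, Fin.ext_iff]
  -- A function of mean zero on the first level: `P` annihilates it and `Q` fixes it.
  set F : List (Fin d) → ℂ := fun v => if v = [x] then 1 else if v = [y] then -1 else 0 with hF
  have hlen : ∀ v : List (Fin d), v.length ≠ 1 → F v = 0 := by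
    intro v hv
    have h1 : v ≠ [x] := by rintro rfl; simp at hv
    have h2 : v ≠ [y] := by rintro rfl; simp at hv
    simp [hF, h1, h2]
  refine ⟨F, ⟨[x], rfl, by simp [hF]⟩, fun w => ?_⟩
  have hP : avgFirst F w = 0 := by
    cases w with
    | nil => exact hlen [] (by simp)
    | cons z w =>
      rw [avgFirst]
      cases w with
      | nil =>
        have : ∀ u : Fin d, F [u] = (if u = x then 1 else 0) + (if u = y then -1 else 0) := by
          intro u
          by_cases hu : u = x
          · simp [hF, hu, hxy]
          · simp [hF, hu]
        simp [this, Finset.sum_add_distrib]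
      | cons z' w =>
        rw [Finset.sum_eq_zero fun u _ => hlen _ (by simp), mul_zero]
  have hQ : selfSimilarProj l act w F = F w := by
    by_cases hw : w.length = 1
    · obtain ⟨z, rfl⟩ := List.length_eq_one_iff.1 hw
      simp [selfSimilarProj, avgFirst]
    · have h := selfSimilarProj_congr (l := l) (act := act) (n := w.length) (F := F)
        (G := fun v => 0 * F v + 0 * F v) (fun v hv => by rw [hlen v (by omega)]; ring) rfl
      rw [selfSimilarProj_linear] at h
      rw [h, hlen w hw]
      ring
  rw [hP, hQ]
  ring

end Projections

/-! The action of recursively defined automorphisms on the boundary. -/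

namespace Recursion

variable {d : ℕ} {Q : Type}

/-- The continuation of the automorphism `q` along an infinite word. -/
def state (A : Recursion d Q) (q : Q) (ξ : ℕ → Fin d) : ℕ → Q
  | 0 => q
  | n + 1 => A.sec (A.state q ξ n) (ξ n)

theorem state_succ' (A : Recursion d Q) (q : Q) (ξ : ℕ → Fin d) (n : ℕ) :
    A.state q ξ (n + 1) = A.state (A.sec q (ξ 0)) (fun i => ξ (i + 1)) n := by
  induction n with
  | zero => rfl
  | succ n ih => rw [state, ih]; rfl

theorem getElem_run (A : Recursion d Q) (q : Q) (ξ : ℕ → Fin d) (n i : ℕ) (hi : i < n)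
    (h : i < (A.run q (initialWord ξ n)).length) :
    (A.run q (initialWord ξ n))[i] = A.out (A.state q ξ i) (ξ i) := by
  induction n generalizing q ξ i with
  | zero => omega
  | succ n ih =>
    have hw : initialWord ξ (n + 1) = ξ 0 :: initialWord (fun i => ξ (i + 1)) n := by
      simp [initialWord, List.ofFn_succ]
    simp only [hw, run]
    cases i with
    | zero => rfl
    | succ i =>
      rw [state_succ', List.getElem_cons_succ]
      exact ih _ _ i (by omega) _

theorem aut_smul_apply (A : Recursion d Q) (q : Q) (ξ : ℕ → Fin d) (n : ℕ) :
    (A.aut q • ξ) n = A.out (A.state q ξ n) (ξ n) :=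
  A.getElem_run q ξ (n + 1) n n.lt_succ_self _

theorem aut_smul_eq_update (A : Recursion d Q) {q : Q} {ξ : ℕ → Fin d} {n : ℕ}
    (h : ∀ i, i ≠ n → A.out (A.state q ξ i) = 1) :
    A.aut q • ξ = Function.update ξ n (A.out (A.state q ξ n) (ξ n)) := by
  funext i
  rw [aut_smul_apply]
  by_cases hi : i = n
  · rw [hi, Function.update_self]
  · rw [Function.update_of_ne hi, h i hi, Equiv.Perm.one_apply]

theorem inv_aut (A : Recursion d Q) (q : Q) : (A.aut q)⁻¹ = A.inverse.aut q :=
  Subtype.ext (Equiv.ext fun _ => rfl)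

theorem state_of_trivial (A : Recursion d Q) {triv : Q → Prop}
    (hsec : ∀ q, triv q → ∀ x, triv (A.sec q x)) {q : Q} {ξ : ℕ → Fin d} {n : ℕ}
    (h : triv (A.state q ξ n)) {i : ℕ} (hi : n ≤ i) : triv (A.state q ξ i) := by
  induction i, hi using Nat.le_induction with
  | base => exact h
  | succ i _ ih => exact hsec _ ih _

/-- A letter other than `l` leads to a state that becomes trivial after one more letter, and trivial
states stay trivial. -/
theorem aut_smul_apply_of_ne (A : Recursion d Q) {triv : Q → Prop}
    (hout : ∀ q, triv q → A.out q = 1) (hsec : ∀ q, triv q → ∀ x, triv (A.sec q x)) {l : Fin d}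
    (hl : ∀ q x y, x ≠ l → triv (A.sec (A.sec q x) y)) (q : Q) {ξ : ℕ → Fin d} {j : ℕ}
    (hj : ξ j ≠ l) {i : ℕ} (hi : j + 2 ≤ i) : (A.aut q • ξ) i = ξ i := by
  rw [aut_smul_apply, hout _ (A.state_of_trivial hsec (n := j + 2) (hl _ _ _ hj) hi),
    Equiv.Perm.one_apply]

end Recursion

/-! The two groups on the binary tree. -/

section Binary

variable {A : Recursion 2 BinaryState}

theorem mem_binaryGenerators {s : TreeAut 2} :
    s ∈ binaryGenerators A ↔ s = A.aut .a ∨ s = A.aut .b ∨ s = A.aut .c ∨ s = A.aut .d := by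
  simp [binaryGenerators]

theorem binary_nearby (hone : ∀ x, A.sec .one x = .one) (ho : A.out = binaryOut)
    (hl : ∀ q y, A.sec (A.sec q 0) y = .one) : ActsNearby (k := 1) (binaryGenerators A) := by
  have key : ∀ q, ∀ (ξ : ℕ → Fin 2) (j : ℕ), ξ j ≠ Fin.last 1 → ∀ i, j + 2 ≤ i →
      (A.aut q • ξ) i = ξ i := by
    intro q ξ j hj i hi
    refine A.aut_smul_apply_of_ne (triv := fun q => q = .one) ?_ ?_ ?_ q hj hi
    · rintro _ rfl
      rw [ho]
      rfl
    · rintro _ rfl x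
      exact hone x
    · intro q x y hx
      have : x = 0 := by
        fin_cases x
        · rfl
        · exact absurd rfl hx
      rw [this]
      exact hl q y
  intro s hs
  rcases mem_binaryGenerators.1 hs with rfl | rfl | rfl | rfl <;> exact key _

/-- Along the letter `1` the states `b`, `c`, `d` form a cycle and change nothing. So one of the
three is in state `b` after a given number of ones; a letter `0` then turns the state into `a`,
which exchanges the two values of the next letter and then stops. -/
theorem binary_flips (hone : ∀ x, A.sec .one x = .one) (ha : ∀ x, A.sec .a x = .one)
    (ho : A.out = binaryOut) (hb0 : A.sec .b 0 = .a) (hb : A.sec .b 1 = .c)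
    (hc : A.sec .c 1 = .d) (hd : A.sec .d 1 = .b) :
    FlipsLetters (k := 1) (binaryGenerators A) := by
  have swap_apply : ∀ x y : Fin 2, x ≠ y → Equiv.swap (0 : Fin 2) 1 x = y := by decide
  have trivial : ∀ (q : BinaryState) (ξ : ℕ → Fin 2) (n : ℕ), A.state q ξ n = .a →
      ∀ i, n + 1 ≤ i → A.out (A.state q ξ i) = 1 := by
    intro q ξ n hn i hi
    have h1 : A.state q ξ (n + 1) = .one := by rw [Recursion.state, hn, ha]
    have := A.state_of_trivial (triv := fun q => q = .one) (by rintro _ rfl x; exact hone x) h1 hi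
    rw [this, ho]
    rfl
  have mem : ∀ q, q = .b ∨ q = .c ∨ q = .d → A.aut q ∈ Subgroup.closure
      ((binaryGenerators A : Finset (TreeAut 2)) : Set (TreeAut 2)) := by
    intro q hq
    refine Subgroup.subset_closure (mem_binaryGenerators.2 ?_)
    rcases hq with rfl | rfl | rfl <;> simp
  have path : ∀ M : ℕ, ∀ r : BinaryState, r = .b ∨ r = .c ∨ r = .d →
      ∃ q : BinaryState, (q = .b ∨ q = .c ∨ q = .d) ∧ ∀ ξ : ℕ → Fin 2, (∀ i < M, ξ i = 1) →
        A.state q ξ M = r ∧ ∀ i ≤ M, A.out (A.state q ξ i) = 1 := by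
    intro M
    induction M with
    | zero =>
      intro r hr
      refine ⟨r, hr, fun ξ _ => ⟨rfl, fun i hi => ?_⟩⟩
      rw [Nat.le_zero.1 hi, Recursion.state, ho]
      rcases hr with rfl | rfl | rfl <;> rfl
    | succ M ih =>
      intro r hr
      obtain ⟨r', hr', hsec⟩ : ∃ r', (r' = .b ∨ r' = .c ∨ r' = .d) ∧ A.sec r' 1 = r := by
        rcases hr with rfl | rfl | rfl
        · exact ⟨.d, by simp, hd⟩
        · exact ⟨.b, by simp, hb⟩
        · exact ⟨.c, by simp, hc⟩
      obtain ⟨q, hq, hpath⟩ := ih r' hr'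
      refine ⟨q, hq, fun ξ hξ => ?_⟩
      obtain ⟨h1, h2⟩ := hpath ξ fun i hi => hξ i (by omega)
      have h3 : A.state q ξ (M + 1) = r := by rw [Recursion.state, h1, hξ M (by omega), hsec]
      refine ⟨h3, fun i hi => ?_⟩
      rcases hi.eq_or_lt with rfl | hi
      · rw [h3, ho]
        rcases hr with rfl | rfl | rfl <;> rfl
      · exact h2 i (by omega)
  intro N
  -- Only the first `N` letters matter: they are `1…10`, with the `0` at index `N - 1`, and nothing
  -- is prescribed for `N = 0`.
  refine ⟨fun i => if i + 1 = N then 0 else 1, fun x y => ?_⟩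
  by_cases hxy : x = y
  · refine ⟨1, one_mem _, fun ξ _ hx => ?_⟩
    rw [one_smul, ← hxy, ← hx, Function.update_eq_self]
  · cases N with
    | zero =>
      refine ⟨A.aut .a, Subgroup.subset_closure (mem_binaryGenerators.2 (Or.inl rfl)),
        fun ξ _ hx => ?_⟩
      rw [A.aut_smul_eq_update (n := 0) fun i hi => trivial .a ξ 0 rfl i (by omega), hx]
      simp only [Recursion.state, ho]
      congr 1
      exact swap_apply x y hxy
    | succ M =>
      obtain ⟨q, hq, hpath⟩ := path M .b (Or.inl rfl)
      refine ⟨A.aut q, mem q hq, fun ξ hξ hx => ?_⟩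
      obtain ⟨h1, h2⟩ := hpath ξ fun i hi => (hξ i (by omega)).trans (if_neg (by omega))
      have hM : ξ M = 0 := (hξ M (by omega)).trans (if_pos rfl)
      have h3 : A.state q ξ (M + 1) = .a := by rw [Recursion.state, h1, hM, hb0]
      rw [A.aut_smul_eq_update (n := M + 1) fun i hi => ?_, hx, h3, ho]
      · congr 1
        exact swap_apply x y hxy
      · rcases lt_or_gt_of_ne hi with hlt | hgt
        · exact h2 i (by omega)
        · exact trivial q ξ (M + 1) h3 i (by omega)

/-- The generators form a set, so they must be pairwise distinct for the average to have four terms.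
-/
theorem sum_binaryGenerators (hab : A.aut .a ≠ A.aut .b) (hac : A.aut .a ≠ A.aut .c)
    (had : A.aut .a ≠ A.aut .d) (hbc : A.aut .b ≠ A.aut .c) (hbd : A.aut .b ≠ A.aut .d)
    (hcd : A.aut .c ≠ A.aut .d) (F : List (Fin 2) → ℂ) (w : List (Fin 2)) :
    levelOperator (binaryGenerators A) F w =
      4⁻¹ * (F (A.run .a w) + (F (A.run .b w) + F (A.run .c w) + F (A.run .d w))) := by
  classical
  have hS : binaryGenerators A = {A.aut .a, A.aut .b, A.aut .c, A.aut .d} := by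
    ext s
    simp [mem_binaryGenerators]
  have hcard : (binaryGenerators A).card = 4 := by
    rw [hS, Finset.card_insert_of_notMem (by simp [hab, hac, had]),
      Finset.card_insert_of_notMem (by simp [hbc, hbd]),
      Finset.card_insert_of_notMem (by simp [hcd]), Finset.card_singleton]
  rw [levelOperator, hcard, hS, Finset.sum_insert (by simp [hab, hac, had]),
    Finset.sum_insert (by simp [hbc, hbd]), Finset.sum_insert (by simp [hcd]),
    Finset.sum_singleton, ← add_assoc (F _) (F _) (F _)]
  rfl

theorem run_one (hone : ∀ x, A.sec .one x = .one) (ho : A.out = binaryOut) (w : List (Fin 2)) :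
    A.run .one w = w := by
  induction w with
  | nil => rfl
  | cons x w ih =>
    rw [Recursion.run, hone, ih, ho]
    rfl

theorem apply_run_a (hone : ∀ x, A.sec .one x = .one) (ha : ∀ x, A.sec .a x = .one)
    (ho : A.out = binaryOut) (F : List (Fin 2) → ℂ) (w : List (Fin 2)) :
    F (A.run .a w) = 2 * avgFirst F w - F w := by
  cases w with
  | nil => simp only [Recursion.run, avgFirst]; ring
  | cons x w =>
    rw [Recursion.run, ha, run_one hone ho, ho, avgFirst, Fin.sum_univ_two]
    fin_cases x
    · change F (1 :: w) = 2 * (((2 : ℕ) : ℂ)⁻¹ * (F (0 :: w) + F (1 :: w))) - F (0 :: w)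
      push_cast
      ring
    · change F (0 :: w) = 2 * (((2 : ℕ) : ℂ)⁻¹ * (F (0 :: w) + F (1 :: w))) - F (1 :: w)
      push_cast
      ring

end Binary

/-! ### The averages over the generators of the binary groups in terms of the two projections -/

theorem aut_ne_of_run_ne {d : ℕ} {Q : Type} {A : Recursion d Q} {q r : Q} (w : List (Fin d))
    (h : A.run q w ≠ A.run r w) : A.aut q ≠ A.aut r := fun hqr =>
  h (congrArg (fun g : TreeAut d => (g : Equiv.Perm (List (Fin d))) w) hqr)

/-- Below the letter `0` the three sections are `a`, `a`, `1`, with sum `2(2P - 1) + 1 = 4P - 1`;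
below `1` they are again `b`, `c`, `d` in another order. -/
theorem grigorchuk_run_bcd (F : List (Fin 2) → ℂ) (w : List (Fin 2)) :
    F (grigorchuk.run .b w) + F (grigorchuk.run .c w) + F (grigorchuk.run .d w) =
      4 * selfSimilarProj 1 (fun _ => true) w F - F w := by
  induction w generalizing F with
  | nil => simp only [Recursion.run, selfSimilarProj]; ring
  | cons x w ih =>
    fin_cases x
    · have h := apply_run_a (A := grigorchuk) (fun x => by fin_cases x <;> rfl)
        (fun x => by fin_cases x <;> rfl) rfl (fun v => F (0 :: v)) w
      have h1 := run_one (A := grigorchuk) (fun x => by fin_cases x <;> rfl) rfl w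
      change F (0 :: grigorchuk.run .a w) + F (0 :: grigorchuk.run .a w) +
        F (0 :: grigorchuk.run .one w) = 4 * avgFirst (fun v => F (0 :: v)) w - F (0 :: w)
      rw [h1]
      linear_combination 2 * h
    · have h := ih fun v => F (1 :: v)
      change F (1 :: grigorchuk.run .c w) + F (1 :: grigorchuk.run .d w) +
        F (1 :: grigorchuk.run .b w) =
        4 * selfSimilarProj 1 (fun _ => true) w (fun v => F (1 :: v)) - F (1 :: w)
      linear_combination h

/-- Below the letter `0` the sections are now `a`, `1`, `1`, with sum `(2P - 1) + 2 = 2P + 1`. -/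
theorem grigorchukTilde_run_bcd (F : List (Fin 2) → ℂ) (w : List (Fin 2)) :
    F (grigorchukTilde.run .b w) + F (grigorchukTilde.run .c w) + F (grigorchukTilde.run .d w) =
      2 * selfSimilarProj 1 (fun _ => true) w F + F w := by
  induction w generalizing F with
  | nil => simp only [Recursion.run, selfSimilarProj]; ring
  | cons x w ih =>
    fin_cases x
    · have h := apply_run_a (A := grigorchukTilde) (fun x => by fin_cases x <;> rfl)
        (fun x => by fin_cases x <;> rfl) rfl (fun v => F (0 :: v)) w
      have h1 := run_one (A := grigorchukTilde) (fun x => by fin_cases x <;> rfl) rfl w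
      change F (0 :: grigorchukTilde.run .a w) + F (0 :: grigorchukTilde.run .one w) +
        F (0 :: grigorchukTilde.run .one w) = 2 * avgFirst (fun v => F (0 :: v)) w + F (0 :: w)
      rw [h1]
      linear_combination h
    · have h := ih fun v => F (1 :: v)
      change F (1 :: grigorchukTilde.run .c w) + F (1 :: grigorchukTilde.run .d w) +
        F (1 :: grigorchukTilde.run .b w) =
        2 * selfSimilarProj 1 (fun _ => true) w (fun v => F (1 :: v)) + F (1 :: w)
      linear_combination h

theorem levelOperator_gensG (F : List (Fin 2) → ℂ) (w : List (Fin 2)) :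
    levelOperator gensG F w =
      1 / 2 * avgFirst F w + selfSimilarProj 1 (fun _ => true) w F - 1 / 2 * F w := by
  -- The first level separates `a` from the rest, and `00` separates `d` from `b` and `c`. As `b`
  -- and `c` have the same section at `0`, the word for them goes through `1`.
  rw [gensG, sum_binaryGenerators (aut_ne_of_run_ne [0] (by decide))
    (aut_ne_of_run_ne [0] (by decide)) (aut_ne_of_run_ne [0] (by decide))
    (aut_ne_of_run_ne [1, 0, 0] (by decide)) (aut_ne_of_run_ne [0, 0] (by decide))
    (aut_ne_of_run_ne [0, 0] (by decide)), grigorchuk_run_bcd,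
    apply_run_a (fun x => by fin_cases x <;> rfl) (fun x => by fin_cases x <;> rfl) rfl F w]
  ring

theorem levelOperator_gensGTilde (F : List (Fin 2) → ℂ) (w : List (Fin 2)) :
    levelOperator gensGTilde F w =
      1 / 2 * avgFirst F w + 1 / 2 * selfSimilarProj 1 (fun _ => true) w F := by
  rw [gensGTilde, sum_binaryGenerators (aut_ne_of_run_ne [0] (by decide))
    (aut_ne_of_run_ne [0] (by decide)) (aut_ne_of_run_ne [0] (by decide))
    (aut_ne_of_run_ne [0, 0] (by decide)) (aut_ne_of_run_ne [0, 0] (by decide))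
    (aut_ne_of_run_ne [1, 0, 0] (by decide)), grigorchukTilde_run_bcd,
    apply_run_a (fun x => by fin_cases x <;> rfl) (fun x => by fin_cases x <;> rfl) rfl F w]
  ring

/-! The groups on the ternary tree. -/

section Ternary

theorem mem_ternaryGenerators {A : Recursion 3 TernaryState} {s : TreeAut 3} :
    s ∈ ternaryGenerators A ↔ s = A.aut (.rot 1) ∨ s = A.inverse.aut (.rot 1) ∨
      s = A.aut .t ∨ s = A.inverse.aut .t := by
  simp [ternaryGenerators, Recursion.inv_aut]

theorem ggs_nearby (ε₁ ε₂ : Fin 3) : ActsNearby (k := 2) (ternaryGenerators (ggs ε₁ ε₂)) := by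
  have hsec : ∀ k x, (ggs ε₁ ε₂).sec (.rot k) x = .rot 0 := by
    intro k x
    fin_cases x <;> rfl
  have ht : ∀ x, x ≠ Fin.last 2 → ∃ k, (ggs ε₁ ε₂).sec .t x = .rot k := by
    intro x hx
    fin_cases x
    · exact ⟨_, rfl⟩
    · exact ⟨_, rfl⟩
    · exact absurd rfl hx
  have hrot : (ggs ε₁ ε₂).out (.rot 0) = 1 := by
    ext x
    simp [ggs]
  have key : ∀ q, ∀ (ξ : ℕ → Fin 3) (j : ℕ), ξ j ≠ Fin.last 2 → ∀ i, j + 2 ≤ i →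
      ((ggs ε₁ ε₂).aut q • ξ) i = ξ i := by
    intro q ξ j hj i hi
    refine (ggs ε₁ ε₂).aut_smul_apply_of_ne (triv := fun q => q = .rot 0) ?_ ?_ ?_ q hj hi
    · rintro _ rfl
      exact hrot
    · rintro _ rfl x
      exact hsec _ _
    · intro q x y hx
      cases q with
      | rot k => rw [hsec, hsec]
      | t => obtain ⟨k, hk⟩ := ht x hx; rw [hk, hsec]
  have key' : ∀ q, ∀ (ξ : ℕ → Fin 3) (j : ℕ), ξ j ≠ Fin.last 2 → ∀ i, j + 2 ≤ i →
      ((ggs ε₁ ε₂).inverse.aut q • ξ) i = ξ i := by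
    intro q ξ j hj i hi
    refine (ggs ε₁ ε₂).inverse.aut_smul_apply_of_ne (triv := fun q => q = .rot 0) ?_ ?_ ?_ q hj hi
    · rintro _ rfl
      change ((ggs ε₁ ε₂).out (.rot 0))⁻¹ = 1
      rw [hrot, inv_one]
    · rintro _ rfl x
      exact hsec 0 _
    · intro q x y hx
      cases q with
      | rot k => simp only [Recursion.inverse, hsec]
      | t =>
        obtain ⟨k, hk⟩ := ht x hx
        have : (ggs ε₁ ε₂).inverse.sec .t x = .rot k := hk
        rw [this]
        exact hsec k _
  intro s hs
  rcases mem_ternaryGenerators.1 hs with rfl | rfl | rfl | rfl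
  exacts [key _, key' _, key _, key' _]

/-- The state `t` persists along the letter `2`; the letter `0` turns it into the rotation, which
changes the next letter only. The hypotheses hold for the recursion and for its inverse, which gives
both directions of rotation. -/
theorem ternary_smul_eq_update (A : Recursion 3 TernaryState)
    (hsec : ∀ k x, A.sec (.rot k) x = .rot 0) (hrot : A.out (.rot 0) = 1) (ht : A.out .t = 1)
    (ht0 : A.sec .t 0 = .rot 1) (ht2 : A.sec .t 2 = .t) {N : ℕ} {ξ : ℕ → Fin 3}
    (h : ∀ i < N, ξ i = if i + 1 = N then 0 else 2) :
    A.aut (if N = 0 then .rot 1 else .t) • ξ = Function.update ξ N (A.out (.rot 1) (ξ N)) := by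
  have trivial : ∀ (q : TernaryState) (n : ℕ), A.state q ξ n = .rot 1 →
      ∀ i, n + 1 ≤ i → A.out (A.state q ξ i) = 1 := by
    intro q n hn i hi
    have h1 : A.state q ξ (n + 1) = .rot 0 := by rw [Recursion.state, hn, hsec]
    have := A.state_of_trivial (triv := fun q => q = .rot 0) (by rintro _ rfl x; exact hsec _ _)
      h1 hi
    rw [this, hrot]
  cases N with
  | zero =>
    rw [if_pos rfl, A.aut_smul_eq_update (n := 0) fun i hi => trivial _ 0 rfl i (by omega)]
    rfl
  | succ M =>
    rw [if_neg (Nat.succ_ne_zero M)]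
    have hpath : ∀ i ≤ M, A.state .t ξ i = .t := by
      intro i
      induction i with
      | zero => intro _; rfl
      | succ i ih =>
        intro hi
        rw [Recursion.state, ih (by omega), h i (by omega), if_neg (by omega), ht2]
    have h3 : A.state .t ξ (M + 1) = .rot 1 := by
      rw [Recursion.state, hpath M le_rfl, h M (by omega), if_pos rfl, ht0]
    rw [A.aut_smul_eq_update (n := M + 1) fun i hi => ?_, h3]
    rcases lt_or_gt_of_ne hi with hlt | hgt
    · rw [hpath i (by omega), ht]
    · exact trivial .t (M + 1) h3 i (by omega)

theorem ggs_flips (ε₂ : Fin 3) : FlipsLetters (k := 2) (ternaryGenerators (ggs 1 ε₂)) := by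
  have hsec : ∀ k x, (ggs 1 ε₂).sec (.rot k) x = .rot 0 := by
    intro k x
    fin_cases x <;> rfl
  have hrot : (ggs 1 ε₂).out (.rot 0) = 1 := by
    ext x
    simp [ggs]
  have h1 := fun {N ξ} => ternary_smul_eq_update (ggs 1 ε₂) hsec hrot rfl rfl rfl (N := N) (ξ := ξ)
  have h2 := fun {N ξ} => ternary_smul_eq_update (ggs 1 ε₂).inverse (fun k x => hsec k _)
    (by change ((ggs 1 ε₂).out (.rot 0))⁻¹ = 1; rw [hrot, inv_one])
    rfl rfl rfl (N := N) (ξ := ξ)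
  intro N
  refine ⟨fun i => if i + 1 = N then 0 else 2, fun x y => ?_⟩
  obtain hxy | hxy | hxy : y = x ∨ y = x + 1 ∨ y = x + -1 := by
    revert x y; decide
  · refine ⟨1, one_mem _, fun ξ _ hx => ?_⟩
    rw [one_smul, hxy, ← hx, Function.update_eq_self]
  · refine ⟨_, Subgroup.subset_closure (mem_ternaryGenerators.2 ?_), fun ξ hξ hx =>
      (h1 hξ).trans ?_⟩
    · split_ifs <;> simp
    · rw [hx, hxy]
      rfl
  · refine ⟨_, Subgroup.subset_closure (mem_ternaryGenerators.2 ?_), fun ξ hξ hx =>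
      (h2 hξ).trans ?_⟩
    · split_ifs <;> simp
    · rw [hx, hxy]
      rfl

variable {ε₁ ε₂ : Fin 3}

theorem ggs_run_rot_zero (w : List (Fin 3)) : (ggs ε₁ ε₂).run (.rot 0) w = w := by
  induction w with
  | nil => rfl
  | cons x w ih =>
    have : (ggs ε₁ ε₂).sec (.rot 0) x = .rot 0 := by fin_cases x <;> rfl
    rw [Recursion.run, this, ih]
    simp [ggs]

theorem ggs_inverse_run_rot_zero (w : List (Fin 3)) :
    (ggs ε₁ ε₂).inverse.run (.rot 0) w = w := by
  conv_lhs => rw [← ggs_run_rot_zero (ε₁ := ε₁) (ε₂ := ε₂) w]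
  exact Recursion.inverse_run _ _ _

/-- A nontrivial rotation, its inverse and the identity run through all three values of the first
letter, so they sum to `3P`. -/
theorem apply_run_rot {k : Fin 3} (hk : k ≠ 0) (F : List (Fin 3) → ℂ) (w : List (Fin 3)) :
    F ((ggs ε₁ ε₂).run (.rot k) w) + F ((ggs ε₁ ε₂).inverse.run (.rot k) w) =
      3 * avgFirst F w - F w := by
  cases w with
  | nil => simp only [Recursion.run, avgFirst]; ring
  | cons x w =>
    have hsec : ∀ x, (ggs ε₁ ε₂).sec (.rot k) x = .rot 0 := fun x => by fin_cases x <;> rfl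
    have hsec' : (ggs ε₁ ε₂).inverse.sec (.rot k) x = .rot 0 := hsec _
    have h1 : (ggs ε₁ ε₂).out (.rot k) x = x + k := rfl
    have h2 : (ggs ε₁ ε₂).inverse.out (.rot k) x = x + -k := rfl
    rw [Recursion.run, Recursion.run, hsec, hsec', ggs_run_rot_zero, ggs_inverse_run_rot_zero,
      h1, h2, avgFirst]
    have hsum : ∀ f : Fin 3 → ℂ, f (x + k) + f (x + -k) = ∑ y, f y - f x := by
      intro f
      rw [Fin.sum_univ_three]
      fin_cases k
      · exact absurd rfl hk
      · fin_cases x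
        · change f 1 + f 2 = f 0 + f 1 + f 2 - f 0
          ring
        · change f 2 + f 0 = f 0 + f 1 + f 2 - f 1
          ring
        · change f 0 + f 1 = f 0 + f 1 + f 2 - f 2
          ring
      · fin_cases x
        · change f 2 + f 1 = f 0 + f 1 + f 2 - f 0
          ring
        · change f 0 + f 2 = f 0 + f 1 + f 2 - f 1
          ring
        · change f 1 + f 0 = f 0 + f 1 + f 2 - f 2
          ring
    rw [hsum fun y => F (y :: w)]
    push_cast
    ring

/-- A nontrivial rotation below a letter contributes `3P - 1`, a trivial one contributes `2 = 3 · 1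
- 1`, and below the letter `2` the same sum recurs. -/
theorem apply_run_t (F : List (Fin 3) → ℂ) (w : List (Fin 3)) :
    F ((ggs ε₁ ε₂).run .t w) + F ((ggs ε₁ ε₂).inverse.run .t w) =
      3 * selfSimilarProj 2 (fun x => decide ((![ε₁, ε₂, 0] : Fin 3 → Fin 3) x ≠ 0)) w F - F w := by
  have hrot : ∀ (k x : Fin 3) (v : List (Fin 3)), F (x :: (ggs ε₁ ε₂).run (.rot k) v) +
      F (x :: (ggs ε₁ ε₂).inverse.run (.rot k) v) =
      3 * (if decide (k ≠ 0) = true then avgFirst (fun v => F (x :: v)) v else F (x :: v)) -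
        F (x :: v) := by
    intro k x v
    by_cases hk : k = 0
    · subst hk
      rw [ggs_run_rot_zero, ggs_inverse_run_rot_zero]
      simp only [ne_eq, not_true_eq_false, decide_false, Bool.false_eq_true, if_false]
      ring
    · rw [if_pos (decide_eq_true hk)]
      exact apply_run_rot hk (fun v => F (x :: v)) v
  induction w generalizing F with
  | nil => simp only [Recursion.run, selfSimilarProj]; ring
  | cons x w ih =>
    fin_cases x
    · exact hrot ε₁ 0 w
    · exact hrot ε₂ 1 w
    · refine ih (fun v => F (2 :: v)) fun k x v => ?_
      by_cases hk : k = 0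
      · subst hk
        rw [ggs_run_rot_zero, ggs_inverse_run_rot_zero]
        simp only [ne_eq, not_true_eq_false, decide_false, Bool.false_eq_true, if_false]
        ring
      · rw [if_pos (decide_eq_true hk)]
        exact apply_run_rot hk (fun v => F (2 :: x :: v)) v

theorem levelOperator_ggs (ε₂ : Fin 3) (F : List (Fin 3) → ℂ) (w : List (Fin 3)) :
    levelOperator (ternaryGenerators (ggs 1 ε₂)) F w = 3 / 4 * avgFirst F w +
      3 / 4 * selfSimilarProj 2 (fun x => decide ((![1, ε₂, 0] : Fin 3 → Fin 3) x ≠ 0)) w F -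
        1 / 2 * F w := by
  classical
  set A := ggs 1 ε₂
  have hne : ∀ (g h : TreeAut 3) (v : List (Fin 3)),
      (g : Equiv.Perm (List (Fin 3))) v ≠ (h : Equiv.Perm (List (Fin 3))) v → g ≠ h := by
    rintro g _ v hv rfl
    exact hv rfl
  have h12 : A.aut (.rot 1) ≠ A.inverse.aut (.rot 1) :=
    hne _ _ [0] (by change [(1 : Fin 3)] ≠ [2]; decide)
  have h13 : A.aut (.rot 1) ≠ A.aut .t := hne _ _ [0] (by change [(1 : Fin 3)] ≠ [0]; decide)
  have h14 : A.aut (.rot 1) ≠ A.inverse.aut .t :=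
    hne _ _ [0] (by change [(1 : Fin 3)] ≠ [0]; decide)
  have h23 : A.inverse.aut (.rot 1) ≠ A.aut .t :=
    hne _ _ [0] (by change [(2 : Fin 3)] ≠ [0]; decide)
  have h24 : A.inverse.aut (.rot 1) ≠ A.inverse.aut .t :=
    hne _ _ [0] (by change [(2 : Fin 3)] ≠ [0]; decide)
  have h34 : A.aut .t ≠ A.inverse.aut .t :=
    hne _ _ [0, 0] (by change [(0 : Fin 3), 1] ≠ [0, 2]; decide)
  have hS : ternaryGenerators A =
      {A.aut (.rot 1), A.inverse.aut (.rot 1), A.aut .t, A.inverse.aut .t} := by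
    ext s
    simp [mem_ternaryGenerators]
  have hcard : (ternaryGenerators A).card = 4 := by
    rw [hS, Finset.card_insert_of_notMem (by simp [h12, h13, h14]),
      Finset.card_insert_of_notMem (by simp [h23, h24]),
      Finset.card_insert_of_notMem (by simp [h34]), Finset.card_singleton]
  rw [levelOperator, hcard, hS, Finset.sum_insert (by simp [h12, h13, h14]),
    Finset.sum_insert (by simp [h23, h24]), Finset.sum_insert (by simp [h34]),
    Finset.sum_singleton]
  have e1 := apply_run_rot (ε₁ := 1) (ε₂ := ε₂) (k := 1) (by decide) F w
  have e2 := apply_run_t (ε₁ := 1) (ε₂ := ε₂) F w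
  change ((4 : ℕ) : ℂ)⁻¹ * (F (A.run (.rot 1) w) + (F (A.inverse.run (.rot 1) w) +
    (F (A.run .t w) + F (A.inverse.run .t w)))) = _
  rw [e2, ← add_assoc, e1]
  push_cast
  ring

end Ternary

/-- Division by `β` reduces the problem to the pencil `(α/β) P + Q`; the level is the length of a
word at which the eigenfunction does not vanish. -/
theorem mem_levelSpectrum_iff {d : ℕ} {S : Finset (TreeAut d)} {l : Fin d} {act : Fin d → Bool}
    {α β γ : ℂ} (hβ : β ≠ 0)
    (h : ∀ F w, levelOperator S F w = α * avgFirst F w + β * selfSimilarProj l act w F - γ * F w)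
    (z : ℂ) : z ∈ levelSpectrum S ↔ ∃ n, (z + γ) / β ∈ pairSpectrum l act (α / β) n := by
  have key : ∀ F : List (Fin d) → ℂ, (∀ w, levelOperator S F w = z * F w) ↔
      ∀ w, α / β * avgFirst F w + selfSimilarProj l act w F = (z + γ) / β * F w := by
    intro F
    refine forall_congr' fun w => ?_
    rw [h]
    constructor
    · intro h1
      field_simp
      linear_combination h1
    · intro h1
      field_simp at h1
      linear_combination h1
  constructor
  · rintro ⟨F, hF, hz⟩
    obtain ⟨w, hw⟩ := Function.ne_iff.1 hF
    exact ⟨w.length, F, ⟨w, rfl, hw⟩, (key F).1 hz⟩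
  · rintro ⟨n, F, ⟨w, -, hw⟩, hz⟩
    exact ⟨F, Function.ne_iff.2 ⟨w, hw⟩, (key F).2 hz⟩

/-! Julia sets of real quadratic polynomials outside the Mandelbrot set. -/

section Julia

open Filter Topology

theorem mem_filledJuliaSet {f : ℂ → ℂ} {z : ℂ} :
    z ∈ filledJuliaSet f ↔ Bornology.IsBounded (Set.range fun n : ℕ => f^[n] z) := Iff.rfl

theorem mem_filledJuliaSet_iff {lam : ℝ} {z : ℂ} :
    z ∈ filledJuliaSet (fun z => z ^ 2 - (lam : ℂ)) ↔
      z ^ 2 - (lam : ℂ) ∈ filledJuliaSet (fun z => z ^ 2 - (lam : ℂ)) := by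
  set f : ℂ → ℂ := fun z => z ^ 2 - (lam : ℂ) with hf
  have h : Set.range (fun n : ℕ => f^[n] z) = insert z (Set.range fun n : ℕ => f^[n] (f z)) := by
    ext w
    constructor
    · rintro ⟨n, rfl⟩
      cases n with
      | zero => exact Or.inl rfl
      | succ n => exact Or.inr ⟨n, rfl⟩
    · rintro (rfl | ⟨n, rfl⟩)
      · exact ⟨0, rfl⟩
      · exact ⟨n + 1, rfl⟩
  rw [mem_filledJuliaSet, mem_filledJuliaSet, h, Bornology.isBounded_insert]

theorem mem_filledJuliaSet_of_fixed {lam : ℝ} {z : ℂ} (h : z ^ 2 - (lam : ℂ) = z) :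
    z ∈ filledJuliaSet (fun z => z ^ 2 - (lam : ℂ)) := by
  have : ∀ n : ℕ, (fun z => z ^ 2 - (lam : ℂ))^[n] z = z := fun n => Function.iterate_fixed h n
  change Bornology.IsBounded (Set.range fun n : ℕ => (fun z => z ^ 2 - (lam : ℂ))^[n] z)
  simp only [this, Set.range_const]
  exact Bornology.isBounded_singleton

/-! ### Reality and compactness of the Julia set when the positive fixed point `β` satisfies `lam -
β > 1/4` -/

variable {lam β : ℝ}

/-- Since `(β + t)² - lam = β + 2βt + t²` and `β > 2`, an excess `t` of the modulus over `β` at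
least doubles at each step. -/
theorem norm_le_of_mem_filledJuliaSet (hβ : β ^ 2 = lam + β) (hβ0 : 0 < β) (hlam : 1 / 4 < lam - β)
    {z : ℂ} (hz : z ∈ filledJuliaSet (fun z => z ^ 2 - (lam : ℂ))) : ‖z‖ ≤ β := by
  by_contra! hlt
  have hβ2 : 2 < β := by nlinarith
  set f : ℂ → ℂ := fun z => z ^ 2 - (lam : ℂ) with hf
  have hgrow : ∀ n : ℕ, β + 2 ^ n * (‖z‖ - β) ≤ ‖f^[n] z‖ := by
    intro n
    induction n with
    | zero => simp
    | succ n ih =>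
      rw [Function.iterate_succ_apply']
      have h1 : ‖f^[n] z‖ ^ 2 - lam ≤ ‖f (f^[n] z)‖ := by
        have := norm_sub_norm_le ((f^[n] z) ^ 2) (lam : ℂ)
        rw [norm_pow, Complex.norm_of_nonneg (by linarith)] at this
        exact this
      have h2 : (0 : ℝ) ≤ 2 ^ n * (‖z‖ - β) := mul_nonneg (by positivity) (by linarith)
      rw [pow_succ]
      nlinarith
  obtain ⟨C, hC⟩ := isBounded_iff_forall_norm_le.1 (mem_filledJuliaSet.1 hz)
  obtain ⟨n, hn⟩ := ((tendsto_pow_atTop_atTop_of_one_lt (r := (2 : ℝ)) (by norm_num)).eventually_gt_atTop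
    (C / (‖z‖ - β))).exists
  rw [div_lt_iff₀ (by linarith)] at hn
  have := hgrow n
  have := hC _ ⟨n, rfl⟩
  linarith

/-- The next iterate has real part `re² - im² - lam`, which is at least `-β`. -/
theorem le_re_sq_of_mem_filledJuliaSet (hβ : β ^ 2 = lam + β) (hβ0 : 0 < β)
    (hlam : 1 / 4 < lam - β) {z : ℂ} (hz : z ∈ filledJuliaSet (fun z => z ^ 2 - (lam : ℂ))) :
    lam - β ≤ z.re ^ 2 := by
  have h1 := norm_le_of_mem_filledJuliaSet hβ hβ0 hlam (mem_filledJuliaSet_iff.1 hz)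
  have h2 := (abs_le.1 ((Complex.abs_re_le_norm _).trans h1)).1
  simp [pow_two] at h2
  nlinarith [mul_self_nonneg z.im]

/-- The imaginary part of `z² - lam` is `2 re im`, so along the orbit its square grows at least by
the factor `4 (lam - β) > 1`, while the orbit is bounded. -/
theorem im_eq_zero_of_mem_filledJuliaSet (hβ : β ^ 2 = lam + β) (hβ0 : 0 < β)
    (hlam : 1 / 4 < lam - β) {z : ℂ} (hz : z ∈ filledJuliaSet (fun z => z ^ 2 - (lam : ℂ))) :
    z.im = 0 := by
  by_contra hne
  set f : ℂ → ℂ := fun z => z ^ 2 - (lam : ℂ) with hf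
  have hmem : ∀ n : ℕ, f^[n] z ∈ filledJuliaSet f := by
    intro n
    induction n with
    | zero => exact hz
    | succ n ih =>
      rw [Function.iterate_succ_apply']
      exact mem_filledJuliaSet_iff.1 ih
  have hgrow : ∀ n : ℕ, (4 * (lam - β)) ^ n * z.im ^ 2 ≤ (f^[n] z).im ^ 2 := by
    intro n
    induction n with
    | zero => simp
    | succ n ih =>
      rw [Function.iterate_succ_apply']
      have h1 := le_re_sq_of_mem_filledJuliaSet hβ hβ0 hlam (hmem n)
      have h2 : (f (f^[n] z)).im = 2 * (f^[n] z).re * (f^[n] z).im := by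
        simp [hf, pow_two]; ring
      rw [h2, pow_succ]
      calc (4 * (lam - β)) ^ n * (4 * (lam - β)) * z.im ^ 2
          = 4 * (lam - β) * ((4 * (lam - β)) ^ n * z.im ^ 2) := by ring
        _ ≤ 4 * (f^[n] z).re ^ 2 * (f^[n] z).im ^ 2 := by
          apply mul_le_mul (by linarith) ih ?_ (by positivity)
          have : 0 < lam - β := by linarith
          positivity
        _ = (2 * (f^[n] z).re * (f^[n] z).im) ^ 2 := by ring
  have hpos : 0 < z.im ^ 2 := by positivity
  obtain ⟨n, hn⟩ := ((tendsto_pow_atTop_atTop_of_one_lt (r := 4 * (lam - β))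
    (by linarith)).eventually_gt_atTop (β ^ 2 / z.im ^ 2)).exists
  rw [div_lt_iff₀ hpos] at hn
  have h1 := hgrow n
  have h2 := (Complex.abs_im_le_norm _).trans
    (norm_le_of_mem_filledJuliaSet hβ hβ0 hlam (hmem n))
  have h3 : (f^[n] z).im ^ 2 ≤ β ^ 2 := sq_le_sq' (abs_le.1 h2).1 (abs_le.1 h2).2
  linarith

theorem mem_filledJuliaSet_iff_norm_le (hβ : β ^ 2 = lam + β) (hβ0 : 0 < β)
    (hlam : 1 / 4 < lam - β) {z : ℂ} : z ∈ filledJuliaSet (fun z => z ^ 2 - (lam : ℂ)) ↔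
      ∀ n : ℕ, ‖(fun z => z ^ 2 - (lam : ℂ))^[n] z‖ ≤ β := by
  constructor
  · intro hz n
    refine norm_le_of_mem_filledJuliaSet hβ hβ0 hlam ?_
    induction n with
    | zero => exact hz
    | succ n ih =>
      rw [Function.iterate_succ_apply']
      exact mem_filledJuliaSet_iff.1 ih
  · intro h
    refine mem_filledJuliaSet.2 (isBounded_iff_forall_norm_le.2 ⟨β, ?_⟩)
    rintro _ ⟨n, rfl⟩
    exact h n

theorem continuous_iterate_quadratic (n : ℕ) :
    Continuous (fun z : ℂ => z ^ 2 - (lam : ℂ))^[n] := Continuous.iterate (by fun_prop) n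

theorem isClosed_filledJuliaSet (hβ : β ^ 2 = lam + β) (hβ0 : 0 < β) (hlam : 1 / 4 < lam - β) :
    IsClosed (filledJuliaSet fun z => z ^ 2 - (lam : ℂ)) := by
  have : filledJuliaSet (fun z => z ^ 2 - (lam : ℂ)) =
      ⋂ n : ℕ, {z | ‖(fun z => z ^ 2 - (lam : ℂ))^[n] z‖ ≤ β} := by
    ext z
    rw [mem_filledJuliaSet_iff_norm_le hβ hβ0 hlam]
    simp
  rw [this]
  exact isClosed_iInter fun n =>
    isClosed_le (continuous_iterate_quadratic n).norm continuous_const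

/-- The filled Julia set is closed, and being contained in the real line it has no interior. -/
theorem juliaSet_eq_filledJuliaSet (hβ : β ^ 2 = lam + β) (hβ0 : 0 < β) (hlam : 1 / 4 < lam - β) :
    juliaSet lam = filledJuliaSet fun z => z ^ 2 - (lam : ℂ) := by
  have hint : interior (filledJuliaSet fun z => z ^ 2 - (lam : ℂ)) = ∅ := by
    by_contra hne
    obtain ⟨z, hz⟩ := Set.nonempty_iff_ne_empty.2 hne
    obtain ⟨ε, hε, hball⟩ := Metric.isOpen_iff.1 isOpen_interior z hz
    have h1 := im_eq_zero_of_mem_filledJuliaSet hβ hβ0 hlam (interior_subset hz)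
    have h2 := im_eq_zero_of_mem_filledJuliaSet hβ hβ0 hlam
      (interior_subset (hball (show z + (ε / 2 : ℝ) * Complex.I ∈ Metric.ball z ε by
        rw [Metric.mem_ball, dist_eq_norm, add_sub_cancel_left, norm_mul, Complex.norm_I, mul_one,
          Complex.norm_of_nonneg (by positivity)]
        linarith)))
    rw [Complex.add_im, h1, Complex.im_ofReal_mul, Complex.I_im] at h2
    linarith
  rw [juliaSet, IsClosed.frontier_eq (isClosed_filledJuliaSet hβ hβ0 hlam), hint, Set.sdiff_empty]

/-- The set of the real points of the Julia set. -/
def realJuliaSet (lam : ℝ) : Set ℝ := {x | (x : ℂ) ∈ juliaSet lam}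

theorem mem_realJuliaSet_iff (hβ : β ^ 2 = lam + β) (hβ0 : 0 < β) (hlam : 1 / 4 < lam - β) {x : ℝ} :
    x ∈ realJuliaSet lam ↔ x ^ 2 - lam ∈ realJuliaSet lam := by
  simp only [realJuliaSet, Set.mem_ofPred_eq, juliaSet_eq_filledJuliaSet hβ hβ0 hlam]
  rw [mem_filledJuliaSet_iff]
  push_cast
  rfl

theorem image_realJuliaSet (hβ : β ^ 2 = lam + β) (hβ0 : 0 < β) (hlam : 1 / 4 < lam - β) :
    Complex.ofReal '' realJuliaSet lam = juliaSet lam := by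
  ext z
  constructor
  · rintro ⟨x, hx, rfl⟩
    exact hx
  · intro hz
    have him := im_eq_zero_of_mem_filledJuliaSet hβ hβ0 hlam
      (juliaSet_eq_filledJuliaSet hβ hβ0 hlam ▸ hz)
    have hz' : ((z.re : ℝ) : ℂ) = z := Complex.ext rfl (by simp [him])
    refine ⟨z.re, ?_, hz'⟩
    change ((z.re : ℝ) : ℂ) ∈ juliaSet lam
    rwa [hz']

theorem abs_le_of_mem_realJuliaSet (hβ : β ^ 2 = lam + β) (hβ0 : 0 < β) (hlam : 1 / 4 < lam - β)
    {x : ℝ} (hx : x ∈ realJuliaSet lam) : |x| ≤ β := by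
  have := norm_le_of_mem_filledJuliaSet hβ hβ0 hlam
    (juliaSet_eq_filledJuliaSet hβ hβ0 hlam ▸ hx : (x : ℂ) ∈ _)
  simpa using this

theorem le_sq_of_mem_realJuliaSet (hβ : β ^ 2 = lam + β) (hβ0 : 0 < β) (hlam : 1 / 4 < lam - β)
    {x : ℝ} (hx : x ∈ realJuliaSet lam) : lam - β ≤ x ^ 2 := by
  have := le_re_sq_of_mem_filledJuliaSet hβ hβ0 hlam
    (juliaSet_eq_filledJuliaSet hβ hβ0 hlam ▸ hx : (x : ℂ) ∈ _)
  simpa using this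

theorem fixed_mem_realJuliaSet (hβ : β ^ 2 = lam + β) (hβ0 : 0 < β) (hlam : 1 / 4 < lam - β) :
    β ∈ realJuliaSet lam := by
  change (β : ℂ) ∈ juliaSet lam
  rw [juliaSet_eq_filledJuliaSet hβ hβ0 hlam]
  apply mem_filledJuliaSet_of_fixed
  have : (β : ℂ) ^ 2 = lam + β := by exact_mod_cast hβ
  linear_combination this

theorem neg_mem_realJuliaSet (hβ : β ^ 2 = lam + β) (hβ0 : 0 < β) (hlam : 1 / 4 < lam - β)
    {x : ℝ} (hx : x ∈ realJuliaSet lam) : -x ∈ realJuliaSet lam := by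
  rw [mem_realJuliaSet_iff hβ hβ0 hlam, neg_sq]
  exact (mem_realJuliaSet_iff hβ hβ0 hlam).1 hx

theorem isCompact_realJuliaSet (hβ : β ^ 2 = lam + β) (hβ0 : 0 < β) (hlam : 1 / 4 < lam - β) :
    IsCompact (realJuliaSet lam) := by
  refine Metric.isCompact_of_isClosed_isBounded ?_ ?_
  · have h := isClosed_filledJuliaSet hβ hβ0 hlam
    rw [← juliaSet_eq_filledJuliaSet hβ hβ0 hlam] at h
    exact h.preimage Complex.continuous_ofReal
  · exact isBounded_iff_forall_norm_le.2 ⟨β, fun x hx => abs_le_of_mem_realJuliaSet hβ hβ0 hlam hx⟩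

/-- The iterated preimages of any point of `[-β, β]` accumulate at the Julia set. -/
theorem exists_iterate_eq (hβ : β ^ 2 = lam + β) (hβ0 : 0 < β) (hlam : 1 / 4 < lam - β) {p : ℝ}
    (hp : |p| ≤ β) (n : ℕ) {x : ℝ} (hx : x ∈ realJuliaSet lam) :
    ∃ q, |q| ≤ β ∧ (fun y => y ^ 2 - lam)^[n] q = p ∧
      |q - x| * (2 * √(lam - β)) ^ n ≤ 2 * β := by
  induction n generalizing x with
  | zero =>
    refine ⟨p, hp, rfl, ?_⟩
    have h1 := abs_le_of_mem_realJuliaSet hβ hβ0 hlam hx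
    have h2 := abs_sub p x
    simp only [pow_zero, mul_one]
    linarith
  | succ n ih =>
    obtain ⟨q, hq, hqp, hdist⟩ := ih ((mem_realJuliaSet_iff hβ hβ0 hlam).1 hx)
    set r := √(lam - β)
    have hr : 0 ≤ r := Real.sqrt_nonneg _
    have hxr : r ≤ |x| := Real.sqrt_le_iff.2 ⟨abs_nonneg _, by
      rw [sq_abs]; exact le_sq_of_mem_realJuliaSet hβ hβ0 hlam hx⟩
    set s := √(lam + q)
    have hq' := abs_le.1 hq
    have hrs : r ≤ s := Real.sqrt_le_sqrt (by linarith)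
    have hs2 : s ^ 2 = lam + q := Real.sq_sqrt (by linarith)
    have hsβ : s ≤ β := Real.sqrt_le_iff.2 ⟨hβ0.le, by linarith⟩
    have hs0 : 0 ≤ s := Real.sqrt_nonneg _
    -- Pull back by the branch of the square root with the sign of `x`: both moduli are at least
    -- `r`, so the difference of the squares is at least `2r` times the distance.
    have key : ∀ t u : ℝ, t ^ 2 = lam + q → u ^ 2 = x ^ 2 → 2 * r ≤ t + u →
        |t - u| * (2 * r) ^ (n + 1) ≤ 2 * β := by
      intro t u ht hu htu
      have h1 : |q - (x ^ 2 - lam)| = |t - u| * (t + u) := by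
        have h0 : |t - u| * (t + u) = |(t - u) * (t + u)| := by
          rw [abs_mul, abs_of_nonneg (show 0 ≤ t + u by linarith)]
        rw [h0]
        congr 1
        linear_combination -ht + hu
      rw [h1] at hdist
      refine le_trans ?_ hdist
      rw [pow_succ, mul_assoc, mul_comm _ (2 * r)]
      gcongr
    rcases le_total 0 x with h0 | h0
    · rw [abs_of_nonneg h0] at hxr
      refine ⟨s, by rwa [abs_of_nonneg hs0], ?_, key s x hs2 rfl (by linarith)⟩
      rw [Function.iterate_succ_apply, hs2, add_sub_cancel_left, hqp]
    · rw [abs_of_nonpos h0] at hxr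
      refine ⟨-s, by rwa [abs_neg, abs_of_nonneg hs0], ?_, ?_⟩
      · rw [Function.iterate_succ_apply, neg_sq, hs2, add_sub_cancel_left, hqp]
      · have := key s (-x) hs2 (by ring) (by linarith)
        rwa [show -s - x = -(s - -x) by ring, abs_neg]

theorem exists_iterate_eq_abs_lt (hβ : β ^ 2 = lam + β) (hβ0 : 0 < β) (hlam : 1 / 4 < lam - β)
    {x : ℝ} (hx : x ∈ realJuliaSet lam) {ε : ℝ} (hε : 0 < ε) :
    ∃ N : ℕ, ∀ n ≥ N, ∀ p, |p| ≤ β →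
      ∃ q, |q| ≤ β ∧ (fun y => y ^ 2 - lam)^[n] q = p ∧ |q - x| < ε := by
  have hr : 1 < 2 * √(lam - β) := by
    have : 1 / 2 < √(lam - β) := Real.lt_sqrt_of_sq_lt (by linarith)
    linarith
  obtain ⟨N, hN⟩ := Filter.eventually_atTop.1
    ((tendsto_pow_atTop_atTop_of_one_lt hr).eventually_gt_atTop (2 * β / ε))
  refine ⟨N, fun n hn p hp => ?_⟩
  obtain ⟨q, hq, hqp, hdist⟩ := exists_iterate_eq hβ hβ0 hlam hp n hx
  refine ⟨q, hq, hqp, ?_⟩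
  have := hN n hn
  rw [div_lt_iff₀ hε] at this
  by_contra! hle
  have h2 : ε * (2 * √(lam - β)) ^ n ≤ |q - x| * (2 * √(lam - β)) ^ n := by gcongr
  linarith

theorem mem_realJuliaSet_of_iterate (hβ : β ^ 2 = lam + β) (hβ0 : 0 < β) (hlam : 1 / 4 < lam - β)
    (n : ℕ) {q : ℝ} (h : (fun y => y ^ 2 - lam)^[n] q ∈ realJuliaSet lam) :
    q ∈ realJuliaSet lam := by
  induction n generalizing q with
  | zero => exact h
  | succ n ih => exact (mem_realJuliaSet_iff hβ hβ0 hlam).2 (ih h)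

/-- Near `x` there are preimages of both `β` and `-β` under the same iterate. They are distinct
points of the Julia set, so one of them is not `x`. -/
theorem preperfect_realJuliaSet (hβ : β ^ 2 = lam + β) (hβ0 : 0 < β) (hlam : 1 / 4 < lam - β) :
    Preperfect (realJuliaSet lam) := by
  intro x hx
  rw [accPt_iff_nhds]
  intro U hU
  obtain ⟨ε, hε, hball⟩ := Metric.mem_nhds_iff.1 hU
  have hfix := fixed_mem_realJuliaSet hβ hβ0 hlam
  have hβabs : |β| ≤ β := (abs_of_pos hβ0).le
  obtain ⟨N, hN⟩ := exists_iterate_eq_abs_lt hβ hβ0 hlam hx hε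
  obtain ⟨q, -, hqp, hdist⟩ := hN N le_rfl β hβabs
  obtain ⟨q', -, hqp', hdist'⟩ := hN N le_rfl (-β) (by rwa [abs_neg])
  have hmem : q ∈ realJuliaSet lam :=
    mem_realJuliaSet_of_iterate hβ hβ0 hlam N (by rw [hqp]; exact hfix)
  have hmem' : q' ∈ realJuliaSet lam :=
    mem_realJuliaSet_of_iterate hβ hβ0 hlam N (by
      rw [hqp']; exact neg_mem_realJuliaSet hβ hβ0 hlam hfix)
  by_cases hqx : q = x
  · refine ⟨q', ⟨hball (by rwa [Metric.mem_ball, Real.dist_eq]), hmem'⟩, ?_⟩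
    rintro rfl
    rw [← hqx, hqp] at hqp'
    linarith
  · exact ⟨q, ⟨hball (by rwa [Metric.mem_ball, Real.dist_eq]), hmem⟩, hqx⟩

theorem isTotallyDisconnected_of_volume_eq_zero {K : Set ℝ} (hK : volume K = 0) :
    IsTotallyDisconnected K := by
  intro t ht hpre x hx y hy
  by_contra hne
  have key : ∀ x ∈ t, ∀ y ∈ t, ¬ x < y := by
    intro x hx y hy hlt
    have h1 : Set.Icc x y ⊆ K := (hpre.Icc_subset hx hy).trans ht
    have h2 := measure_mono_null h1 hK
    rw [Real.volume_Icc, ENNReal.ofReal_eq_zero] at h2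
    linarith
  rcases lt_or_gt_of_ne hne with h | h
  · exact key x hx y hy h
  · exact key y hy x hx h

/-- The density with respect to which the quadratic polynomial expands lengths on its Julia set by
more than the factor `2`. -/
noncomputable def juliaDensity (lam x : ℝ) : ℝ := (√(2 * lam - x ^ 2))⁻¹

/-- The derivative alone need not exceed `2` in modulus. The density is modelled on the Chebyshev
case `lam = 2`, where `(4 - x²)^(-1/2)` is expanded exactly by `2`; for `lam > 2` the constant `√(8
- 8/lam)` exceeds `2`. -/
theorem mul_juliaDensity_le (hβ : β ^ 2 = lam + β) (hβ0 : 0 < β) (hlam : 1 / 4 < lam - β)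
    {x : ℝ} (hx : x ∈ realJuliaSet lam) :
    √(8 - 8 / lam) * juliaDensity lam x ≤ |2 * x| * juliaDensity lam (x ^ 2 - lam) := by
  have hβ2 : 2 < β := by nlinarith
  have hlam0 : 0 < lam := by linarith
  have hbound : ∀ y ∈ realJuliaSet lam, 0 < 2 * lam - y ^ 2 := by
    intro y hy
    have := abs_le.1 (abs_le_of_mem_realJuliaSet hβ hβ0 hlam hy)
    nlinarith
  have hA := hbound x hx
  have hB := hbound _ ((mem_realJuliaSet_iff hβ hβ0 hlam).1 hx)
  rw [juliaDensity, juliaDensity, ← div_eq_mul_inv, ← div_eq_mul_inv,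
    div_le_div_iff₀ (Real.sqrt_pos.2 hA) (Real.sqrt_pos.2 hB)]
  have hc : 0 ≤ 8 - 8 / lam := by
    rw [sub_nonneg, div_le_iff₀ hlam0]
    linarith
  rw [← Real.sqrt_mul hc, ← Real.sqrt_sq_eq_abs, ← Real.sqrt_mul (sq_nonneg _)]
  apply Real.sqrt_le_sqrt
  have h1 : (2 * x) ^ 2 * (2 * lam - x ^ 2) - (8 - 8 / lam) * (2 * lam - (x ^ 2 - lam) ^ 2) =
      4 * (lam - 2) / lam * (x ^ 2 - lam) ^ 2 + 4 * (lam - 2) ^ 2 := by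
    field_simp
    ring
  have h2 : 0 ≤ 4 * (lam - 2) / lam * (x ^ 2 - lam) ^ 2 + 4 * (lam - 2) ^ 2 := by
    have : 0 ≤ lam - 2 := by linarith
    positivity
  linarith

/-- Each of the positive and negative halves of `K` is mapped injectively into `K` with expansion at
least `c > 2`. Hence the weighted measure `ν` of `K` satisfies `c ν ≤ 2 ν`; as it is finite, it is
zero. -/
theorem volume_realJuliaSet (hβ : β ^ 2 = lam + β) (hβ0 : 0 < β) (hlam : 1 / 4 < lam - β) :
    volume (realJuliaSet lam) = 0 := by
  have hβ2 : 2 < β := by nlinarith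
  have hlam0 : 0 < lam := by linarith
  set K := realJuliaSet lam
  have hcomp := isCompact_realJuliaSet hβ hβ0 hlam
  have hKm : MeasurableSet K := hcomp.measurableSet
  set ρ : ℝ → ℝ≥0∞ := fun x => ENNReal.ofReal (juliaDensity lam x) with hρ
  set c := √(8 - 8 / lam)
  have hc : 2 < c := by
    apply Real.lt_sqrt_of_sq_lt
    have : 8 / lam < 4 := by rw [div_lt_iff₀ hlam0]; linarith
    linarith
  have hhalf : ∀ E ⊆ K, MeasurableSet E → Set.InjOn (fun x : ℝ => x ^ 2 - lam) E →
      ENNReal.ofReal c * ∫⁻ x in E, ρ x ≤ ∫⁻ x in K, ρ x := by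
    intro E hE hEm hinj
    have hder : ∀ x ∈ E, HasDerivWithinAt (fun x : ℝ => x ^ 2 - lam) (2 * x) E x := by
      intro x _
      have := ((hasDerivAt_pow 2 x).sub_const lam).hasDerivWithinAt (s := E)
      simpa using this
    have himg : (fun x : ℝ => x ^ 2 - lam) '' E ⊆ K := by
      rintro _ ⟨x, hx, rfl⟩
      exact (mem_realJuliaSet_iff hβ hβ0 hlam).1 (hE hx)
    refine le_trans ?_ (lintegral_mono_set himg)
    rw [lintegral_image_eq_lintegral_abs_deriv_mul hEm hder hinj,
      ← lintegral_const_mul' _ _ ENNReal.ofReal_ne_top]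
    refine setLIntegral_mono' hEm fun x hx => ?_
    simp only [hρ]
    rw [← ENNReal.ofReal_mul (by linarith), ← ENNReal.ofReal_mul (abs_nonneg _)]
    exact ENNReal.ofReal_le_ofReal (mul_juliaDensity_le hβ hβ0 hlam (hE hx))
  have hunion : K = (K ∩ Set.Ioi 0) ∪ (K ∩ Set.Iio 0) := by
    rw [← Set.inter_union_distrib_left, Set.union_comm, Set.Iio_union_Ioi, Set.left_eq_inter]
    rintro x hx rfl
    have := le_sq_of_mem_realJuliaSet hβ hβ0 hlam hx
    norm_num at this
    linarith
  have hpos := hhalf (K ∩ Set.Ioi 0) Set.inter_subset_left (hKm.inter measurableSet_Ioi) (by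
    rintro x ⟨-, hx⟩ y ⟨-, hy⟩ hxy
    simp only [Set.mem_Ioi, sub_left_inj] at hx hy hxy
    exact (pow_left_inj₀ hx.le hy.le two_ne_zero).1 hxy)
  have hneg := hhalf (K ∩ Set.Iio 0) Set.inter_subset_left (hKm.inter measurableSet_Iio) (by
    rintro x ⟨-, hx⟩ y ⟨-, hy⟩ hxy
    simp only [Set.mem_Iio, sub_left_inj] at hx hy hxy
    have : (-x) ^ 2 = (-y) ^ 2 := by rw [neg_sq, neg_sq, hxy]
    exact neg_injective ((pow_left_inj₀ (by linarith) (by linarith) two_ne_zero).1 this))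
  have hsum : ∫⁻ x in K, ρ x ≤ (∫⁻ x in K ∩ Set.Ioi 0, ρ x) + ∫⁻ x in K ∩ Set.Iio 0, ρ x := by
    conv_lhs => rw [hunion]
    exact lintegral_union_le _ _ _
  have hρle : ∀ x ∈ K, juliaDensity lam x ≤ (√(lam - β))⁻¹ := by
    intro x hx
    have := abs_le.1 (abs_le_of_mem_realJuliaSet hβ hβ0 hlam hx)
    exact inv_anti₀ (Real.sqrt_pos.2 (by linarith)) (Real.sqrt_le_sqrt (by nlinarith))
  have hfin : ∫⁻ x in K, ρ x ≠ ∞ := by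
    refine ne_top_of_le_ne_top ?_ (setLIntegral_mono' (g := fun _ =>
      ENNReal.ofReal (√(lam - β))⁻¹) hKm fun x hx => ENNReal.ofReal_le_ofReal (hρle x hx))
    rw [setLIntegral_const]
    exact ENNReal.mul_ne_top ENNReal.ofReal_ne_top hcomp.measure_ne_top
  have hzero : ∫⁻ x in K, ρ x = 0 := by
    set ν := ∫⁻ x in K, ρ x
    by_contra hne
    have h1 : ENNReal.ofReal c * ν ≤ ENNReal.ofReal 2 * ν := by
      calc ENNReal.ofReal c * ν ≤ ENNReal.ofReal c *
            ((∫⁻ x in K ∩ Set.Ioi 0, ρ x) + ∫⁻ x in K ∩ Set.Iio 0, ρ x) := by gcongr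
        _ ≤ ν + ν := by rw [mul_add]; exact add_le_add hpos hneg
        _ = ENNReal.ofReal 2 * ν := by rw [ENNReal.ofReal_ofNat, two_mul]
    have h2 := (ENNReal.mul_le_mul_iff_left hne hfin).1 h1
    rw [ENNReal.ofReal_le_ofReal_iff (by norm_num)] at h2
    linarith
  -- The density is bounded below by a positive constant, so Lebesgue measure vanishes along with
  -- the weighted one.
  have hlow : ENNReal.ofReal (√(2 * lam))⁻¹ * volume K ≤ ∫⁻ x in K, ρ x := by
    rw [← setLIntegral_const]
    refine setLIntegral_mono' hKm fun x hx => ENNReal.ofReal_le_ofReal ?_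
    have := abs_le.1 (abs_le_of_mem_realJuliaSet hβ hβ0 hlam hx)
    exact inv_anti₀ (Real.sqrt_pos.2 (by nlinarith)) (Real.sqrt_le_sqrt (by nlinarith))
  rw [hzero, nonpos_iff_eq_zero, mul_eq_zero] at hlow
  refine hlow.resolve_left ?_
  rw [ENNReal.ofReal_eq_zero, not_le]
  positivity

theorem isCantorSet_realJuliaSet (hβ : β ^ 2 = lam + β) (hβ0 : 0 < β) (hlam : 1 / 4 < lam - β) :
    IsCantorSet (realJuliaSet lam) :=
  ⟨⟨β, fixed_mem_realJuliaSet hβ hβ0 hlam⟩, isCompact_realJuliaSet hβ hβ0 hlam,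
    preperfect_realJuliaSet hβ hβ0 hlam,
    isTotallyDisconnected_of_volume_eq_zero (volume_realJuliaSet hβ hβ0 hlam)⟩

end Julia

/-! The spectra of the two groups on the binary tree. -/

section BinarySpectrum

theorem exists_real_of_sq_eq {z : ℂ} {r : ℝ} (hr : 0 ≤ r) (h : z ^ 2 = r) :
    ∃ x : ℝ, z = x ∧ x ^ 2 = r := by
  have h1 : ((√r : ℝ) : ℂ) ^ 2 = r := by exact_mod_cast congrArg Complex.ofReal (Real.sq_sqrt hr)
  rcases sq_eq_sq_iff_eq_or_eq_neg.1 (h.trans h1.symm) with h2 | h2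
  · exact ⟨√r, h2, Real.sq_sqrt hr⟩
  · exact ⟨-√r, by rw [h2]; push_cast; rfl, by rw [neg_sq, Real.sq_sqrt hr]⟩

/-- For a fixed sign `σ`, `t ↦ σ √t` is a continuous branch of the square root through `e`; density
statements are carried along it. -/
theorem exists_sign_mul_sqrt (e : ℝ) : ∃ σ : ℝ, σ ^ 2 = 1 ∧ e = σ * √(e ^ 2) := by
  rw [Real.sqrt_sq_eq_abs]
  rcases le_total 0 e with h0 | h0
  · exact ⟨1, by norm_num, by rw [abs_of_nonneg h0, one_mul]⟩
  · exact ⟨-1, by norm_num, by rw [abs_of_nonpos h0]; ring⟩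

theorem binary_card_act :
    (Finset.univ.filter fun x : Fin 2 => x ≠ 1 ∧ (fun _ => true) x = true).card = 1 := by decide

theorem binary_card_not_act :
    (Finset.univ.filter fun x : Fin 2 => x ≠ 1 ∧ ¬ (fun _ => true) x = true).card = 0 := by decide

/-- With `y = 1 + c` the recursion is `c ↦ 2c² - 1`, and preimages of points of `[-1, 1]` are again
in `[-1, 1]`. -/
theorem binary_pairSpectrum_one {n : ℕ} {y : ℂ}
    (h : y ∈ pairSpectrum (1 : Fin 2) (fun _ => true) 1 n) :
    ∃ c : ℝ, c ^ 2 ≤ 1 ∧ y = 1 + c := by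
  induction n generalizing y with
  | zero => exact ⟨1, by norm_num, by rw [mem_pairSpectrum_zero h]; push_cast; rfl⟩
  | succ n ih =>
    rcases mem_pairSpectrum_succ binary_card_act binary_card_not_act one_ne_zero h with h | h | h
    · exact ⟨-1, by norm_num, by rw [h]; push_cast; ring⟩
    · exact ⟨0, by norm_num, by rw [h]; push_cast; ring⟩
    · rw [Nat.cast_one] at h
      obtain ⟨c, hc, hy⟩ := ih h
      have hc' := abs_le.1 ((sq_le_one_iff_abs_le_one c).1 hc)
      obtain ⟨x, hx, hx2⟩ := exists_real_of_sq_eq (z := y - 1) (r := (1 + c) / 2) (by linarith) (by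
        push_cast at hy ⊢
        linear_combination hy / 2)
      exact ⟨x, by linarith, by linear_combination hx⟩

theorem sin_dyadic_ne_zero (j : ℤ) (m : ℕ) :
    Real.sin ((2 * j + 1) * Real.pi / 2 ^ (m + 1)) ≠ 0 := by
  intro h
  obtain ⟨n, hn⟩ := Real.sin_eq_zero_iff.1 h
  have h1 : (n : ℝ) * 2 ^ (m + 1) = 2 * j + 1 := by
    rw [eq_div_iff (by positivity)] at hn
    apply mul_right_cancel₀ Real.pi_ne_zero
    linear_combination hn
  have h2 : n * 2 ^ (m + 1) = 2 * j + 1 := by exact_mod_cast h1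
  rw [pow_succ] at h2
  have h3 : 2 * (n * 2 ^ m) = 2 * j + 1 := by linear_combination h2
  omega

/-- Halving the angle inverts `c ↦ 2c² - 1`, starting from `c = 0` on level one. The exceptional
values `y = 0` and `y = 1` are avoided because `sin 2θ ≠ 0` excludes `cos θ = -1` and `cos θ = 0`.
-/
theorem cos_mem_pairSpectrum (j : ℤ) (m : ℕ) :
    1 + (Real.cos ((2 * j + 1) * Real.pi / 2 ^ (m + 1)) : ℂ) ∈
      pairSpectrum (1 : Fin 2) (fun _ => true) 1 (m + 1) := by
  induction m with
  | zero =>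
    have h : Real.cos ((2 * j + 1) * Real.pi / 2 ^ (0 + 1)) = 0 := by
      rw [Real.cos_eq_zero_iff]
      exact ⟨j, by simp⟩
    rw [h, Complex.ofReal_zero, add_zero]
    exact one_mem_pairSpectrum le_rfl 1
  | succ m ih =>
    set θ := (2 * j + 1) * Real.pi / 2 ^ (m + 1 + 1) with hθ
    have h2θ : (2 * j + 1) * Real.pi / 2 ^ (m + 1) = 2 * θ := by
      rw [hθ, pow_succ 2 (m + 1)]
      field_simp
    have hs := sin_dyadic_ne_zero j m
    rw [h2θ, Real.sin_two_mul] at hs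
    rw [h2θ, Real.cos_two_mul] at ih
    have hc0 : Real.cos θ ≠ 0 := right_ne_zero_of_mul hs
    have hs0 : Real.sin θ ≠ 0 := right_ne_zero_of_mul (left_ne_zero_of_mul hs)
    have hc1 : Real.cos θ ≠ -1 := by
      intro h
      have := Real.sin_sq_add_cos_sq θ
      rw [h] at this
      exact hs0 (pow_eq_zero_iff two_ne_zero |>.1 (by linarith))
    refine mem_pairSpectrum_of_quadratic binary_card_act binary_card_not_act one_ne_zero ?_ ?_ ?_
    · intro h
      apply hc1
      have : ((1 + Real.cos θ : ℝ) : ℂ) = 0 := by push_cast; exact_mod_cast h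
      have := Complex.ofReal_eq_zero.1 this
      linarith
    · intro h
      apply hc0
      have : ((Real.cos θ : ℝ) : ℂ) = 0 := by linear_combination h
      exact Complex.ofReal_eq_zero.1 this
    · rw [Nat.cast_one]
      convert ih using 1
      push_cast
      ring

/-- The eigenvalues `cos θ` that correspond to the odd multiples `θ` of `π / 2 ^ (m + 1)`. -/
def dyadicCosines : Set ℝ :=
  {c | ∃ (j : ℤ) (m : ℕ), c = Real.cos ((2 * j + 1) * Real.pi / 2 ^ (m + 1))}

theorem mem_closure_dyadicCosines {c : ℝ} (h1 : -1 ≤ c) (h2 : c ≤ 1) :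
    c ∈ closure dyadicCosines := by
  rw [Metric.mem_closure_iff]
  intro ε hε
  set θ := Real.arccos c with hθ
  obtain ⟨m, hm⟩ := exists_pow_lt_of_lt_one (show 0 < ε / Real.pi by positivity)
    (show (1 / 2 : ℝ) < 1 by norm_num)
  set j : ℤ := ⌊θ * 2 ^ m / Real.pi⌋
  have hj1 : (j : ℝ) ≤ θ * 2 ^ m / Real.pi := Int.floor_le _
  have hj2 : θ * 2 ^ m / Real.pi < j + 1 := Int.lt_floor_add_one _
  rw [le_div_iff₀ Real.pi_pos] at hj1
  rw [div_lt_iff₀ Real.pi_pos] at hj2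
  refine ⟨_, ⟨j, m, rfl⟩, ?_⟩
  -- The midpoint of the interval between consecutive multiples of `π / 2 ^ m` that contains `θ`.
  set φ := (2 * j + 1) * Real.pi / 2 ^ (m + 1) with hφ
  have hφ' : φ * 2 ^ m = (j + 1 / 2) * Real.pi := by
    rw [hφ, pow_succ]
    field_simp
  have hdist : |θ - φ| * 2 ^ m ≤ Real.pi := by
    have h2m : |(2 : ℝ) ^ m| = 2 ^ m := abs_of_pos (by positivity)
    rw [← h2m, ← abs_mul, abs_le, sub_mul, hφ']
    constructor <;> nlinarith [Real.pi_pos]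
  rw [← Real.cos_arccos h1 h2, ← hθ, Real.dist_eq]
  have hlip : |Real.cos θ - Real.cos φ| ≤ |θ - φ| := by
    have := Real.lipschitzWith_cos.dist_le_mul θ φ
    simpa [Real.dist_eq] using this
  refine hlip.trans_lt ?_
  rw [lt_div_iff₀ Real.pi_pos, div_pow, one_pow, div_mul_eq_mul_div, one_mul,
    div_lt_iff₀ (by positivity)] at hm
  have h2m : (0 : ℝ) < 2 ^ m := by positivity
  exact lt_of_mul_lt_mul_right (hdist.trans_lt hm) h2m.le

theorem closure_levelSpectrum_gensGTilde :
    closure (levelSpectrum gensGTilde) = Complex.ofReal '' Set.Icc 0 1 := by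
  have hmem := fun z => mem_levelSpectrum_iff (S := gensGTilde) (l := (1 : Fin 2))
    (act := fun _ => true) (α := 1 / 2) (β := 1 / 2) (γ := 0) (by norm_num)
    (fun F w => by rw [levelOperator_gensGTilde]; ring) z
  simp only [add_zero, div_self (show (1 / 2 : ℂ) ≠ 0 by norm_num)] at hmem
  apply Set.Subset.antisymm
  · refine closure_minimal (fun z hz => ?_) (isCompact_Icc.image Complex.continuous_ofReal).isClosed
    obtain ⟨n, hn⟩ := (hmem z).1 hz
    obtain ⟨c, hc, hy⟩ := binary_pairSpectrum_one hn
    have hc' := abs_le.1 ((sq_le_one_iff_abs_le_one c).1 hc)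
    exact ⟨(1 + c) / 2, ⟨by linarith, by linarith⟩, by push_cast; linear_combination -hy / 2⟩
  · rintro _ ⟨x, ⟨h0, h1⟩, rfl⟩
    have h := map_mem_closure (t := levelSpectrum gensGTilde)
      (f := fun c : ℝ => (((1 + c) / 2 : ℝ) : ℂ)) (by fun_prop)
      (mem_closure_dyadicCosines (c := 2 * x - 1) (by linarith) (by linarith)) ?_
    · rwa [show (1 + (2 * x - 1)) / 2 = x by ring] at h
    · rintro _ ⟨j, m, rfl⟩
      refine (hmem _).2 ⟨m + 1, ?_⟩
      convert cos_mem_pairSpectrum j m using 1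
      push_cast
      ring

/-- One step leads from `α = 1/2` to `α = p = 1`. In the coordinate `e = 4y - 3` it reads `e² = 5 +
4c` with `c` in `[-1, 1]`, which opens the gap `|e| < 1`. -/
theorem binary_pairSpectrum_half {n : ℕ} {y : ℂ}
    (h : y ∈ pairSpectrum (1 : Fin 2) (fun _ => true) (1 / 2) n) :
    ∃ e : ℝ, 1 ≤ e ^ 2 ∧ e ^ 2 ≤ 9 ∧ 4 * y - 3 = e := by
  cases n with
  | zero =>
    exact ⟨3, by norm_num, by norm_num, by rw [mem_pairSpectrum_zero h]; push_cast; ring⟩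
  | succ n =>
    rcases mem_pairSpectrum_succ binary_card_act binary_card_not_act (by norm_num) h with h | h | h
    · exact ⟨-3, by norm_num, by norm_num, by rw [h]; push_cast; ring⟩
    · exact ⟨1, by norm_num, by norm_num, by rw [h]; push_cast; ring⟩
    · rw [Nat.cast_one] at h
      obtain ⟨c, hc, hy⟩ := binary_pairSpectrum_one h
      have hc' := abs_le.1 ((sq_le_one_iff_abs_le_one c).1 hc)
      obtain ⟨x, hx, hx2⟩ := exists_real_of_sq_eq (z := 4 * y - 3) (r := 5 + 4 * c)
        (by linarith) (by
          push_cast at hy ⊢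
          linear_combination 4 * hy)
      exact ⟨x, by linarith, by linarith, hx⟩

theorem mem_pairSpectrum_half {m : ℕ} {j : ℤ} {c e : ℝ}
    (hc : c = Real.cos ((2 * j + 1) * Real.pi / 2 ^ (m + 1))) (he : e ^ 2 = 5 + 4 * c) (h1 : e ^ 2 ≠ 1)
    (h9 : e ^ 2 ≠ 9) :
    ((e : ℂ) + 3) / 4 ∈ pairSpectrum (1 : Fin 2) (fun _ => true) (1 / 2) (m + 2) := by
  refine mem_pairSpectrum_of_quadratic binary_card_act binary_card_not_act (by norm_num) ?_ ?_ ?_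
  · intro h
    apply h9
    have : (e : ℂ) = ((-3 : ℝ) : ℂ) := by push_cast; linear_combination 4 * h
    rw [Complex.ofReal_injective this]
    norm_num
  · intro h
    apply h1
    have : (e : ℂ) = ((1 : ℝ) : ℂ) := by push_cast; linear_combination 4 * h
    rw [Complex.ofReal_injective this]
    norm_num
  · rw [Nat.cast_one]
    convert cos_mem_pairSpectrum j m using 1
    rw [hc] at he
    have := congrArg Complex.ofReal he
    push_cast at this ⊢
    linear_combination this / 4

theorem closure_levelSpectrum_gensG : closure (levelSpectrum gensG) =
    Complex.ofReal '' (Set.Icc (-1 / 2) 0 ∪ Set.Icc (1 / 2) 1) := by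
  have hmem := fun z => mem_levelSpectrum_iff (S := gensG) (l := (1 : Fin 2))
    (act := fun _ => true) (α := 1 / 2) (β := 1) (γ := 1 / 2) (by norm_num)
    (fun F w => by rw [levelOperator_gensG]; ring) z
  simp only [div_one] at hmem
  apply Set.Subset.antisymm
  · refine closure_minimal (fun z hz => ?_)
      ((isCompact_Icc.union isCompact_Icc).image Complex.continuous_ofReal).isClosed
    obtain ⟨n, hn⟩ := (hmem z).1 hz
    obtain ⟨e, h1, h9, he⟩ := binary_pairSpectrum_half hn
    refine ⟨(e + 1) / 4, ?_, by push_cast; linear_combination -he / 4⟩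
    rcases le_total 0 e with h0 | h0
    · right
      constructor <;> nlinarith
    · left
      constructor <;> nlinarith
  · rintro _ ⟨x, hx, rfl⟩
    -- The operator is `P/2 + Q - 1/2`, so `x = y - 1/2` and `4y - 3 = 4x - 1`.
    set e := 4 * x - 1 with he
    have he2 : 1 ≤ e ^ 2 ∧ e ^ 2 ≤ 9 := by
      rcases hx with ⟨h1, h2⟩ | ⟨h1, h2⟩ <;> constructor <;> nlinarith
    obtain ⟨σ, hσ, hσe⟩ := exists_sign_mul_sqrt e
    have h := map_mem_closure (t := levelSpectrum gensG)
      (f := fun c : ℝ => (((1 + σ * √(5 + 4 * c)) / 4 : ℝ) : ℂ)) (by fun_prop)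
      (mem_closure_dyadicCosines (c := (e ^ 2 - 5) / 4) (by linarith) (by linarith)) ?_
    · rwa [show 5 + 4 * ((e ^ 2 - 5) / 4) = e ^ 2 by ring, ← hσe,
        show (1 + e) / 4 = x by rw [he]; ring] at h
    · rintro c ⟨j, m, hc⟩
      have hcos := Real.neg_one_le_cos ((2 * j + 1) * Real.pi / 2 ^ (m + 1))
      have hsq : (σ * √(5 + 4 * c)) ^ 2 = 5 + 4 * c := by
        rw [mul_pow, hσ, one_mul, Real.sq_sqrt (by linarith)]
      have hc2 : c ^ 2 ≠ 1 := by
        intro h1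
        have h2 := Real.sin_sq_add_cos_sq ((2 * j + 1) * Real.pi / 2 ^ (m + 1))
        rw [← hc, h1] at h2
        exact sin_dyadic_ne_zero j m (pow_eq_zero_iff two_ne_zero |>.1 (by linarith))
      refine (hmem _).2 ⟨m + 2, ?_⟩
      convert mem_pairSpectrum_half hc hsq ?_ ?_ using 1
      · push_cast
        ring
      · rw [hsq]
        intro h1
        exact hc2 (by rw [show c = -1 by linarith]; norm_num)
      · rw [hsq]
        intro h1
        exact hc2 (by rw [show c = 1 by linarith]; norm_num)

end BinarySpectrum

/-! Cantor sets and null sets as preimages. -/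

section Cantor

open Filter Topology

/-- A continuous section through `x` carries the points of `A` that accumulate at `g x` to points of
`B` that accumulate at `x`. -/
theorem preperfect_of_section {A B : Set ℝ} (hA : Preperfect A) (g : ℝ → ℝ)
    (h : ∀ x ∈ B, g x ∈ A ∧ ∃ s : ℝ → ℝ, Continuous s ∧ s (g x) = x ∧
      ∀ y ∈ A, s y ∈ B ∧ g (s y) = y) : Preperfect B := by
  intro x hx
  obtain ⟨hgx, s, hs, hsx, hsy⟩ := h x hx
  rw [accPt_iff_nhds]
  intro U hU
  have hV : s ⁻¹' U ∈ 𝓝 (g x) := hs.continuousAt.preimage_mem_nhds (by rwa [hsx])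
  obtain ⟨y, ⟨hyU, hyA⟩, hne⟩ := accPt_iff_nhds.1 (hA _ hgx) _ hV
  refine ⟨s y, ⟨hyU, (hsy y hyA).1⟩, ?_⟩
  intro hxy
  apply hne
  rw [← (hsy y hyA).2, hxy]

theorem cantor_affine {A : Set ℝ} (hA : IsCantorSet A) (hA0 : volume A = 0) :
    IsCantorSet {w | 4 * w - 1 ∈ A} ∧ volume {w | 4 * w - 1 ∈ A} = 0 := by
  have himg : {w | 4 * w - 1 ∈ A} = (fun x => (x + 1) / 4) '' A := by
    ext w
    constructor
    · intro hw
      exact ⟨_, hw, by ring⟩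
    · rintro ⟨x, hx, rfl⟩
      change 4 * ((x + 1) / 4) - 1 ∈ A
      rwa [show 4 * ((x + 1) / 4) - 1 = x by ring]
  have hvol : volume {w | 4 * w - 1 ∈ A} = 0 := by
    rw [himg]
    exact addHaar_image_eq_zero_of_differentiableOn_of_addHaar_eq_zero _ (by fun_prop) hA0
  refine ⟨⟨?_, ?_, ?_, isTotallyDisconnected_of_volume_eq_zero hvol⟩, hvol⟩
  · rw [himg]
    exact hA.1.image _
  · rw [himg]
    exact hA.2.1.image (by fun_prop)
  · refine preperfect_of_section hA.2.2.1 (fun w => 4 * w - 1) fun x hx =>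
      ⟨hx, fun y => (y + 1) / 4, by fun_prop, by ring, fun y hy => ?_⟩
    have : 4 * ((y + 1) / 4) - 1 = y := by ring
    refine ⟨?_, this⟩
    change 4 * ((y + 1) / 4) - 1 ∈ A
    rwa [this]

theorem cantor_sqrt {A : Set ℝ} (hA : IsCantorSet A) (hA0 : volume A = 0)
    (hle : ∀ x ∈ A, 0 ≤ 9 / 2 + 2 * x) :
    IsCantorSet {y | (y ^ 2 - 9 / 2) / 2 ∈ A} ∧ volume {y | (y ^ 2 - 9 / 2) / 2 ∈ A} = 0 := by
  have hsq : ∀ σ : ℝ, σ ^ 2 = 1 → ∀ x ∈ A, ((σ * √(9 / 2 + 2 * x)) ^ 2 - 9 / 2) / 2 = x := by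
    intro σ hσ x hx
    rw [mul_pow, hσ, Real.sq_sqrt (hle x hx)]
    ring
  have hmem : ∀ y : ℝ, ∃ σ : ℝ, σ ^ 2 = 1 ∧ σ * √(9 / 2 + 2 * ((y ^ 2 - 9 / 2) / 2)) = y := by
    intro y
    obtain ⟨σ, hσ, hy⟩ := exists_sign_mul_sqrt y
    refine ⟨σ, hσ, ?_⟩
    rw [show 9 / 2 + 2 * ((y ^ 2 - 9 / 2) / 2) = y ^ 2 by ring, ← hy]
  have hvol : volume {y | (y ^ 2 - 9 / 2) / 2 ∈ A} = 0 := by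
    -- Differentiable images of null sets are null; the point `-9/4`, where the square root is not
    -- differentiable, only contributes `y = 0`.
    have himg : ∀ σ : ℝ, volume ((fun x => σ * √(9 / 2 + 2 * x)) '' (A \ {-9 / 4})) = 0 := by
      intro σ
      refine addHaar_image_eq_zero_of_differentiableOn_of_addHaar_eq_zero _ ?_
        (measure_mono_null Set.sdiff_subset hA0)
      intro x hx
      refine (DifferentiableAt.const_mul (DifferentiableAt.sqrt (by fun_prop) ?_)
        σ).differentiableWithinAt
      intro h
      exact hx.2 (by rw [Set.mem_singleton_iff]; linarith)
    refine measure_mono_null (t := ({0} ∪ (fun x => 1 * √(9 / 2 + 2 * x)) '' (A \ {-9 / 4})) ∪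
      (fun x => -1 * √(9 / 2 + 2 * x)) '' (A \ {-9 / 4})) ?_
      (measure_union_null (measure_union_null (by simp) (himg 1)) (himg (-1)))
    intro y hy
    by_cases h0 : y = 0
    · exact Or.inl (Or.inl h0)
    · obtain ⟨σ, hσ, hy2⟩ := hmem y
      have hmem' : (y ^ 2 - 9 / 2) / 2 ∈ A \ {-9 / 4} := by
        refine ⟨hy, fun h => h0 ?_⟩
        rw [Set.mem_singleton_iff] at h
        exact pow_eq_zero_iff two_ne_zero |>.1 (by linarith)
      rcases sq_eq_sq_iff_eq_or_eq_neg.1 (hσ.trans (one_pow 2).symm) with rfl | rfl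
      · exact Or.inl (Or.inr ⟨_, hmem', hy2⟩)
      · exact Or.inr ⟨_, hmem', hy2⟩
  refine ⟨⟨?_, ?_, ?_, isTotallyDisconnected_of_volume_eq_zero hvol⟩, hvol⟩
  · obtain ⟨x, hx⟩ := hA.1
    refine ⟨1 * √(9 / 2 + 2 * x), ?_⟩
    change ((1 * √(9 / 2 + 2 * x)) ^ 2 - 9 / 2) / 2 ∈ A
    rwa [hsq 1 (by norm_num) x hx]
  · refine Metric.isCompact_of_isClosed_isBounded (hA.2.1.isClosed.preimage (by fun_prop)) ?_
    obtain ⟨C, hC⟩ := isBounded_iff_forall_norm_le.1 hA.2.1.isBounded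
    refine isBounded_iff_forall_norm_le.2 ⟨2 * C + 9 / 2 + 1, fun y hy => ?_⟩
    have h1 := (abs_le.1 (hC _ hy)).2
    rw [Real.norm_eq_abs]
    have h2 : 0 ≤ y ^ 2 := sq_nonneg y
    exact abs_le_of_sq_le_sq (by nlinarith) (by linarith)
  · refine preperfect_of_section hA.2.2.1 (fun y => (y ^ 2 - 9 / 2) / 2) fun y hy => ⟨hy, ?_⟩
    obtain ⟨σ, hσ, hy2⟩ := hmem y
    refine ⟨fun x => σ * √(9 / 2 + 2 * x), by fun_prop, hy2, fun x hx => ?_⟩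
    refine ⟨?_, hsq σ hσ x hx⟩
    change ((σ * √(9 / 2 + 2 * x)) ^ 2 - 9 / 2) / 2 ∈ A
    rwa [hsq σ hσ x hx]

end Cantor

/-! The spectrum of the first group on the ternary tree. -/

section Gamma

open Filter Topology

theorem ofReal_iterate_quadratic (lam : ℝ) (n : ℕ) (q : ℝ) :
    (((fun y : ℝ => y ^ 2 - lam)^[n] q : ℝ) : ℂ) = (fun z : ℂ => z ^ 2 - (lam : ℂ))^[n] q := by
  induction n generalizing q with
  | zero => rfl
  | succ n ih =>
    rw [Function.iterate_succ_apply, Function.iterate_succ_apply, ih]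
    push_cast
    rfl

theorem isNestedRadical_iff {lam : ℝ} {z : ℂ} : IsNestedRadical lam z ↔
    ∃ n : ℕ, (fun z => z ^ 2 - (lam : ℂ))^[n + 1] z = 0 := by
  constructor
  · intro h
    induction h with
    | sqrt h => exact ⟨0, by simp [h]⟩
    | @step y z _ hz ih =>
      obtain ⟨n, hn⟩ := ih
      refine ⟨n + 1, ?_⟩
      rw [Function.iterate_succ_apply]
      simp only [hz, add_sub_cancel_left]
      exact hn
  · rintro ⟨n, hn⟩
    induction n generalizing z with
    | zero => exact .sqrt (sub_eq_zero.1 hn)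
    | succ n ih =>
      rw [Function.iterate_succ_apply] at hn
      exact .step (ih hn) (by ring)

theorem IsNestedRadical.neg {lam : ℝ} {z : ℂ} (h : IsNestedRadical lam z) :
    IsNestedRadical lam (-z) := by
  cases h with
  | sqrt h => exact .sqrt (by rw [neg_sq, h])
  | step h hz => exact .step h (by rw [neg_sq, hz])

/-- The bounds reproduce themselves: `|y| ≤ 3` gives `3 ≤ 6 + y ≤ 9`. -/
theorem IsNestedRadical.exists_real {z : ℂ} (h : IsNestedRadical 6 z) :
    ∃ x : ℝ, z = x ∧ 3 ≤ x ^ 2 ∧ x ^ 2 ≤ 9 := by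
  induction h with
  | sqrt h =>
    obtain ⟨x, hx, hx2⟩ := exists_real_of_sq_eq (by norm_num) h
    exact ⟨x, hx, by linarith, by linarith⟩
  | step _ hz ih =>
    obtain ⟨y, rfl, h1, h2⟩ := ih
    have hy := abs_le.1 (abs_le_of_sq_le_sq (show y ^ 2 ≤ 3 ^ 2 by linarith) (by norm_num))
    obtain ⟨x, hx, hx2⟩ := exists_real_of_sq_eq (r := 6 + y) (by linarith [hy.1]) (by
      rw [hz]; push_cast; rfl)
    exact ⟨x, hx, by linarith [hy.1], by linarith [hy.2]⟩

theorem six_fixed : (3 : ℝ) ^ 2 = 6 + 3 := by norm_num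

theorem six_lt : (1 : ℝ) / 4 < 6 - 3 := by norm_num

theorem mem_juliaSet_iff {lam β : ℝ} (hβ : β ^ 2 = lam + β) (hβ0 : 0 < β)
    (hlam : 1 / 4 < lam - β) {z : ℂ} : z ∈ juliaSet lam ↔ z ^ 2 - (lam : ℂ) ∈ juliaSet lam := by
  rw [juliaSet_eq_filledJuliaSet hβ hβ0 hlam]
  exact mem_filledJuliaSet_iff

theorem neg_mem_juliaSet {lam β : ℝ} (hβ : β ^ 2 = lam + β) (hβ0 : 0 < β)
    (hlam : 1 / 4 < lam - β) {z : ℂ} (h : z ∈ juliaSet lam) : -z ∈ juliaSet lam := by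
  rw [mem_juliaSet_iff hβ hβ0 hlam, neg_sq]
  exact (mem_juliaSet_iff hβ hβ0 hlam).1 h

theorem zero_notMem_juliaSet_six : (0 : ℂ) ∉ juliaSet 6 := by
  intro h
  have h1 : (0 : ℝ) ∈ realJuliaSet 6 := by
    change ((0 : ℝ) : ℂ) ∈ juliaSet 6
    rwa [Complex.ofReal_zero]
  have := le_sq_of_mem_realJuliaSet six_fixed (by norm_num) six_lt h1
  norm_num at this

/-- The orbit of a nested radical hits `0`, which is outside the completely invariant Julia set. -/
theorem IsNestedRadical.notMem_juliaSet {z : ℂ} (h : IsNestedRadical 6 z) : z ∉ juliaSet 6 := by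
  induction h with
  | sqrt h =>
    rw [mem_juliaSet_iff six_fixed (by norm_num) six_lt, h, sub_self]
    exact zero_notMem_juliaSet_six
  | step _ hz ih =>
    rw [mem_juliaSet_iff six_fixed (by norm_num) six_lt, hz, add_sub_cancel_left]
    exact ih

/-- For each `n`, a nested radical is either a zero of one of the first `n` iterates or is mapped by
the `n`-th iterate to another radical, of modulus at most `3`. Both conditions are closed, so a
limit that is not itself a radical has its whole orbit bounded by `3`. Conversely, the preimages of
`0` accumulate at every point of the Julia set. -/
theorem closure_nestedRadicals :
    closure {z | IsNestedRadical 6 z} = {z | IsNestedRadical 6 z} ∪ juliaSet 6 := by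
  apply Set.Subset.antisymm
  · intro z hz
    by_contra hnot
    rw [Set.mem_union, not_or] at hnot
    refine hnot.2 ?_
    rw [juliaSet_eq_filledJuliaSet six_fixed (by norm_num) six_lt,
      mem_filledJuliaSet_iff_norm_le six_fixed (by norm_num) six_lt]
    intro n
    have hclosed : IsClosed ((⋃ m ∈ Finset.range n,
        {z : ℂ | (fun z => z ^ 2 - ((6 : ℝ) : ℂ))^[m + 1] z = 0}) ∪
        {z | ‖(fun z => z ^ 2 - ((6 : ℝ) : ℂ))^[n] z‖ ≤ 3}) := by
      refine IsClosed.union ?_ (isClosed_le (continuous_iterate_quadratic n).norm continuous_const)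
      exact isClosed_biUnion_finset fun m _ =>
        isClosed_eq (continuous_iterate_quadratic (m + 1)) continuous_const
    have hsub : {z | IsNestedRadical 6 z} ⊆ (⋃ m ∈ Finset.range n,
        {z : ℂ | (fun z => z ^ 2 - ((6 : ℝ) : ℂ))^[m + 1] z = 0}) ∪
        {z | ‖(fun z => z ^ 2 - ((6 : ℝ) : ℂ))^[n] z‖ ≤ 3} := by
      intro r hr
      obtain ⟨m, hm⟩ := isNestedRadical_iff.1 hr
      by_cases hmn : m < n
      · exact Or.inl (Set.mem_biUnion (Finset.mem_coe.2 (Finset.mem_range.2 hmn)) hm)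
      · right
        have h1 : IsNestedRadical 6 ((fun z => z ^ 2 - ((6 : ℝ) : ℂ))^[n] r) := by
          refine isNestedRadical_iff.2 ⟨m - n, ?_⟩
          rw [← Function.iterate_add_apply, show m - n + 1 + n = m + 1 by omega]
          exact hm
        obtain ⟨x, hx, -, h9⟩ := h1.exists_real
        change ‖(fun z => z ^ 2 - ((6 : ℝ) : ℂ))^[n] r‖ ≤ 3
        rw [hx, Complex.norm_real]
        exact abs_le_of_sq_le_sq (by linarith) (by norm_num)
    rcases closure_minimal hsub hclosed hz with h | h
    · simp only [Set.mem_iUnion] at h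
      obtain ⟨m, -, hm⟩ := h
      exact absurd (isNestedRadical_iff.2 ⟨m, hm⟩) hnot.1
    · exact h
  · refine Set.union_subset subset_closure fun z hz => ?_
    rw [← image_realJuliaSet six_fixed (by norm_num) six_lt] at hz
    obtain ⟨x, hx, rfl⟩ := hz
    rw [Metric.mem_closure_iff]
    intro ε hε
    obtain ⟨N, hN⟩ := exists_iterate_eq_abs_lt six_fixed (by norm_num) six_lt hx hε
    obtain ⟨q, -, hq, hdist⟩ := hN (N + 1) (by omega) 0 (by norm_num)
    refine ⟨q, isNestedRadical_iff.2 ⟨N, ?_⟩, ?_⟩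
    · rw [← ofReal_iterate_quadratic, hq, Complex.ofReal_zero]
    · rw [Complex.dist_eq, ← Complex.ofReal_sub, Complex.norm_real, norm_sub_rev]
      exact hdist

theorem mem_quarterOnePM {A : Set ℂ} (hA : ∀ z ∈ A, -z ∈ A) {w : ℂ} :
    w ∈ quarterOnePM A ↔ 4 * w - 1 ∈ A := by
  constructor
  · rintro ⟨z, hz, rfl | rfl⟩
    · rwa [show 4 * ((1 + z) / 4) - 1 = z by ring]
    · rw [show 4 * ((1 - z) / 4) - 1 = -z by ring]
      exact hA z hz
  · intro h
    exact ⟨_, h, Or.inl (by ring)⟩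

/-- In the coordinate `4w - 1` the point `w = 1` is the fixed point `3`, already in the Julia set,
and `w = 1/4` is `0`. -/
theorem mem_spectrumGamma {w : ℂ} : w ∈ spectrumGamma ↔
    4 * w - 1 = 0 ∨ IsNestedRadical 6 (4 * w - 1) ∨ 4 * w - 1 ∈ juliaSet 6 := by
  rw [spectrumGamma, closure_nestedRadicals, Set.mem_union, mem_quarterOnePM (by
    rintro z (h | h)
    · exact Or.inl h.neg
    · exact Or.inr (neg_mem_juliaSet six_fixed (by norm_num) six_lt h))]
  have h3 : (3 : ℂ) ∈ juliaSet 6 := by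
    have := fixed_mem_realJuliaSet six_fixed (by norm_num) six_lt
    exact_mod_cast (show ((3 : ℝ) : ℂ) ∈ juliaSet 6 from this)
  constructor
  · rintro ((rfl | rfl) | h | h)
    · right; right
      rwa [show (4 : ℂ) * 1 - 1 = 3 by norm_num]
    · left
      norm_num
    · exact Or.inr (Or.inl h)
    · exact Or.inr (Or.inr h)
  · rintro (h | h | h)
    · left; right
      rw [Set.mem_singleton_iff]
      linear_combination h / 4
    · exact Or.inr (Or.inl h)
    · exact Or.inr (Or.inr h)

/-! ### Level eigenvalues when `p = i = 1` -/

section Pair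

variable {act : Fin 3 → Bool}

/-- The coordinate `x = 3(y - 1)` turns the recursion into `x ↦ x² - 6`. The eigenvalue `2` of level
zero and the exceptional values `0` and `1` become `3`, `-3` and `0`. -/
theorem gamma_pairSpectrum (hp : (Finset.univ.filter fun x => x ≠ 2 ∧ act x = true).card = 1)
    (hi : (Finset.univ.filter fun x => x ≠ 2 ∧ ¬ act x = true).card = 1) {n : ℕ} {y : ℂ}
    (h : y ∈ pairSpectrum 2 act 1 n) :
    3 * (y - 1) = 0 ∨ IsNestedRadical 6 (3 * (y - 1)) ∨ 3 * (y - 1) ∈ juliaSet 6 := by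
  have h3 : (3 : ℂ) ∈ juliaSet 6 := by
    have := fixed_mem_realJuliaSet six_fixed (by norm_num) six_lt
    exact_mod_cast (show ((3 : ℝ) : ℂ) ∈ juliaSet 6 from this)
  induction n generalizing y with
  | zero =>
    rw [mem_pairSpectrum_zero h]
    right; right
    rwa [show (3 : ℂ) * (1 + 1 - 1) = 3 by norm_num]
  | succ n ih =>
    rcases mem_pairSpectrum_succ hp hi one_ne_zero h with h | h | h
    · rw [h]
      right; right
      rw [show (3 : ℂ) * (0 - 1) = -3 by norm_num]
      exact neg_mem_juliaSet six_fixed (by norm_num) six_lt h3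
    · left
      rw [h]
      ring
    · rw [Nat.cast_one] at h
      have e : 3 * (((3 : ℕ) : ℂ) * ((y - 1) * (y - 1) / 1) - 1 - 1) =
          (3 * (y - 1)) ^ 2 - ((6 : ℝ) : ℂ) := by
        push_cast
        ring
      have ih' := ih h
      rw [e] at ih'
      rcases ih' with h | h | h
      · exact Or.inr (Or.inl (.sqrt (sub_eq_zero.1 h)))
      · exact Or.inr (Or.inl (.step h (by ring)))
      · exact Or.inr (Or.inr ((mem_juliaSet_iff six_fixed (by norm_num) six_lt).2 h))

/-- The backward orbit starts from `y = 1` on level one. It never meets the exceptional values: `-3`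
is in the Julia set, and nested radicals are nonzero. -/
theorem mem_gamma_pairSpectrum (hp : (Finset.univ.filter fun x => x ≠ 2 ∧ act x = true).card = 1)
    (hi : (Finset.univ.filter fun x => x ≠ 2 ∧ ¬ act x = true).card = 1) (n : ℕ) {q : ℂ}
    (h : (fun z => z ^ 2 - ((6 : ℝ) : ℂ))^[n] q = 0) :
    1 + q / 3 ∈ pairSpectrum 2 act 1 (n + 1) := by
  induction n generalizing q with
  | zero =>
    have : q = 0 := h
    rw [this, zero_div, add_zero]
    exact one_mem_pairSpectrum (by norm_num) 1
  | succ n ih =>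
    have hrad : IsNestedRadical 6 q := isNestedRadical_iff.2 ⟨n, h⟩
    refine mem_pairSpectrum_of_quadratic hp hi one_ne_zero (fun h0 => ?_) (fun h1 => ?_) ?_
    · have h3 : q = ((-3 : ℝ) : ℂ) := by push_cast; linear_combination 3 * h0
      refine hrad.notMem_juliaSet ?_
      rw [h3]
      exact neg_mem_realJuliaSet six_fixed (by norm_num) six_lt
        (fixed_mem_realJuliaSet six_fixed (by norm_num) six_lt)
    · obtain ⟨x, hx, hx3, -⟩ := hrad.exists_real
      have h3 : (x : ℂ) = 0 := by rw [← hx]; linear_combination 3 * h1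
      rw [Complex.ofReal_eq_zero.1 h3] at hx3
      norm_num at hx3
    · rw [Nat.cast_one]
      have := ih (q := q ^ 2 - ((6 : ℝ) : ℂ)) h
      convert this using 1
      push_cast
      ring

end Pair

theorem mem_levelSpectrum_ggs {ε₂ : Fin 3} {z : ℂ} :
    z ∈ levelSpectrum (ternaryGenerators (ggs 1 ε₂)) ↔ ∃ n, 1 + (4 * z - 1) / 3 ∈
      pairSpectrum 2 (fun x => decide ((![1, ε₂, 0] : Fin 3 → Fin 3) x ≠ 0)) 1 n := by
  have h := mem_levelSpectrum_iff (S := ternaryGenerators (ggs 1 ε₂)) (α := 3 / 4) (β := 3 / 4)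
    (γ := 1 / 2) (by norm_num) (levelOperator_ggs ε₂) z
  rw [h, div_self (by norm_num), show (z + 1 / 2) / (3 / 4) = 1 + (4 * z - 1) / 3 by ring]

theorem closure_levelSpectrum_gensGamma : closure (levelSpectrum gensGamma) = spectrumGamma := by
  apply Set.Subset.antisymm
  · have hclosed : IsClosed spectrumGamma := by
      have : spectrumGamma = (fun w : ℂ => 4 * w - 1) ⁻¹'
          ({0} ∪ closure {z | IsNestedRadical 6 z}) := by
        ext w
        rw [mem_spectrumGamma, closure_nestedRadicals]
        rfl
      rw [this]
      exact (isClosed_singleton.union isClosed_closure).preimage (by fun_prop)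
    refine closure_minimal (fun z hz => ?_) hclosed
    obtain ⟨n, hn⟩ := mem_levelSpectrum_ggs.1 hz
    have h := gamma_pairSpectrum (by decide) (by decide) hn
    rw [show 3 * (1 + (4 * z - 1) / 3 - 1) = 4 * z - 1 by ring] at h
    exact mem_spectrumGamma.2 h
  · intro w hw
    rcases mem_spectrumGamma.1 hw with h | h
    · refine subset_closure (mem_levelSpectrum_ggs.2 ⟨1, ?_⟩)
      exact mem_gamma_pairSpectrum (by decide) (by decide) 0 h
    · have hcl : 4 * w - 1 ∈ closure {z | IsNestedRadical 6 z} := by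
        rw [closure_nestedRadicals]
        exact h
      have := map_mem_closure (t := levelSpectrum gensGamma) (f := fun z : ℂ => (1 + z) / 4)
        (by fun_prop) hcl ?_
      · rwa [show (1 + (4 * w - 1)) / 4 = w by ring] at this
      · intro z hz
        obtain ⟨n, hn⟩ := isNestedRadical_iff.1 hz
        refine mem_levelSpectrum_ggs.2 ⟨n + 1 + 1, ?_⟩
        rw [show 4 * ((1 + z) / 4) - 1 = z by ring]
        exact mem_gamma_pairSpectrum (by decide) (by decide) (n + 1) hn

/-- The points `0` and the nested radicals are isolated in their union with the Julia set. -/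
theorem exists_isOpen_inter_eq_singleton {x : ℝ} (hx : x = 0 ∨ IsNestedRadical 6 (x : ℂ)) :
    ∃ U : Set ℝ, IsOpen U ∧
      U ∩ {u | u = 0 ∨ IsNestedRadical 6 (u : ℂ) ∨ (u : ℂ) ∈ juliaSet 6} = {x} := by
  set X : Set ℝ := {u | u = 0 ∨ IsNestedRadical 6 (u : ℂ) ∨ (u : ℂ) ∈ juliaSet 6} with hX
  have hzero : ∃ U : Set ℝ, IsOpen U ∧ U ∩ X = {0} := by
    refine ⟨Metric.ball 0 1, Metric.isOpen_ball, ?_⟩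
    ext u
    rw [Set.mem_inter_iff, Metric.mem_ball, Real.dist_eq, sub_zero, Set.mem_singleton_iff]
    constructor
    · rintro ⟨hu, h | h | h⟩
      · exact h
      · obtain ⟨y, hy, hy3, -⟩ := h.exists_real
        rw [← Complex.ofReal_injective hy] at hy3
        have := (sq_lt_one_iff_abs_lt_one u).2 hu
        linarith
      · have := le_sq_of_mem_realJuliaSet six_fixed (by norm_num) six_lt h
        have := (sq_lt_one_iff_abs_lt_one u).2 hu
        linarith
    · rintro rfl
      exact ⟨by simp, Or.inl rfl⟩
  have hstep : ∀ x : ℝ, IsNestedRadical 6 (x : ℂ) →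
      (∃ V : Set ℝ, IsOpen V ∧ V ∩ X = {x ^ 2 - 6}) → ∃ U : Set ℝ, IsOpen U ∧ U ∩ X = {x} := by
    rintro x hx ⟨V, hV, hVX⟩
    have hx0 : x ≠ 0 := by
      rintro rfl
      obtain ⟨y, hy, hy3, -⟩ := hx.exists_real
      rw [← Complex.ofReal_injective hy] at hy3
      norm_num at hy3
    -- Isolation is pulled back along `u ↦ u² - 6`; the sign condition selects one of the two
    -- preimages.
    refine ⟨{u | u ^ 2 - 6 ∈ V} ∩ {u | 0 < u * x},
      (hV.preimage (by fun_prop)).inter (isOpen_lt continuous_const (by fun_prop)), ?_⟩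
    ext u
    constructor
    · rintro ⟨⟨huV, hux⟩, huX⟩
      simp only [Set.mem_ofPred_eq] at huV hux
      have hfX : u ^ 2 - 6 ∈ X := by
        rcases huX with rfl | h | h
        · simp at hux
        · cases h with
          | sqrt h =>
            left
            have : u ^ 2 = 6 := by exact_mod_cast h
            linarith
          | @step y _ h hz =>
            right; left
            have : ((u ^ 2 - 6 : ℝ) : ℂ) = y := by push_cast at hz ⊢; linear_combination hz
            rwa [this]
        · right; right
          have := (mem_juliaSet_iff six_fixed (by norm_num) six_lt).1 h
          exact_mod_cast this
      have h1 : u ^ 2 - 6 ∈ V ∩ X := ⟨huV, hfX⟩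
      rw [hVX, Set.mem_singleton_iff, sub_left_inj] at h1
      rcases sq_eq_sq_iff_eq_or_eq_neg.1 h1 with h2 | h2
      · exact h2
      · rw [h2] at hux
        nlinarith [sq_nonneg x]
    · rintro rfl
      have h1 : u ^ 2 - 6 ∈ V ∩ X := by rw [hVX]; rfl
      exact ⟨⟨h1.1, mul_self_pos.2 hx0⟩, Or.inr (Or.inl hx)⟩
  rcases hx with rfl | hx
  · exact hzero
  · have key : ∀ z : ℂ, IsNestedRadical 6 z → ∀ x : ℝ, z = x →
        ∃ U : Set ℝ, IsOpen U ∧ U ∩ X = {x} := by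
      intro z hz
      induction hz with
      | @sqrt z h =>
        rintro x rfl
        refine hstep x (.sqrt h) ?_
        have : x ^ 2 = 6 := by exact_mod_cast h
        rw [this, sub_self]
        exact hzero
      | @step y z hy h ih =>
        rintro x rfl
        refine hstep x (.step hy h) (ih _ ?_)
        push_cast at h ⊢
        linear_combination -h
    exact key _ hx x rfl

theorem spectrumGamma_decomposition : ∃ K I : Set ℝ,
    spectrumGamma = Complex.ofReal '' (K ∪ I) ∧ Disjoint K I ∧
      Complex.ofReal '' K = quarterOnePM (juliaSet 6) ∧ IsCantorSet K ∧ volume K = 0 ∧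
      Complex.ofReal '' I = {1 / 4} ∪ quarterOnePM {z | IsNestedRadical 6 z} ∧
      ∀ x ∈ I, ∃ U : Set ℝ, IsOpen U ∧ U ∩ (K ∪ I) = {x} := by
  set K : Set ℝ := {w | 4 * w - 1 ∈ realJuliaSet 6} with hK
  set I : Set ℝ := {w | 4 * w - 1 = 0 ∨ IsNestedRadical 6 ((4 * w - 1 : ℝ) : ℂ)} with hI
  obtain ⟨hcantor, hvol⟩ := cantor_affine
    (isCantorSet_realJuliaSet six_fixed (by norm_num) six_lt)
    (volume_realJuliaSet six_fixed (by norm_num) six_lt)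
  have hreal : ∀ (w : ℂ) (x : ℝ), 4 * w - 1 = x → ∃ v : ℝ, (v : ℂ) = w ∧ 4 * v - 1 = x := by
    intro w x h
    exact ⟨(x + 1) / 4, by push_cast; linear_combination -h / 4, by ring⟩
  have hKim : Complex.ofReal '' K = quarterOnePM (juliaSet 6) := by
    ext w
    rw [mem_quarterOnePM fun z hz => neg_mem_juliaSet six_fixed (by norm_num) six_lt hz]
    constructor
    · rintro ⟨v, hv, rfl⟩
      exact_mod_cast (show ((4 * v - 1 : ℝ) : ℂ) ∈ juliaSet 6 from hv)
    · intro h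
      rw [← image_realJuliaSet six_fixed (by norm_num) six_lt] at h
      obtain ⟨x, hx, hxw⟩ := h
      obtain ⟨v, rfl, hv⟩ := hreal w x hxw.symm
      refine ⟨v, ?_, rfl⟩
      change 4 * v - 1 ∈ realJuliaSet 6
      rwa [hv]
  have hIim : Complex.ofReal '' I = {1 / 4} ∪ quarterOnePM {z | IsNestedRadical 6 z} := by
    ext w
    rw [Set.mem_union, mem_quarterOnePM (A := {z | IsNestedRadical 6 z}) fun z hz =>
        IsNestedRadical.neg hz,
      Set.mem_singleton_iff]
    constructor
    · rintro ⟨v, hv | hv, rfl⟩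
      · left
        have : v = 1 / 4 := by linarith
        rw [this]
        push_cast
        rfl
      · right
        exact_mod_cast hv
    · rintro (rfl | h)
      · exact ⟨1 / 4, Or.inl (by norm_num), by push_cast; rfl⟩
      · obtain ⟨x, hx, -⟩ := IsNestedRadical.exists_real h
        obtain ⟨v, rfl, hv⟩ := hreal w x hx
        refine ⟨v, Or.inr ?_, rfl⟩
        exact_mod_cast h
  refine ⟨K, I, ?_, ?_, hKim, hcantor, hvol, hIim, ?_⟩
  · rw [Set.image_union, hKim, hIim]
    ext w
    rw [mem_spectrumGamma, Set.mem_union, Set.mem_union, Set.mem_singleton_iff,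
      mem_quarterOnePM fun z hz => neg_mem_juliaSet six_fixed (by norm_num) six_lt hz,
      mem_quarterOnePM (A := {z | IsNestedRadical 6 z}) fun z hz =>
        IsNestedRadical.neg hz, Set.mem_ofPred_eq]
    have : 4 * w - 1 = 0 ↔ w = 1 / 4 :=
      ⟨fun h => by linear_combination h / 4, fun h => by rw [h]; norm_num⟩
    rw [this]
    tauto
  · rw [Set.disjoint_left]
    rintro w hwK (h | h)
    · have := le_sq_of_mem_realJuliaSet six_fixed (by norm_num) six_lt hwK
      rw [h] at this
      norm_num at this
    · exact h.notMem_juliaSet hwK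
  · intro w hw
    obtain ⟨U, hU, hUX⟩ := exists_isOpen_inter_eq_singleton hw
    refine ⟨{v | 4 * v - 1 ∈ U}, hU.preimage (by fun_prop), ?_⟩
    ext v
    have h1 := Set.ext_iff.1 hUX (4 * v - 1)
    have h2 : 4 * v - 1 ∈ ({4 * w - 1} : Set ℝ) ↔ v ∈ ({w} : Set ℝ) := by
      simp only [Set.mem_singleton_iff]
      constructor <;> intro h <;> linarith
    rw [← h2, ← h1]
    refine and_congr_right fun _ => ?_
    change (_ ∨ _ ∨ _) ↔ (_ ∨ _ ∨ _)
    exact or_comm.trans or_assoc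

end Gamma

/-! The spectrum of the last two groups. -/

section GammaBar

theorem nine_quarters_fixed : (9 / 4 : ℝ) ^ 2 = 45 / 16 + 9 / 4 := by norm_num

theorem nine_quarters_lt : (1 : ℝ) / 4 < 45 / 16 - 9 / 4 := by norm_num

theorem mem_juliaSet_bar {z : ℂ} : z ∈ juliaSet (45 / 16) ↔ z ^ 2 - 45 / 16 ∈ juliaSet (45 / 16) := by
  have h := mem_juliaSet_iff nine_quarters_fixed (by norm_num) nine_quarters_lt (z := z)
  rwa [show ((45 / 16 : ℝ) : ℂ) = 45 / 16 by push_cast; rfl] at h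

theorem neg_mem_juliaSet_bar {z : ℂ} (h : z ∈ juliaSet (45 / 16)) : -z ∈ juliaSet (45 / 16) :=
  neg_mem_juliaSet nine_quarters_fixed (by norm_num) nine_quarters_lt h

theorem nine_quarters_mem_juliaSet : (9 / 4 : ℂ) ∈ juliaSet (45 / 16) := by
  have h := fixed_mem_realJuliaSet nine_quarters_fixed (by norm_num) nine_quarters_lt
  have h2 : ((9 / 4 : ℝ) : ℂ) ∈ juliaSet (45 / 16) := h
  rwa [show ((9 / 4 : ℝ) : ℂ) = 9 / 4 by push_cast; rfl] at h2

/-- The three extra points are redundant: `1` and `-1/2` correspond to the fixed point `9/4`, and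
`1/4` to its preimage `-9/4`. -/
theorem mem_spectrumGammaBar {w : ℂ} :
    w ∈ spectrumGammaBar ↔ ((4 * w - 1) ^ 2 - 9 / 2) / 2 ∈ juliaSet (45 / 16) := by
  have hsqrt : ∀ y : ℂ, y ∈ sqrtNineHalvesPM (juliaSet (45 / 16)) ↔
      (y ^ 2 - 9 / 2) / 2 ∈ juliaSet (45 / 16) := by
    intro y
    constructor
    · rintro ⟨z, hz, h | h⟩
      · rwa [h, show (9 / 2 + 2 * z - 9 / 2) / 2 = z by ring]
      · rw [h, show (9 / 2 - 2 * z - 9 / 2) / 2 = -z by ring]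
        exact neg_mem_juliaSet_bar hz
    · intro h
      exact ⟨_, h, Or.inl (by ring)⟩
  rw [spectrumGammaBar, Set.mem_union, mem_quarterOnePM (by
    intro y hy
    rw [hsqrt] at hy ⊢
    rwa [neg_sq]), hsqrt]
  refine or_iff_right_of_imp ?_
  rintro (rfl | rfl | rfl)
  · rw [show ((4 * (1 : ℂ) - 1) ^ 2 - 9 / 2) / 2 = 9 / 4 by norm_num]
    exact nine_quarters_mem_juliaSet
  · rw [show ((4 * (-1 / 2 : ℂ) - 1) ^ 2 - 9 / 2) / 2 = 9 / 4 by norm_num]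
    exact nine_quarters_mem_juliaSet
  · rw [show ((4 * (1 / 4 : ℂ) - 1) ^ 2 - 9 / 2) / 2 = -(9 / 4) by norm_num]
    exact neg_mem_juliaSet_bar nine_quarters_mem_juliaSet

theorem spectrumGammaBar_eq_image : spectrumGammaBar =
    Complex.ofReal '' {w | 4 * w - 1 ∈ {y : ℝ | (y ^ 2 - 9 / 2) / 2 ∈ realJuliaSet (45 / 16)}} := by
  have hiff : ∀ v : ℝ, (v : ℂ) ∈ spectrumGammaBar ↔
      ((4 * v - 1) ^ 2 - 9 / 2) / 2 ∈ realJuliaSet (45 / 16) := by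
    intro v
    rw [mem_spectrumGammaBar]
    change _ ↔ ((((4 * v - 1) ^ 2 - 9 / 2) / 2 : ℝ) : ℂ) ∈ juliaSet (45 / 16)
    push_cast
    rfl
  ext w
  constructor
  · intro hw
    have h := mem_spectrumGammaBar.1 hw
    rw [← image_realJuliaSet nine_quarters_fixed (by norm_num) nine_quarters_lt] at h
    obtain ⟨x, hx, hxw⟩ := h
    have hx2 := abs_le.1
      (abs_le_of_mem_realJuliaSet nine_quarters_fixed (by norm_num) nine_quarters_lt hx)
    obtain ⟨y, hy, -⟩ := exists_real_of_sq_eq (z := 4 * w - 1) (r := 9 / 2 + 2 * x)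
      (by linarith [hx2.1]) (by push_cast; linear_combination -2 * hxw)
    have hwr : w = (((y + 1) / 4 : ℝ) : ℂ) := by
      push_cast
      linear_combination hy / 4
    rw [hwr] at hw ⊢
    exact ⟨_, (hiff _).1 hw, rfl⟩
  · rintro ⟨v, hv, rfl⟩
    exact (hiff v).2 hv

theorem cantor_spectrumGammaBar : ∃ K : Set ℝ, spectrumGammaBar = Complex.ofReal '' K ∧
    IsCantorSet K ∧ volume K = 0 := by
  obtain ⟨h1, h2⟩ := cantor_sqrt
    (isCantorSet_realJuliaSet nine_quarters_fixed (by norm_num) nine_quarters_lt)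
    (volume_realJuliaSet nine_quarters_fixed (by norm_num) nine_quarters_lt) (fun x hx => by
      have := abs_le.1
        (abs_le_of_mem_realJuliaSet nine_quarters_fixed (by norm_num) nine_quarters_lt hx)
      linarith [this.1])
  exact ⟨_, spectrumGammaBar_eq_image, cantor_affine h1 h2⟩

theorem isClosed_spectrumGammaBar : IsClosed spectrumGammaBar := by
  obtain ⟨K, hK, hC, -⟩ := cantor_spectrumGammaBar
  rw [hK]
  exact (hC.2.1.image Complex.continuous_ofReal).isClosed

/-! ### Level eigenvalues when `p = 2` and `i = 0` -/

section Pair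

variable {act : Fin 3 → Bool}

/-- The coordinate `q = 3y/2 - 9/4` turns the recursion with `α = p = 2` into `q ↦ q² - 45/16`. The
values `y = 3, 0, 1` become `9/4`, `-9/4`, `-3/4`, which all end at the fixed point `9/4`. -/
theorem bar_pairSpectrum_two
    (hp : (Finset.univ.filter fun x => x ≠ 2 ∧ act x = true).card = 2)
    (hi : (Finset.univ.filter fun x => x ≠ 2 ∧ ¬ act x = true).card = 0) {n : ℕ} {y : ℂ}
    (h : y ∈ pairSpectrum 2 act 2 n) : 3 * y / 2 - 9 / 4 ∈ juliaSet (45 / 16) := by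
  induction n generalizing y with
  | zero =>
    rw [mem_pairSpectrum_zero h, show (3 * (2 + 1) / 2 - 9 / 4 : ℂ) = 9 / 4 by norm_num]
    exact nine_quarters_mem_juliaSet
  | succ n ih =>
    rcases mem_pairSpectrum_succ hp hi two_ne_zero h with h | h | h
    · rw [h, show (3 * 0 / 2 - 9 / 4 : ℂ) = -(9 / 4) by norm_num]
      exact neg_mem_juliaSet_bar nine_quarters_mem_juliaSet
    · rw [h, mem_juliaSet_bar, show ((3 * 1 / 2 - 9 / 4) ^ 2 - 45 / 16 : ℂ) = -(9 / 4) by norm_num]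
      exact neg_mem_juliaSet_bar nine_quarters_mem_juliaSet
    · rw [Nat.cast_two] at h
      have ih' := ih h
      rw [mem_juliaSet_bar]
      convert ih' using 1
      push_cast
      ring

/-- The first step goes from `α = 1` to `α = p = 2`, which gives `q = (e² - 9/2)/2` for `e = 3(y -
1)`. -/
theorem bar_pairSpectrum_one
    (hp : (Finset.univ.filter fun x => x ≠ 2 ∧ act x = true).card = 2)
    (hi : (Finset.univ.filter fun x => x ≠ 2 ∧ ¬ act x = true).card = 0) {n : ℕ} {y : ℂ}
    (h : y ∈ pairSpectrum 2 act 1 n) :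
    ((3 * (y - 1)) ^ 2 - 9 / 2) / 2 ∈ juliaSet (45 / 16) := by
  cases n with
  | zero =>
    rw [mem_pairSpectrum_zero h,
      show ((3 * ((1 : ℂ) + 1 - 1)) ^ 2 - 9 / 2) / 2 = 9 / 4 by norm_num]
    exact nine_quarters_mem_juliaSet
  | succ n =>
    rcases mem_pairSpectrum_succ hp hi one_ne_zero h with h | h | h
    · rw [h, show ((3 * ((0 : ℂ) - 1)) ^ 2 - 9 / 2) / 2 = 9 / 4 by norm_num]
      exact nine_quarters_mem_juliaSet
    · rw [h, show ((3 * ((1 : ℂ) - 1)) ^ 2 - 9 / 2) / 2 = -(9 / 4) by norm_num]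
      exact neg_mem_juliaSet_bar nine_quarters_mem_juliaSet
    · rw [Nat.cast_two] at h
      have h' := bar_pairSpectrum_two hp hi h
      convert h' using 1
      push_cast
      ring

theorem sq_iterate_bar (n : ℕ) {q : ℂ} (h : q ^ 2 = 81 / 16) :
    ((fun z : ℂ => z ^ 2 - ((45 / 16 : ℝ) : ℂ))^[n] q) ^ 2 = 81 / 16 := by
  induction n generalizing q with
  | zero => exact h
  | succ n ih =>
    rw [Function.iterate_succ_apply]
    refine ih ?_
    rw [h]
    push_cast
    norm_num

/-- The points `±9/4` are mapped to the fixed point `9/4`, so their orbits never reach `-3/4`. This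
excludes the exceptional eigenvalues along backward orbits of `-3/4`. -/
theorem sq_ne_of_iterate_bar {n : ℕ} {q : ℂ}
    (h : (fun z : ℂ => z ^ 2 - ((45 / 16 : ℝ) : ℂ))^[n] q = -3 / 4) : q ^ 2 ≠ 81 / 16 := by
  intro hq
  have h1 := sq_iterate_bar n hq
  rw [h] at h1
  norm_num at h1

/-- The backward orbit starts at `q = -3/4`, the coordinate of the eigenvalue `1` of level one. The
exceptional `y = 0` is `q = -9/4`, and `y = 1` is `q = -3/4`, whose next iterate is `-9/4`. -/
theorem mem_bar_pairSpectrum_two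
    (hp : (Finset.univ.filter fun x => x ≠ 2 ∧ act x = true).card = 2)
    (hi : (Finset.univ.filter fun x => x ≠ 2 ∧ ¬ act x = true).card = 0) (n : ℕ) {q : ℂ}
    (h : (fun z : ℂ => z ^ 2 - ((45 / 16 : ℝ) : ℂ))^[n] q = -3 / 4) :
    2 / 3 * q + 3 / 2 ∈ pairSpectrum 2 act 2 (n + 1) := by
  induction n generalizing q with
  | zero =>
    have : q = -3 / 4 := h
    rw [this, show (2 / 3 * (-3 / 4) + 3 / 2 : ℂ) = 1 by norm_num]
    exact one_mem_pairSpectrum (by norm_num) 2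
  | succ n ih =>
    refine mem_pairSpectrum_of_quadratic hp hi two_ne_zero (fun h0 => ?_) (fun h1 => ?_) ?_
    · refine sq_ne_of_iterate_bar h ?_
      rw [show q = -9 / 4 by linear_combination 3 / 2 * h0]
      norm_num
    · rw [Function.iterate_succ_apply] at h
      refine sq_ne_of_iterate_bar h ?_
      rw [show q = -3 / 4 by linear_combination 3 / 2 * h1]
      push_cast
      norm_num
    · rw [Nat.cast_two]
      have := ih (q := q ^ 2 - ((45 / 16 : ℝ) : ℂ)) h
      convert this using 1
      push_cast
      ring

theorem mem_bar_pairSpectrum_one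
    (hp : (Finset.univ.filter fun x => x ≠ 2 ∧ act x = true).card = 2)
    (hi : (Finset.univ.filter fun x => x ≠ 2 ∧ ¬ act x = true).card = 0) (n : ℕ) {q e : ℂ}
    (h : (fun z : ℂ => z ^ 2 - ((45 / 16 : ℝ) : ℂ))^[n] q = -3 / 4)
    (he : e ^ 2 = 9 / 2 + 2 * q) : 1 + e / 3 ∈ pairSpectrum 2 act 1 (n + 2) := by
  refine mem_pairSpectrum_of_quadratic hp hi one_ne_zero (fun h0 => ?_) (fun h1 => ?_) ?_
  · refine sq_ne_of_iterate_bar h ?_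
    rw [show e = -3 by linear_combination 3 * h0] at he
    rw [show q = 9 / 4 by linear_combination -he / 2]
    norm_num
  · refine sq_ne_of_iterate_bar h ?_
    rw [show e = 0 by linear_combination 3 * h1] at he
    rw [show q = -9 / 4 by linear_combination -he / 2]
    norm_num
  · rw [Nat.cast_two]
    have := mem_bar_pairSpectrum_two hp hi n h
    convert this using 1
    push_cast
    linear_combination he / 3

end Pair

theorem closure_levelSpectrum_bar {ε₂ : Fin 3} (hε : ε₂ ≠ 0) :
    closure (levelSpectrum (ternaryGenerators (ggs 1 ε₂))) = spectrumGammaBar := by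
  have hp : (Finset.univ.filter fun x : Fin 3 => x ≠ 2 ∧
      decide ((![1, ε₂, 0] : Fin 3 → Fin 3) x ≠ 0) = true).card = 2 := by
    revert hε ε₂
    decide
  have hi : (Finset.univ.filter fun x : Fin 3 => x ≠ 2 ∧
      ¬ decide ((![1, ε₂, 0] : Fin 3 → Fin 3) x ≠ 0) = true).card = 0 := by
    revert hε ε₂
    decide
  apply Set.Subset.antisymm
  · refine closure_minimal (fun z hz => ?_) isClosed_spectrumGammaBar
    obtain ⟨n, hn⟩ := mem_levelSpectrum_ggs.1 hz
    have h := bar_pairSpectrum_one hp hi hn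
    rw [show 3 * (1 + (4 * z - 1) / 3 - 1) = 4 * z - 1 by ring] at h
    exact mem_spectrumGammaBar.2 h
  · intro w hw
    rw [spectrumGammaBar_eq_image] at hw
    obtain ⟨v, hv, rfl⟩ := hw
    obtain ⟨σ, hσ, hvσ⟩ := exists_sign_mul_sqrt (4 * v - 1)
    -- The backward orbit of `-3/4` accumulates at every point of the Julia set; the bound `|q| ≤
    -- 9/4` keeps `9/2 + 2q` nonnegative, so that the real square root applies.
    have hcl : ((4 * v - 1) ^ 2 - 9 / 2) / 2 ∈ closure {q : ℝ | |q| ≤ 9 / 4 ∧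
        ∃ n : ℕ, (fun y : ℝ => y ^ 2 - 45 / 16)^[n] q = -3 / 4} := by
      rw [Metric.mem_closure_iff]
      intro ε hε0
      obtain ⟨N, hN⟩ := exists_iterate_eq_abs_lt nine_quarters_fixed (by norm_num)
        nine_quarters_lt hv hε0
      obtain ⟨q, hq, hqN, hdist⟩ := hN N le_rfl (-3 / 4) (by norm_num [abs_le])
      refine ⟨q, ⟨hq, N, hqN⟩, ?_⟩
      rwa [dist_comm, Real.dist_eq]
    have h := map_mem_closure (t := levelSpectrum (ternaryGenerators (ggs 1 ε₂)))
      (f := fun c : ℝ => (((1 + σ * √(9 / 2 + 2 * c)) / 4 : ℝ) : ℂ)) (by fun_prop) hcl ?_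
    · rwa [show 9 / 2 + 2 * (((4 * v - 1) ^ 2 - 9 / 2) / 2) = (4 * v - 1) ^ 2 by ring, ← hvσ,
        show (1 + (4 * v - 1)) / 4 = v by ring] at h
    · rintro q ⟨hq, n, hn⟩
      refine mem_levelSpectrum_ggs.2 ⟨n + 2, ?_⟩
      have he : (σ * √(9 / 2 + 2 * q)) ^ 2 = 9 / 2 + 2 * q := by
        rw [mul_pow, hσ, one_mul, Real.sq_sqrt (by linarith [(abs_le.1 hq).1])]
      have hn' : (fun z : ℂ => z ^ 2 - ((45 / 16 : ℝ) : ℂ))^[n] q = -3 / 4 := by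
        rw [← ofReal_iterate_quadratic, hn]
        push_cast
        rfl
      have := mem_bar_pairSpectrum_one hp hi n (e := ((σ * √(9 / 2 + 2 * q) : ℝ) : ℂ)) hn'
        (by rw [← Complex.ofReal_pow, he]; push_cast; rfl)
      convert this using 2
      push_cast
      ring

end GammaBar

end FractalSpectra

open FractalSpectra in
theorem mainTheorem1 :
    (spectrum ℂ (parabolicMarkov gensG gensG_symm) =
        Complex.ofReal '' (Set.Icc (-1 / 2) 0 ∪ Set.Icc (1 / 2) 1) ∧
      spectrum ℂ (heckeOperator gensG) =
        Complex.ofReal '' (Set.Icc (-1 / 2) 0 ∪ Set.Icc (1 / 2) 1)) ∧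
    (spectrum ℂ (parabolicMarkov gensGTilde gensGTilde_symm) = Complex.ofReal '' Set.Icc 0 1 ∧
      spectrum ℂ (heckeOperator gensGTilde) = Complex.ofReal '' Set.Icc 0 1) ∧
    (spectrum ℂ (parabolicMarkov gensGamma (ternaryGenerators_symm _)) = spectrumGamma ∧
      spectrum ℂ (heckeOperator gensGamma) = spectrumGamma ∧
      ∃ K I : Set ℝ, spectrumGamma = Complex.ofReal '' (K ∪ I) ∧ Disjoint K I ∧
        Complex.ofReal '' K = quarterOnePM (juliaSet 6) ∧
        IsCantorSet K ∧ MeasureTheory.volume K = 0 ∧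
        Complex.ofReal '' I = {1 / 4} ∪ quarterOnePM {z | IsNestedRadical 6 z} ∧
        ∀ x ∈ I, ∃ U : Set ℝ, IsOpen U ∧ U ∩ (K ∪ I) = {x}) ∧
    (spectrum ℂ (parabolicMarkov gensGammaBar (ternaryGenerators_symm _)) = spectrumGammaBar ∧
      spectrum ℂ (heckeOperator gensGammaBar) = spectrumGammaBar) ∧
    (spectrum ℂ (parabolicMarkov gensGammaBarBar (ternaryGenerators_symm _)) = spectrumGammaBar ∧
      spectrum ℂ (heckeOperator gensGammaBarBar) = spectrumGammaBar) ∧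
    ∃ K : Set ℝ, spectrumGammaBar = Complex.ofReal '' K ∧
      IsCantorSet K ∧ MeasureTheory.volume K = 0 := by
  have nearG : ActsNearby (k := 1) gensG := binary_nearby
    (by intro x; fin_cases x <;> rfl) rfl (by intro q y; cases q <;> fin_cases y <;> rfl)
  have flipG : FlipsLetters (k := 1) gensG := binary_flips
    (by intro x; fin_cases x <;> rfl) (by intro x; fin_cases x <;> rfl) rfl rfl rfl rfl rfl
  have nearT : ActsNearby (k := 1) gensGTilde := binary_nearby
    (by intro x; fin_cases x <;> rfl) rfl (by intro q y; cases q <;> fin_cases y <;> rfl)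
  have flipT : FlipsLetters (k := 1) gensGTilde := binary_flips
    (by intro x; fin_cases x <;> rfl) (by intro x; fin_cases x <;> rfl) rfl rfl rfl rfl rfl
  refine ⟨⟨?_, ?_⟩, ⟨?_, ?_⟩, ⟨?_, ?_, spectrumGamma_decomposition⟩, ⟨?_, ?_⟩, ⟨?_, ?_⟩,
    cantor_spectrumGammaBar⟩
  · exact (spectrum_parabolicMarkov le_rfl _ nearG flipG).trans closure_levelSpectrum_gensG
  · exact (spectrum_heckeOperator gensG_symm).trans closure_levelSpectrum_gensG
  · exact (spectrum_parabolicMarkov le_rfl _ nearT flipT).trans closure_levelSpectrum_gensGTilde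
  · exact (spectrum_heckeOperator gensGTilde_symm).trans closure_levelSpectrum_gensGTilde
  · exact (spectrum_parabolicMarkov one_le_two _ (ggs_nearby 1 0) (ggs_flips 0)).trans
      closure_levelSpectrum_gensGamma
  · exact (spectrum_heckeOperator (ternaryGenerators_symm _)).trans closure_levelSpectrum_gensGamma
  · exact (spectrum_parabolicMarkov one_le_two _ (ggs_nearby 1 1) (ggs_flips 1)).trans
      (closure_levelSpectrum_bar (by decide))
  · exact (spectrum_heckeOperator (ternaryGenerators_symm _)).trans
      (closure_levelSpectrum_bar (by decide))
  · exact (spectrum_parabolicMarkov one_le_two _ (ggs_nearby 1 2) (ggs_flips 2)).trans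
      (closure_levelSpectrum_bar (by decide))
  · exact (spectrum_heckeOperator (ternaryGenerators_symm _)).trans
      (closure_levelSpectrum_bar (by decide))
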